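/- Let $q\ge 2$ be an integer and let $\mathcal X$ be the homogeneous tree of degree $q+1$ (a connected graph without cycles in which every vertex has $q+1$ neighbours), with graph distance $d$, fixed origin $o$, and $|x|=d(o,x)$. Let $1\le p<2$ and $S_p=\{z\in\mathbb C:|\Im z|\le |1/p-1/2|\}$. Let $\mathcal S_p(\mathcal X)$ be the space of all $\phi:\mathcal X\to\mathbb C$ with $\nu_{p,m}(\phi)=\sup_{x}(1+|x|)^m q^{|x|/p}|\phi(x)|<\infty$ for every integer $m\ge 0$. An $L^p$-tempered distribution is a linear functional $T$ on $\mathcal S_p(\mathcal X)$ such that $\langle T,\phi_n\rangle\to 0$ whenever $\nu_{p,m}(\phi_n)\to 0$ for every $m$. For $z\in\mathbb C$ let $\gamma(z)=1-\frac{q^{1/2+iz}+q^{1/2-iz}}{q+1}$, and let $\phi_z$ be the elementary spherical function, that is, the unique function on $\mathcal X$ that depends only on $|x|$, satisfies $\phi_z(o)=1$, and satisfies $\phi_z(x)-\frac1{q+1}\sum_{d(x,y)=1}\phi_z(y)=\gamma(z)\phi_z(x)$ for all $x$. A multiplier on $\mathcal S_p(\mathcal X)$ is an operator $\Lambda\phi=\phi*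 k$, $(\phi* k)(x)=\sum_{y}\phi(y)\,k(d(x,y))$, with $k$ a radial function (written as a function of the distance from $o$), that is well defined on $\mathcal S_p(\mathcal X)$, maps it into itself, and satisfies: for every $m$ there is $C_m>0$ with $\nu_{p,m}(\Lambda\phi)\le C_m\,\nu_{p,m}(\phi)$ for all $\phi\in\mathcal S_p(\mathcal X)$. Its symbol is $\kappa(z)=\sum_{x}k(|x|)\phi_z(x)$, $z\in S_p$, and it acts on $L^p$-tempered distributions by $\langle\Lambda T,\phi\rangle=\langle T,\Lambda\phi\rangle$. Theorem. Let $\Lambda$ be a multiplier on $\mathcal S_p(\mathcal X)$ whose symbol satisfies $\kappa(z)\neq 0$ for all $z\in S_p$. Let $A\in\mathbb C\setminus\{0\}$, and let $(T_k)_{k\ge 0}$ be a sequence of $L^p$-tempered distributions such that (i) $\Lambda T_k=A\,T_{k+1}$ for all $k\ge 0$; (ii) for some integer $m\ge 0$ and some $M>0$, $|\langle T_k,\phi\rangle|\le M\,\nu_{p,m}(\phi)$ for all $k\ge 0$ and all $\phi\in\mathcal S_p(\mathcal X)$. Then: (a) If $|A|=\min\{|\kappa(z)|:z\in S_p\}$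 and $\kappa(S_p)\cap\{w\in\mathbb C:|w|=|A|\}$ consists of finitely many distinct points $A_1,\dots,A_j$, then $T_0$ can be uniquely written as $T_0=T_{0,1}+\dots+T_{0,j}$ with $L^p$-tempered distributions $T_{0,i}$ satisfying $\Lambda T_{0,i}=A_iT_{0,i}$ for $i=1,\dots,j$. (b) If $|A|<\min\{|\kappa(z)|:z\in S_p\}$, then $T_0=0$. -/

import Mathlib

open Filter Topology

noncomputable section

namespace HomogeneousTree

/-! ### Strip, Laplacian and spherical functions -/

/-- The closed strip `S_p = {z : |Im z| ≤ |1/p - 1/2|}`. -/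
def strip (p : ℝ) : Set ℂ := {z | |z.im| ≤ |1 / p - 1 / 2|}

/-- The function `γ(z) = 1 - (q^{1/2+iz} + q^{1/2-iz}) / (q+1)`. -/
def gamma (q : ℕ) (z : ℂ) : ℂ :=
  1 - ((q : ℂ) ^ (1 / 2 + Complex.I * z) + (q : ℂ) ^ (1 / 2 - Complex.I * z)) / ((q : ℂ) + 1)

/-- The Laplacian `f(x) - (q+1)⁻¹ ∑_{d(x,y)=1} f(y)` of a graph all of whose vertices have `q+1`
neighbours. -/
def laplacian {X : Type*} (G : SimpleGraph X) [G.LocallyFinite] (q : ℕ) (f : X → ℂ) (x : X) : ℂ :=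
  f x - (∑ y ∈ G.neighborFinset x, f y) / ((q : ℂ) + 1)

/-- The elementary spherical function `φ_z` of the homogeneous tree of degree `q+1`, written as a
function of `n = |x| = d(o,x)`. It is the unique radial eigenfunction of the Laplacian with
eigenvalue `γ(z)` and value `1` at the origin `o`: the two recursions below are the eigenvalue
equation at `o` and at a vertex with `|x| = n + 1`
(see `laplacian_spherical` and `eq_spherical_of_laplacian_eq`). -/
def spherical (q : ℕ) (z : ℂ) : ℕ → ℂ
  | 0 => 1
  | 1 => 1 - gamma q z
  | n + 2 => (((q : ℂ) + 1) * (1 - gamma q z) * spherical q z (n + 1) - spherical q z n) / (q : ℂ)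

/-- In a tree, a vertex other than `o` has exactly one neighbour that is closer to `o`. -/
theorem exists_unique_parent {X : Type*} {G : SimpleGraph X} (hG : G.IsTree) (o x : X)
    (hx : x ≠ o) :
    ∃ y, G.Adj x y ∧ G.dist o x = G.dist o y + 1 ∧
      ∀ w, G.Adj x w → w ≠ y → G.dist o w = G.dist o x + 1 := by
  obtain ⟨P, hP, hPl⟩ := hG.connected.exists_path_of_dist o x
  have hnil : ¬ P.Nil := fun h => hx h.eq.symm
  have hadj : G.Adj x P.penultimate := (P.adj_penultimate hnil).symm
  -- a neighbour of `x` that is not farther from `o` is the last but one vertex of `P`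
  have key : ∀ w, G.Adj x w → G.dist o x = G.dist o w + 1 → w = P.penultimate := by
    intro w hw hd
    obtain ⟨Q, hQ, hQl⟩ := hG.connected.exists_path_of_dist o w
    have hxQ : x ∉ Q.support := by
      intro hmem
      classical
      have h1 : G.dist o x ≤ Q.length :=
        (G.dist_le (Q.takeUntil x hmem)).trans (Q.length_takeUntil_le_length hmem)
      omega
    have hwP : w ∈ P.support :=
      hG.isAcyclic.mem_support_of_ne_mem_support_of_adj_of_isPath hP hQ hw hxQ
    exact hG.isAcyclic.eq_penultimate_of_adj_end hP hw hwP
  have hex : G.dist o x = G.dist o P.penultimate + 1 := by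
    rcases hG.dist_eq_dist_add_one_of_adj o hadj with h | h
    · exact h
    · exfalso
      have h1 := G.dist_le P.dropLast
      have h2 : P.dropLast.length ≤ P.length := by
        simp
      omega
  refine ⟨P.penultimate, hadj, hex, fun w hw hne => ?_⟩
  rcases hG.dist_eq_dist_add_one_of_adj o hw with h | h
  · exact absurd (key w hw h) hne
  · exact h

/-- The sum of a radial function over the neighbours of the origin. -/
theorem sum_neighbors_origin {X : Type*} {G : SimpleGraph X} [G.LocallyFinite] {q : ℕ}
    (hreg : G.IsRegularOfDegree (q + 1)) (o : X) (f : ℕ → ℂ) :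
    ∑ y ∈ G.neighborFinset o, f (G.dist o y) = ((q : ℂ) + 1) * f 1 := by
  have h : ∀ y ∈ G.neighborFinset o, f (G.dist o y) = f 1 := by
    intro y hy
    rw [SimpleGraph.mem_neighborFinset] at hy
    rw [SimpleGraph.dist_eq_one_iff_adj.2 hy]
  rw [Finset.sum_congr rfl h, Finset.sum_const, SimpleGraph.card_neighborFinset_eq_degree, hreg o]
  simp

/-- The sum of a radial function over the neighbours of a vertex at distance `n + 1` from the
origin: one neighbour is at distance `n`, the other `q` are at distance `n + 2`. -/
theorem sum_neighbors {X : Type*} {G : SimpleGraph X} [G.LocallyFinite] {q : ℕ}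
    (hG : G.IsTree) (hreg : G.IsRegularOfDegree (q + 1)) (o x : X) (n : ℕ)
    (hn : G.dist o x = n + 1) (f : ℕ → ℂ) :
    ∑ y ∈ G.neighborFinset x, f (G.dist o y) = f n + (q : ℂ) * f (n + 2) := by
  classical
  have hx : x ≠ o := by
    rintro rfl
    simp at hn
  obtain ⟨y, hy, hd, hw⟩ := exists_unique_parent hG o x hx
  have hmem : y ∈ G.neighborFinset x := by rwa [SimpleGraph.mem_neighborFinset]
  have h : ∀ w ∈ (G.neighborFinset x).erase y, f (G.dist o w) = f (n + 2) := by
    intro w hw'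
    rw [Finset.mem_erase, SimpleGraph.mem_neighborFinset] at hw'
    rw [hw w hw'.2 hw'.1, hn]
  rw [← Finset.add_sum_erase _ _ hmem, Finset.sum_congr rfl h, Finset.sum_const,
    Finset.card_erase_of_mem hmem, SimpleGraph.card_neighborFinset_eq_degree, hreg x]
  have : G.dist o y = n := by omega
  simp [this]

/-- `x ↦ φ_z(|x|)` is an eigenfunction of the Laplacian with eigenvalue `γ(z)`. -/
theorem laplacian_spherical {X : Type*} {G : SimpleGraph X} [G.LocallyFinite] {q : ℕ} (hq : q ≠ 0)
    (hG : G.IsTree) (hreg : G.IsRegularOfDegree (q + 1)) (o : X) (z : ℂ) (x : X) :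
    laplacian G q (fun y => spherical q z (G.dist o y)) x
      = gamma q z * spherical q z (G.dist o x) := by
  have hq0 : (q : ℂ) ≠ 0 := by exact_mod_cast hq
  have hq1 : (q : ℂ) + 1 ≠ 0 := by exact_mod_cast Nat.succ_ne_zero q
  unfold laplacian
  rcases hn : G.dist o x with _ | n
  · have hx : o = x := (hG.connected.dist_eq_zero_iff).1 hn
    subst hx
    rw [sum_neighbors_origin hreg o (spherical q z)]
    simp only [SimpleGraph.dist_self, spherical]
    field_simp
    ring
  · rw [sum_neighbors hG hreg o x n hn (spherical q z)]
    simp only [hn, spherical]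
    field_simp
    ring

/-- Every radial eigenfunction of the Laplacian with eigenvalue `γ(z)` and value `1` at the origin
is `φ_z`. -/
theorem eq_spherical_of_laplacian_eq {X : Type*} {G : SimpleGraph X} [G.LocallyFinite] {q : ℕ}
    (hq : q ≠ 0) (hG : G.IsTree) (hreg : G.IsRegularOfDegree (q + 1)) (o : X) (z : ℂ) (f : ℕ → ℂ)
    (h0 : f 0 = 1)
    (hf : ∀ x, laplacian G q (fun y => f (G.dist o y)) x = gamma q z * f (G.dist o x)) (x : X) :
    f (G.dist o x) = spherical q z (G.dist o x) := by
  have hq0 : (q : ℂ) ≠ 0 := by exact_mod_cast hq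
  have hq1 : (q : ℂ) + 1 ≠ 0 := by exact_mod_cast Nat.succ_ne_zero q
  suffices H : ∀ n, ∀ x, G.dist o x = n → f n = spherical q z n from H _ x rfl
  intro n
  induction n using Nat.strong_induction_on with
  | _ n ih =>
    intro x hx
    match n, ih, hx with
    | 0, _, _ => simpa [spherical] using h0
    | 1, _, _ =>
      have := hf o
      unfold laplacian at this
      rw [sum_neighbors_origin hreg o f] at this
      simp only [SimpleGraph.dist_self, h0] at this
      rw [mul_div_cancel_left₀ _ hq1] at this
      simp only [spherical]
      linear_combination -this
    | n + 2, ih, hx =>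
      have hne : x ≠ o := by
        rintro rfl
        simp at hx
      obtain ⟨y, -, hy, -⟩ := exists_unique_parent hG o x hne
      have hy1 : G.dist o y = n + 1 := by omega
      have hney : y ≠ o := by
        rintro rfl
        simp at hy1
      obtain ⟨w, -, hw, -⟩ := exists_unique_parent hG o y hney
      have e1 := ih (n + 1) (by omega) y hy1
      have e0 := ih n (by omega) w (by omega)
      have := hf y
      unfold laplacian at this
      rw [sum_neighbors hG hreg o y n hy1 f] at this
      simp only [hy1] at this
      simp only [spherical]
      rw [← e1, ← e0, eq_div_iff hq0]
      field_simp at this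
      linear_combination -this

/-! ### Schwartz spaces and tempered distributions -/

variable {X : Type*} (G : SimpleGraph X) (q : ℕ) (p : ℝ) (o : X)

/-- The weight `(1 + |x|)^m q^{|x|/p}`, where `|x| = d(o,x)`. -/
def weight (m : ℕ) (x : X) : ℝ :=
  (1 + (G.dist o x : ℝ)) ^ m * (q : ℝ) ^ ((G.dist o x : ℝ) / p)

/-- The seminorm `ν_{p,m}(φ) = sup_x (1 + |x|)^m q^{|x|/p} |φ(x)|` (used for functions for which the
supremum is finite). -/
def nu (m : ℕ) (φ : X → ℂ) : ℝ := ⨆ x, weight G q p o m x * ‖φ x‖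

theorem weight_nonneg (m : ℕ) (x : X) : 0 ≤ weight G q p o m x := by
  unfold weight
  positivity

theorem nu_nonneg (m : ℕ) (φ : X → ℂ) : 0 ≤ nu G q p o m φ :=
  Real.iSup_nonneg fun x => mul_nonneg (weight_nonneg G q p o m x) (norm_nonneg _)

/-- The `p`-Schwartz space: all functions `φ` with `ν_{p,m}(φ) < ∞` for every `m`. -/
def Schwartz : Submodule ℂ (X → ℂ) where
  carrier := {φ | ∀ m : ℕ, BddAbove (Set.range fun x => weight G q p o m x * ‖φ x‖)}
  zero_mem' := by
    intro m
    refine ⟨0, ?_⟩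
    rintro _ ⟨x, rfl⟩
    simp
  add_mem' := by
    intro φ ψ hφ hψ m
    obtain ⟨a, ha⟩ := hφ m
    obtain ⟨b, hb⟩ := hψ m
    refine ⟨a + b, ?_⟩
    rintro _ ⟨x, rfl⟩
    have h1 := ha ⟨x, rfl⟩
    have h2 := hb ⟨x, rfl⟩
    have h3 := mul_le_mul_of_nonneg_left (norm_add_le (φ x) (ψ x)) (weight_nonneg G q p o m x)
    simp only [Pi.add_apply]
    simp only at h1 h2
    linarith
  smul_mem' := by
    intro c φ hφ m
    obtain ⟨a, ha⟩ := hφ m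
    refine ⟨‖c‖ * a, ?_⟩
    rintro _ ⟨x, rfl⟩
    have h1 := mul_le_mul_of_nonneg_left (ha ⟨x, rfl⟩) (norm_nonneg c)
    simp only [Pi.smul_apply, smul_eq_mul, norm_mul]
    simp only at h1
    linarith

/-- The space of `L^p`-tempered distributions: all linear functionals `T` on the `p`-Schwartz space
such that `T φ_n → 0` whenever `ν_{p,m}(φ_n) → 0` for every `m`. -/
def TemperedDist : Submodule ℂ (Schwartz G q p o →ₗ[ℂ] ℂ) where
  carrier := {T | ∀ φ : ℕ → Schwartz G q p o,
    (∀ m : ℕ, Tendsto (fun n => nu G q p o m (φ n : X → ℂ)) atTop (𝓝 0)) →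
      Tendsto (fun n => T (φ n)) atTop (𝓝 0)}
  zero_mem' := by
    intro φ _
    simp
  add_mem' := by
    intro S T hS hT φ hφ
    simpa using (hS φ hφ).add (hT φ hφ)
  smul_mem' := by
    intro c T hT φ hφ
    simpa using (hT φ hφ).const_mul c

/-! ### Multipliers -/

/-- The convolution `(φ * k)(x) = ∑_y φ(y) k(d(x,y))` of a function `φ` with a radial function, the
latter being given by its value `k n` at the vertices with `|x| = n`. -/
def convolution (φ : X → ℂ) (k : ℕ → ℂ) (x : X) : ℂ := ∑' y, φ y * k (G.dist x y)

/-- A multiplier on the `p`-Schwartz space: a radial function `k` (given by its value `k n` at the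
vertices with `|x| = n`) for which `φ ↦ φ * k` is defined on the `p`-Schwartz space, maps it to
itself, and is bounded with respect to every seminorm `ν_{p,m}`. -/
structure Multiplier where
  /-- the radial convolution kernel -/
  kernel : ℕ → ℂ
  summable (φ : Schwartz G q p o) (x : X) :
    Summable fun y => (φ : X → ℂ) y * kernel (G.dist x y)
  mem (φ : Schwartz G q p o) : convolution G (φ : X → ℂ) kernel ∈ Schwartz G q p o
  bounded (m : ℕ) : ∃ C : ℝ, 0 < C ∧ ∀ φ : Schwartz G q p o,
    nu G q p o m (convolution G (φ : X → ℂ) kernel) ≤ C * nu G q p o m (φ : X → ℂ)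

variable {G q p o}

/-- The operator `φ ↦ φ * k` on the `p`-Schwartz space. -/
def Multiplier.toLinearMap (Λ : Multiplier G q p o) :
    Schwartz G q p o →ₗ[ℂ] Schwartz G q p o where
  toFun φ := ⟨convolution G (φ : X → ℂ) Λ.kernel, Λ.mem φ⟩
  map_add' φ ψ := by
    ext x
    have := (Λ.summable φ x).tsum_add (Λ.summable ψ x)
    simpa [convolution, add_mul] using this
  map_smul' c φ := by
    ext x
    simp [convolution, mul_assoc, tsum_mul_left]

/-- The symbol `κ(z) = ∑_x k(x) φ_z(x)`, the spherical Fourier transform of the kernel; it is used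
for `z` in the strip `S_p`. -/
def Multiplier.symbol (Λ : Multiplier G q p o) (z : ℂ) : ℂ :=
  ∑' x : X, Λ.kernel (G.dist o x) * spherical q z (G.dist o x)

/-- The action of a multiplier on `L^p`-tempered distributions, `⟨ΛT, φ⟩ = ⟨T, Λφ⟩`. -/
def Multiplier.dual (Λ : Multiplier G q p o) :
    TemperedDist G q p o →ₗ[ℂ] TemperedDist G q p o where
  toFun T := ⟨(T : Schwartz G q p o →ₗ[ℂ] ℂ) ∘ₗ Λ.toLinearMap, by
    intro φ hφ
    refine T.2 (fun n => Λ.toLinearMap (φ n)) fun m => ?_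
    obtain ⟨C, -, hC⟩ := Λ.bounded m
    refine squeeze_zero (fun n => nu_nonneg G q p o m _) (fun n => hC (φ n)) ?_
    simpa using (hφ m).const_mul C⟩
  map_add' S T := by
    ext φ
    simp
  map_smul' c T := by
    ext φ
    simp

end HomogeneousTree

end

open HomogeneousTree

/-!
Write `A` for the given complex number, `K(ζ)` for the symbol in the variable `ζ = i z log q`, and
`T_j φ` for the Chebyshev polynomial `T_j` of the normalised adjacency operator applied to `φ`. In
this variable the strip `S_p` is the closed strip `|Re ζ| ≤ σ`, where `e^σ = q^(1/p - 1/2)` is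
`radius q p`.

The formal resolvent `μ ↦ T_0 ((Λ - μ)⁻¹ φ)` of the given orbit is studied as a function of `μ`.
Outside the disc `|μ| ≤ |A|` it is the convergent series `-∑ A^k μ^{-(k+1)} T_k φ`
(`exteriorResolvent`), of size `O(1/(|μ| - |A|))`. Whenever `μ` is not a value of `K`, it is also
given by pairing the numbers `T_0 (T_j φ)` with the Laurent coefficients of `1/(K - μ)` (`pairing`).
This needs the relation between `Λ` and the operators `T_j`: the sum over a sphere of
radius `n` is a difference of ball sums, each of which is a polynomial of the second kind in the
adjacency operator, and `U_n T_j = ∑ T_{j+l-i}` over `l + i = n`. Consequently `Λ` acts on the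
sequence `T_j φ` by the convolution whose Laurent series is `K`
(`hasSum_functional_multiplier`, `hasSum_symbol`). The two descriptions agree (`pairing_eq`) because
the seminorms of `T_j φ` are `O((1 + |j|)^N e^(σ|j|))` for some `N` (`weight_cheb_le`), whereas the
coefficients of `1/(K - μ)` are `O((1 + |j|)^(-N) e^(-σ|j|))` for every `N`: all derivatives of `K`
are bounded up to the boundary of the strip (`norm_fourierCoef_resolventFun_le`).

If `|K| ≥ |A|` on the strip, the resolvent therefore continues holomorphically to the plane minus
the finite set `s` of values of `K` on the circle `|μ| = |A|`, with growth at most a power of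
`1/(|A| - |μ|)` inside the circle. Each point of `s` is thus a pole, and the bound from outside
shows that it is simple (`norm_mul_pow_le_of_norm_mul_abs_pow_le`, `exists_norm_sub_mul_le`).
Multiplication by `∏ (μ - a)` amounts, modulo polynomials, to applying `∏ (Λ - a)` to `φ`, so the
resolvent of the latter vector is entire. It vanishes at infinity, hence identically, which gives
`T_0 (∏ (Λ - a) φ) = 0` (`apply_aeval_prod_eq_zero`). For `s = ∅` this is the vanishing of `T_0`; in
general Lagrange interpolation splits `T_0` into eigenvectors (`existsUnique_sum_eigenvectors`).
-/

noncomputable section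

namespace HomogeneousTree

/-! ### Spheres in a homogeneous tree -/

section Tree

variable {X : Type*} {G : SimpleGraph X}

/-- If the geodesic from `x` to `y` does not start with the step from `x` to its parent `w`
(relative to `o`), then `x` lies on the geodesic from `o` to `y`. -/
theorem dist_eq_add_of_dist_parent (hG : G.IsTree) {o x w : X} (hw : G.Adj x w)
    (hd : G.dist o x = G.dist o w + 1) (y : X) (h : G.dist w y = G.dist x y + 1) :
    G.dist o y = G.dist o x + G.dist x y := by
  induction hn : G.dist x y using Nat.strong_induction_on generalizing y with
  | _ n ih =>
    by_cases hxy : y = x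
    · subst hxy
      rw [SimpleGraph.dist_self] at hn
      omega
    -- moving one step towards `x` preserves the hypothesis
    have step : ∀ v, G.Adj y v → G.dist x y = G.dist x v + 1 → G.dist w v = G.dist x v + 1 := by
      intro v hv hxv
      have h1 := hG.dist_eq_dist_add_one_of_adj w hv
      have h2 : G.dist w v ≤ G.dist w x + G.dist x v := hG.connected.dist_triangle
      rw [SimpleGraph.dist_eq_one_iff_adj.2 hw.symm] at h2
      omega
    obtain ⟨v, hyv, hxv, -⟩ := exists_unique_parent hG x y hxy
    have hwv := step v hyv hxv
    have hov := ih (G.dist x v) (by omega) v hwv rfl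
    rcases hG.dist_eq_dist_add_one_of_adj o hyv with h1 | h1
    · omega
    exfalso
    have hvo : v ≠ o := by
      rintro rfl
      simp at h1
    obtain ⟨z, -, -, hz⟩ := exists_unique_parent hG o v hvo
    have hyz : y = z := by
      by_contra hne
      have := hz y hyv.symm hne
      omega
    by_cases hvx : v = x
    · subst hvx
      have hwz : w = z := by
        by_contra hne
        have := hz w hw hne
        omega
      rw [hyz, hwz, SimpleGraph.dist_self] at h
      omega
    · obtain ⟨u, hvu, hxu, -⟩ := exists_unique_parent hG x v hvx
      have hwu : G.dist w u = G.dist x u + 1 := by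
        have h1 := hG.dist_eq_dist_add_one_of_adj w hvu
        have h2 : G.dist w u ≤ G.dist w x + G.dist x u := hG.connected.dist_triangle
        rw [SimpleGraph.dist_eq_one_iff_adj.2 hw.symm] at h2
        omega
      have hou := ih (G.dist x u) (by omega) u hwu rfl
      have huz : u = z := by
        by_contra hne
        have := hz u hvu hne
        omega
      rw [hyz, ← huz] at hxv
      omega

variable [G.LocallyFinite]

theorem finite_sphere (hG : G.Connected) (x : X) (n : ℕ) : {y | G.dist x y = n}.Finite := by
  classical
  induction n with
  | zero =>
    refine (Set.finite_singleton x).subset fun y hy => ?_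
    exact ((hG.dist_eq_zero_iff).1 hy).symm
  | succ n ih =>
    refine (ih.biUnion fun y _ => (G.neighborFinset y).finite_toSet).subset fun y hy => ?_
    obtain ⟨P, hP⟩ := hG.exists_walk_length_eq_dist x y
    have hnil : ¬ P.Nil := by
      intro hnil
      rw [Set.mem_ofPred_eq, hnil.eq, SimpleGraph.dist_self] at hy
      omega
    have hadj := P.adj_penultimate hnil
    simp only [Set.mem_iUnion]
    refine ⟨P.penultimate, ?_, by simpa using hadj⟩
    have h1 : G.dist x P.penultimate ≤ P.dropLast.length := G.dist_le P.dropLast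
    have h2 : P.dropLast.length + 1 = P.length := by
      have := (SimpleGraph.Walk.not_nil_iff_lt_length).1 hnil
      simp
      omega
    have h3 : G.dist x y ≤ G.dist x P.penultimate + G.dist P.penultimate y := hG.dist_triangle
    rw [SimpleGraph.dist_eq_one_iff_adj.2 hadj] at h3
    simp only [Set.mem_ofPred_eq] at hy ⊢
    omega

/-- The sphere of radius `n` about `x`, as a finite set. -/
def sphere (hG : G.Connected) (x : X) (n : ℕ) : Finset X := (finite_sphere hG x n).toFinset

@[simp] theorem mem_sphere {hG : G.Connected} {x y : X} {n : ℕ} :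
    y ∈ sphere hG x n ↔ G.dist x y = n := by simp [sphere]

theorem sphere_zero (hG : G.Connected) (x : X) : sphere hG x 0 = {x} := by
  ext y
  simp [hG.dist_eq_zero_iff, eq_comm]

/-- The adjacency operator on all functions. -/
def adjacency (G : SimpleGraph X) [G.LocallyFinite] : (X → ℂ) →ₗ[ℂ] (X → ℂ) where
  toFun φ x := ∑ y ∈ G.neighborFinset x, φ y
  map_add' φ ψ := by
    ext x
    simp [Finset.sum_add_distrib]
  map_smul' c φ := by
    ext x
    simp [Finset.mul_sum]

theorem adjacency_apply (φ : X → ℂ) (x : X) :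
    adjacency G φ x = ∑ y ∈ G.neighborFinset x, φ y := rfl

/-- The operator `φ ↦ (x ↦ ∑_{d(x,y)=n} φ(y))`. -/
def sphereSum (hG : G.Connected) (n : ℕ) : (X → ℂ) →ₗ[ℂ] (X → ℂ) where
  toFun φ x := ∑ y ∈ sphere hG x n, φ y
  map_add' φ ψ := by
    ext x
    simp [Finset.sum_add_distrib]
  map_smul' c φ := by
    ext x
    simp [Finset.mul_sum]

theorem sphereSum_apply (hG : G.Connected) (n : ℕ) (φ : X → ℂ) (x : X) :
    sphereSum hG n φ x = ∑ y ∈ sphere hG x n, φ y := rfl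

theorem sphereSum_zero (hG : G.Connected) : sphereSum hG 0 = LinearMap.id := by
  ext φ x
  simp [sphereSum_apply, sphere_zero]

theorem sphereSum_one (hG : G.Connected) : sphereSum hG 1 = adjacency G := by
  ext φ x
  rw [sphereSum_apply, adjacency_apply]
  congr 1
  ext y
  simp [SimpleGraph.dist_eq_one_iff_adj]

/-- Sums over the spheres about the neighbours of `x`, rearranged by the distance to `x`. -/
theorem adjacency_sphereSum_eq (hG : G.IsTree) (n : ℕ) (φ : X → ℂ) (x : X) (B : Finset X)
    (hB : ∀ z, G.dist x z ≤ n + 1 → z ∈ B) :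
    adjacency G (sphereSum hG.connected n φ) x =
      ∑ z ∈ B, φ z * ∑ y ∈ G.neighborFinset x, (if G.dist z y = n then 1 else 0 : ℂ) := by
  classical
  simp only [adjacency_apply, sphereSum_apply, Finset.mul_sum]
  rw [Finset.sum_comm]
  refine Finset.sum_congr rfl fun y hy => ?_
  rw [SimpleGraph.mem_neighborFinset] at hy
  have : sphere hG.connected y n = B.filter fun z => G.dist z y = n := by
    ext z
    simp only [mem_sphere, Finset.mem_filter]
    rw [SimpleGraph.dist_comm]
    refine ⟨fun h => ⟨hB z ?_, h⟩, fun h => h.2⟩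
    have h3 : G.dist x z ≤ G.dist x y + G.dist y z := hG.connected.dist_triangle
    rw [SimpleGraph.dist_eq_one_iff_adj.2 hy, SimpleGraph.dist_comm (u := y)] at h3
    omega
  rw [this, Finset.sum_filter]
  simp

theorem exists_finset_ball (hG : G.Connected) (x : X) (n : ℕ) :
    ∃ B : Finset X, ∀ z, G.dist x z ≤ n → z ∈ B := by
  classical
  refine ⟨(Finset.range (n + 1)).biUnion (sphere hG x), fun z hz => ?_⟩
  simp
  omega

theorem sphereSum_eq_sum_ite (hG : G.Connected) (n : ℕ) (φ : X → ℂ) (x : X) (B : Finset X)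
    (hB : ∀ z, G.dist x z ≤ n → z ∈ B) :
    sphereSum hG n φ x = ∑ z ∈ B, φ z * (if G.dist x z = n then 1 else 0) := by
  classical
  have : sphere hG x n = B.filter fun z => G.dist x z = n := by
    ext z
    simp only [mem_sphere, Finset.mem_filter]
    exact ⟨fun h => ⟨hB z h.le, h⟩, fun h => h.2⟩
  rw [sphereSum_apply, this, Finset.sum_filter]
  simp

variable {q : ℕ}

theorem adjacency_sphereSum_one (hG : G.IsTree) (hreg : G.IsRegularOfDegree (q + 1)) :
    adjacency G ∘ₗ sphereSum hG.connected 1 =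
      sphereSum hG.connected 2 + ((q : ℂ) + 1) • sphereSum hG.connected 0 := by
  refine LinearMap.ext fun φ => funext fun x => ?_
  obtain ⟨B, hB⟩ := exists_finset_ball hG.connected x 2
  rw [LinearMap.comp_apply, adjacency_sphereSum_eq hG 1 φ x B hB, LinearMap.add_apply,
    LinearMap.smul_apply, Pi.add_apply, Pi.smul_apply,
    sphereSum_eq_sum_ite hG.connected 2 φ x B hB,
    sphereSum_eq_sum_ite hG.connected 0 φ x B fun z hz => hB z (by omega), smul_eq_mul,
    Finset.mul_sum, ← Finset.sum_add_distrib]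
  refine Finset.sum_congr rfl fun z _ => ?_
  rcases hd : G.dist z x with _ | d
  · have hx : z = x := (hG.connected.dist_eq_zero_iff).1 hd
    subst hx
    rw [sum_neighbors_origin hreg z fun d => if d = 1 then 1 else 0]
    simp
    ring
  · rw [sum_neighbors hG hreg z x d hd fun d => if d = 1 then 1 else 0, SimpleGraph.dist_comm, hd]
    simp

theorem adjacency_sphereSum_add_two (hG : G.IsTree) (hreg : G.IsRegularOfDegree (q + 1)) (n : ℕ) :
    adjacency G ∘ₗ sphereSum hG.connected (n + 2) =
      sphereSum hG.connected (n + 3) + (q : ℂ) • sphereSum hG.connected (n + 1) := by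
  refine LinearMap.ext fun φ => funext fun x => ?_
  obtain ⟨B, hB⟩ := exists_finset_ball hG.connected x (n + 3)
  rw [LinearMap.comp_apply, adjacency_sphereSum_eq hG (n + 2) φ x B hB, LinearMap.add_apply,
    LinearMap.smul_apply, Pi.add_apply, Pi.smul_apply,
    sphereSum_eq_sum_ite hG.connected (n + 3) φ x B hB,
    sphereSum_eq_sum_ite hG.connected (n + 1) φ x B fun z hz => hB z (by omega), smul_eq_mul,
    Finset.mul_sum, ← Finset.sum_add_distrib]
  refine Finset.sum_congr rfl fun z _ => ?_
  rcases hd : G.dist z x with _ | d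
  · have hx : z = x := (hG.connected.dist_eq_zero_iff).1 hd
    subst hx
    rw [sum_neighbors_origin hreg z fun d => if d = n + 2 then 1 else 0]
    simp
  · rw [sum_neighbors hG hreg z x d hd fun d => if d = n + 2 then 1 else 0,
      SimpleGraph.dist_comm, hd]
    simp
    split_ifs <;> ring

theorem card_sphere_succ (hG : G.IsTree) (hreg : G.IsRegularOfDegree (q + 1)) (x : X) (n : ℕ) :
    (sphere hG.connected x (n + 1)).card = (q + 1) * q ^ n := by
  have hone : adjacency G 1 = ((q : ℂ) + 1) • 1 := by
    ext y
    simp [adjacency_apply, hreg y]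
  have hcard : ∀ n, sphereSum hG.connected n 1 x = (sphere hG.connected x n).card := by
    intro n
    simp [sphereSum_apply]
  have key : ∀ n, sphereSum hG.connected (n + 1) 1 = (((q : ℂ) + 1) * (q : ℂ) ^ n) • 1 ∧
      sphereSum hG.connected (n + 2) 1 = (((q : ℂ) + 1) * (q : ℂ) ^ (n + 1)) • 1 := by
    intro n
    induction n with
    | zero =>
      have h := LinearMap.congr_fun (adjacency_sphereSum_one hG hreg) 1
      simp only [LinearMap.comp_apply, sphereSum_one, hone, map_smul, LinearMap.add_apply,
        LinearMap.smul_apply, sphereSum_zero, LinearMap.id_apply, smul_smul] at h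
      refine ⟨by simp [sphereSum_one, hone], ?_⟩
      rw [← sub_eq_iff_eq_add, ← sub_smul] at h
      rw [← h]
      congr 1
      ring
    | succ n ih =>
      refine ⟨ih.2, ?_⟩
      have h := LinearMap.congr_fun (adjacency_sphereSum_add_two hG hreg n) 1
      simp only [LinearMap.comp_apply, ih.1, ih.2, map_smul, LinearMap.add_apply, hone,
        LinearMap.smul_apply, smul_smul] at h
      rw [← sub_eq_iff_eq_add, ← sub_smul] at h
      rw [← h]
      congr 1
      ring
  have h := congrFun (key n).1 x
  rw [hcard] at h
  have h' : ((sphere hG.connected x (n + 1)).card : ℂ) = ((q + 1) * q ^ n : ℕ) := by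
    rw [h]
    simp
  exact_mod_cast h'

theorem card_sphere_le (hG : G.IsTree) (hreg : G.IsRegularOfDegree (q + 1)) (hq : 1 ≤ q) (x : X)
    (n : ℕ) : (sphere hG.connected x n).card ≤ 2 * q ^ n := by
  cases n with
  | zero => simp [sphere_zero]
  | succ n =>
    rw [card_sphere_succ hG hreg, pow_succ]
    nlinarith [Nat.pos_of_ne_zero (pow_ne_zero n (by omega : q ≠ 0))]

/-- Summation over a sphere of the function `ρ^{-|y|}`. A vertex of the sphere of radius `n + 1`
about `x` either lies behind `x` as seen from the origin, or belongs to the sphere of radius `n`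
about the parent of `x`. -/
theorem sum_sphere_pow_le (hG : G.IsTree) (hreg : G.IsRegularOfDegree (q + 1)) (hq : 1 ≤ q) (o : X)
    {ρ : ℝ} (hρ : 0 < ρ) (hρq : (q : ℝ) ≤ ρ ^ 2) (n : ℕ) (x : X) :
    ∑ y ∈ sphere hG.connected x n, (ρ ^ G.dist o y)⁻¹ ≤
      2 * (n + 1) * ρ ^ n * (ρ ^ G.dist o x)⁻¹ := by
  classical
  have hcard : ∀ (x : X) (n : ℕ), ((sphere hG.connected x n).card : ℝ) * (ρ ^ n)⁻¹ ≤ 2 * ρ ^ n := by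
    intro x n
    have h1 : ((sphere hG.connected x n).card : ℝ) ≤ 2 * (q : ℝ) ^ n := by
      exact_mod_cast card_sphere_le hG hreg hq x n
    have h2 : (q : ℝ) ^ n ≤ ρ ^ n * ρ ^ n := by
      rw [← mul_pow, ← sq]
      exact pow_le_pow_left₀ (by positivity) hρq n
    rw [mul_inv_le_iff₀ (by positivity)]
    linarith
  induction n generalizing x with
  | zero => simp [sphere_zero]; nlinarith [inv_pos.2 (pow_pos hρ (G.dist o x))]
  | succ n ih =>
    by_cases hx : x = o
    · subst hx
      have h1 : ∑ y ∈ sphere hG.connected x (n + 1), (ρ ^ G.dist x y)⁻¹ =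
          ((sphere hG.connected x (n + 1)).card : ℝ) * (ρ ^ (n + 1))⁻¹ := by
        rw [← nsmul_eq_mul]
        refine Finset.sum_eq_card_nsmul fun y hy => ?_
        rw [mem_sphere] at hy
        rw [hy]
      rw [h1, SimpleGraph.dist_self]
      refine (hcard x (n + 1)).trans ?_
      have : 0 < ρ ^ (n + 1) := by positivity
      push_cast
      simp only [pow_zero, inv_one, mul_one]
      nlinarith [(Nat.cast_nonneg n : (0 : ℝ) ≤ n)]
    · obtain ⟨w, hw, hd, -⟩ := exists_unique_parent hG o x hx
      have hsub : sphere hG.connected x (n + 1) ⊆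
          (sphere hG.connected x (n + 1)).filter (fun y => G.dist o y = G.dist o x + (n + 1)) ∪
            sphere hG.connected w n := by
        intro y hy
        rw [mem_sphere] at hy
        rw [Finset.mem_union, Finset.mem_filter, mem_sphere, mem_sphere]
        have h1 := hG.dist_eq_dist_add_one_of_adj y hw
        rw [SimpleGraph.dist_comm (v := x), SimpleGraph.dist_comm (v := w)] at h1
        rcases h1 with h1 | h1
        · right
          omega
        · left
          have := dist_eq_add_of_dist_parent hG hw hd y h1
          exact ⟨hy, by omega⟩
      have hpos : ∀ k : ℕ, 0 < ρ ^ k := fun k => by positivity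
      have hfil : ∑ y ∈ (sphere hG.connected x (n + 1)).filter
            (fun y => G.dist o y = G.dist o x + (n + 1)), (ρ ^ G.dist o y)⁻¹ ≤
          2 * ρ ^ (n + 1) * (ρ ^ G.dist o x)⁻¹ := by
        have h1 : ∀ y ∈ (sphere hG.connected x (n + 1)).filter
            (fun y => G.dist o y = G.dist o x + (n + 1)),
            (ρ ^ G.dist o y)⁻¹ ≤ (ρ ^ (n + 1))⁻¹ * (ρ ^ G.dist o x)⁻¹ := by
          intro y hy
          rw [(Finset.mem_filter.1 hy).2, pow_add, mul_inv, mul_comm]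
        refine (Finset.sum_le_card_nsmul _ _ _ h1).trans ?_
        rw [nsmul_eq_mul, ← mul_assoc]
        refine mul_le_mul_of_nonneg_right ?_ (inv_nonneg.2 (hpos _).le)
        refine le_trans ?_ (hcard x (n + 1))
        refine mul_le_mul_of_nonneg_right ?_ (inv_nonneg.2 (hpos _).le)
        exact_mod_cast Finset.card_filter_le _ _
      have hw' : (ρ ^ G.dist o w)⁻¹ = ρ * (ρ ^ G.dist o x)⁻¹ := by
        rw [hd, pow_succ]
        field_simp
      have h2 := ih w
      rw [hw'] at h2
      calc ∑ y ∈ sphere hG.connected x (n + 1), (ρ ^ G.dist o y)⁻¹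
          ≤ _ := Finset.sum_le_sum_of_subset_of_nonneg hsub
            fun y _ _ => inv_nonneg.2 (hpos _).le
        _ ≤ _ := by
          rw [← Finset.sum_union_inter]
          exact le_add_of_nonneg_right (Finset.sum_nonneg fun y _ => inv_nonneg.2 (hpos _).le)
        _ ≤ _ := add_le_add hfil h2
        _ = _ := by push_cast; ring

end Tree

/-! ### Chebyshev polynomials of the adjacency operator -/

section Operators

open Polynomial

variable {X : Type*} {G : SimpleGraph X} [G.LocallyFinite] {q : ℕ} {p : ℝ} {o : X}

/-- The product of Chebyshev polynomials of the two kinds, as a sum of polynomials of the first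
kind. -/
theorem chebyshev_U_mul_T (n : ℕ) (j : ℤ) :
    Chebyshev.U ℂ n * Chebyshev.T ℂ j =
      ∑ a ∈ Finset.HasAntidiagonal.antidiagonal n, Chebyshev.T ℂ ((a.1 : ℤ) - a.2 + j) := by
  induction n using Nat.strong_induction_on with
  | _ n ih =>
    match n, ih with
    | 0, _ => simp
    | 1, _ =>
      have h := Chebyshev.T_mul_T ℂ 1 j
      rw [Chebyshev.T_one] at h
      rw [show Finset.HasAntidiagonal.antidiagonal 1 = {((0 : ℕ), (1 : ℕ)), (1, 0)} from rfl]
      rw [Finset.sum_insert (by simp), Finset.sum_singleton]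
      have e : (((0 : ℕ) : ℤ) - ((1 : ℕ) : ℤ) + j) = -(1 - j) := by push_cast; ring
      have e' : (((1 : ℕ) : ℤ) - ((0 : ℕ) : ℤ) + j) = 1 + j := by push_cast; ring
      simp only [e, e', Chebyshev.T_neg]
      simp only [Nat.cast_one, Chebyshev.U_one]
      rw [h, add_comm]
    | n + 2, ih =>
      have h := Chebyshev.T_mul_T ℂ ((n : ℤ) + 2) j
      have h2 := ih n (by omega)
      rw [Finset.Nat.antidiagonal_succ_succ', Finset.sum_cons, Finset.sum_cons, Finset.sum_map]
      push_cast
      rw [Chebyshev.U_eq_two_mul_T_add_U, add_mul, h, h2]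
      simp only [Function.Embedding.prodMap, Function.Embedding.coeFn_mk,
        Prod.map_fst, Prod.map_snd, Nat.succ_eq_add_one, Nat.cast_add, Nat.cast_one,
        add_sub_add_right_eq_sub]
      have e : ((0 : ℤ) - ((n : ℤ) + 2) + j) = -((n : ℤ) + 2 - j) := by ring
      rw [e, Chebyshev.T_neg, sub_zero]
      ring

variable (G q) in
/-- The adjacency operator, normalised so that it acts on `φ_z` by a cosine. -/
def normAdj : Module.End ℂ (X → ℂ) := ((1 / (2 * √(q : ℝ)) : ℝ) : ℂ) • adjacency G

variable (G q) in
/-- The Chebyshev polynomial `T_j` of the normalised adjacency operator. -/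
def cheb (j : ℤ) : Module.End ℂ (X → ℂ) := aeval (normAdj G q) (Chebyshev.T ℂ j)

variable (G q) in
/-- The operator `q^{n/2} U_n` of the normalised adjacency operator; it sums a function over all
points at distance at most `n` with the parity of `n`. -/
def ballSum (n : ℕ) : Module.End ℂ (X → ℂ) :=
  ((√(q : ℝ) ^ n : ℝ) : ℂ) • aeval (normAdj G q) (Chebyshev.U ℂ n)

theorem two_eq_smul_one : (2 : Module.End ℂ (X → ℂ)) = (2 : ℂ) • 1 := by
  rw [← one_add_one_eq_two, ← one_add_one_eq_two, add_smul, one_smul]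

theorem two_sqrt_smul_normAdj (hq : q ≠ 0) :
    ((2 * √(q : ℝ) : ℝ) : ℂ) • normAdj G q = adjacency G := by
  have h : √(q : ℝ) ≠ 0 := by positivity
  rw [normAdj, smul_smul, ← Complex.ofReal_mul, mul_one_div_cancel (by positivity)]
  simp

theorem adjacency_mul_ballSum (hq : q ≠ 0) (n : ℕ) :
    adjacency G * ballSum G q (n + 1) = ballSum G q (n + 2) + (q : ℂ) • ballSum G q n := by
  have hs : ((√(q : ℝ) : ℝ) : ℂ) * ((√(q : ℝ) : ℝ) : ℂ) = (q : ℂ) := by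
    rw [← Complex.ofReal_mul, Real.mul_self_sqrt (Nat.cast_nonneg q)]
    simp
  rw [← two_sqrt_smul_normAdj hq]
  unfold ballSum
  have h := congrArg (aeval (normAdj G q)) (Chebyshev.U_add_two ℂ n)
  simp only [map_sub, map_mul, aeval_X, map_ofNat] at h
  push_cast
  rw [h, smul_sub, smul_smul, smul_mul_assoc, mul_smul_comm, smul_smul]
  have e : (q : ℂ) * (√(q : ℝ) : ℂ) ^ n = (√(q : ℝ) : ℂ) ^ (n + 2) := by
    rw [← hs]
    ring
  rw [e, sub_add_cancel, mul_assoc (2 : Module.End ℂ (X → ℂ))]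
  rw [two_eq_smul_one]
  rw [smul_mul_assoc, one_mul, smul_smul]
  congr 1
  ring

theorem ballSum_zero : ballSum G q 0 = 1 := by simp [ballSum]

theorem ballSum_one (hq : q ≠ 0) : ballSum G q 1 = adjacency G := by
  rw [← two_sqrt_smul_normAdj hq, ballSum]
  simp only [Nat.cast_one, Chebyshev.U_one, map_mul, aeval_X, map_ofNat]
  rw [two_eq_smul_one]
  rw [smul_mul_assoc, one_mul, smul_smul]
  congr 1
  push_cast
  ring

/-- Sphere sums as differences of ball sums, by comparison of the two recursions. -/
theorem sphereSum_add_two (hG : G.IsTree) (hreg : G.IsRegularOfDegree (q + 1)) (hq : q ≠ 0)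
    (n : ℕ) : sphereSum hG.connected (n + 2) = ballSum G q (n + 2) - ballSum G q n := by
  induction n using Nat.strong_induction_on with
  | _ n ih =>
    match n, ih with
    | 0, _ =>
      have h := adjacency_sphereSum_one hG hreg
      have h2 := adjacency_mul_ballSum (G := G) hq 0
      rw [← sub_eq_iff_eq_add] at h h2
      rw [← h, ← h2, ballSum_one hq, sphereSum_one, sphereSum_zero, ballSum_zero, add_smul,
        one_smul]
      simp only [Module.End.mul_eq_comp, Module.End.one_eq_id]
      abel
    | 1, ih =>
      have h := adjacency_sphereSum_add_two hG hreg 0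
      have h2 := adjacency_mul_ballSum (G := G) hq 1
      rw [← sub_eq_iff_eq_add] at h h2
      rw [← h, ← h2, ih 0 (by omega), sphereSum_one, ← Module.End.mul_eq_comp, mul_sub,
        ballSum_zero, mul_one, ballSum_one hq]
      abel
    | n + 2, ih =>
      have h := adjacency_sphereSum_add_two hG hreg (n + 1)
      have h2 := adjacency_mul_ballSum (G := G) hq (n + 2)
      have h3 := adjacency_mul_ballSum (G := G) hq n
      rw [← sub_eq_iff_eq_add] at h h2
      rw [← h, ← h2, ih (n + 1) (by omega), ih n (by omega), ← Module.End.mul_eq_comp, mul_sub,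
        h3, smul_sub]
      abel

theorem ballSum_mul_cheb (n : ℕ) (j : ℤ) :
    ballSum G q n * cheb G q j =
      ((√(q : ℝ) ^ n : ℝ) : ℂ) •
        ∑ a ∈ Finset.HasAntidiagonal.antidiagonal n, cheb G q ((a.1 : ℤ) - a.2 + j) := by
  unfold ballSum cheb
  rw [smul_mul_assoc, ← map_mul, chebyshev_U_mul_T, map_sum]

/-! ### Bounds in the Schwartz seminorms -/

variable (q p) in
/-- The outer radius `q^{1/p-1/2}` of the annulus corresponding to the strip `S_p`. -/
def radius : ℝ := (q : ℝ) ^ (1 / p) / √(q : ℝ)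

omit [G.LocallyFinite] in
theorem weight_eq (m : ℕ) (x : X) :
    weight G q p o m x = (1 + (G.dist o x : ℝ)) ^ m * ((q : ℝ) ^ (1 / p)) ^ G.dist o x := by
  unfold weight
  rw [← Real.rpow_natCast ((q : ℝ) ^ (1 / p)), ← Real.rpow_mul (Nat.cast_nonneg q)]
  congr 2
  ring

theorem radius_eq (hq : q ≠ 0) : radius q p = (q : ℝ) ^ (1 / p - 1 / 2) := by
  rw [radius, Real.sqrt_eq_rpow, Real.rpow_sub (by positivity)]

theorem one_lt_radius (hq : 2 ≤ q) (hp : 0 < p) (hp2 : p < 2) : 1 < radius q p := by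
  rw [radius_eq (by omega)]
  refine Real.one_lt_rpow (by exact_mod_cast hq) ?_
  rw [sub_pos]
  exact one_div_lt_one_div_of_lt hp hp2

theorem le_sq_rpow (hq : 1 ≤ q) (hp : 0 < p) (hp2 : p ≤ 2) :
    (q : ℝ) ≤ ((q : ℝ) ^ (1 / p)) ^ 2 := by
  rw [← Real.rpow_natCast, ← Real.rpow_mul (Nat.cast_nonneg q)]
  nth_rewrite 1 [← Real.rpow_one (q : ℝ)]
  refine Real.rpow_le_rpow_of_exponent_le (by exact_mod_cast hq) ?_
  rw [one_div_mul_eq_div, le_div_iff₀ hp]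
  simpa using hp2

theorem one_le_rpow (hq : 1 ≤ q) (hp : 0 < p) : 1 ≤ (q : ℝ) ^ (1 / p) :=
  Real.one_le_rpow (by exact_mod_cast hq) (by positivity)

/-- The sphere operator of radius `n` has norm of order `n^{m+1} q^{n/p}` in the seminorm of index
`m`. The hypothesis `p ≤ 2` enters through `q ≤ q^{2/p}`. -/
theorem weight_sphereSum_le (hG : G.IsTree) (hreg : G.IsRegularOfDegree (q + 1)) (hq : 1 ≤ q)
    (hp : 0 < p) (hp2 : p ≤ 2) {m : ℕ} {φ : X → ℂ} {c : ℝ}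
    (hφ : ∀ x, weight G q p o m x * ‖φ x‖ ≤ c) (n : ℕ) (x : X) :
    weight G q p o m x * ‖sphereSum hG.connected n φ x‖ ≤
      c * (2 * (n + 1) ^ (m + 1) * ((q : ℝ) ^ (1 / p)) ^ n) := by
  have hq0 : q ≠ 0 := by omega
  set ρ := (q : ℝ) ^ (1 / p) with hρdef
  have hρ : 0 < ρ := zero_lt_one.trans_le (one_le_rpow hq hp)
  have hc : 0 ≤ c := (mul_nonneg (weight_nonneg G q p o m x) (norm_nonneg _)).trans (hφ x)
  have hpt : ∀ y ∈ sphere hG.connected x n,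
      (1 + (G.dist o x : ℝ)) ^ m * ‖φ y‖ ≤ c * (n + 1) ^ m * (ρ ^ G.dist o y)⁻¹ := by
    intro y hy
    rw [mem_sphere] at hy
    have h1 := hφ y
    rw [weight_eq, ← hρdef] at h1
    have h2 : (1 + (G.dist o x : ℝ)) ^ m ≤ (n + 1) ^ m * (1 + (G.dist o y : ℝ)) ^ m := by
      rw [← mul_pow]
      refine pow_le_pow_left₀ (by positivity) ?_ m
      have h3 : G.dist o x ≤ G.dist o y + G.dist y x := hG.connected.dist_triangle
      rw [SimpleGraph.dist_comm (u := y), hy] at h3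
      have h4 : (G.dist o x : ℝ) ≤ G.dist o y + n := by exact_mod_cast h3
      nlinarith [mul_nonneg (Nat.cast_nonneg (α := ℝ) n) (Nat.cast_nonneg (α := ℝ) (G.dist o y))]
    have hρy : 0 < ρ ^ G.dist o y := by positivity
    rw [← div_eq_mul_inv, le_div_iff₀ hρy]
    calc (1 + (G.dist o x : ℝ)) ^ m * ‖φ y‖ * ρ ^ G.dist o y
        ≤ ((n + 1) ^ m * (1 + (G.dist o y : ℝ)) ^ m) * ‖φ y‖ * ρ ^ G.dist o y := by gcongr
      _ = (n + 1) ^ m * ((1 + (G.dist o y : ℝ)) ^ m * ρ ^ G.dist o y * ‖φ y‖) := by ring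
      _ ≤ (n + 1) ^ m * c := by gcongr
      _ = _ := by ring
  have hsum := sum_sphere_pow_le hG hreg hq o hρ (le_sq_rpow hq hp hp2) n x
  have hρx : 0 < ρ ^ G.dist o x := by positivity
  rw [weight_eq, ← hρdef, sphereSum_apply]
  calc (1 + (G.dist o x : ℝ)) ^ m * ρ ^ G.dist o x * ‖∑ y ∈ sphere hG.connected x n, φ y‖
      ≤ (1 + (G.dist o x : ℝ)) ^ m * ρ ^ G.dist o x * ∑ y ∈ sphere hG.connected x n, ‖φ y‖ := by
        gcongr
        exact norm_sum_le _ _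
    _ = ρ ^ G.dist o x * ∑ y ∈ sphere hG.connected x n, (1 + (G.dist o x : ℝ)) ^ m * ‖φ y‖ := by
        rw [← Finset.mul_sum]
        ring
    _ ≤ ρ ^ G.dist o x *
          ∑ y ∈ sphere hG.connected x n, c * (n + 1) ^ m * (ρ ^ G.dist o y)⁻¹ := by
        exact mul_le_mul_of_nonneg_left (Finset.sum_le_sum hpt) hρx.le
    _ = ρ ^ G.dist o x * (c * (n + 1) ^ m) *
          ∑ y ∈ sphere hG.connected x n, (ρ ^ G.dist o y)⁻¹ := by
        rw [← Finset.mul_sum]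
        ring
    _ ≤ ρ ^ G.dist o x * (c * (n + 1) ^ m) * (2 * (n + 1) * ρ ^ n * (ρ ^ G.dist o x)⁻¹) := by
        gcongr
    _ = _ := by
        field_simp
        ring

theorem weight_ballSum_le (hG : G.IsTree) (hreg : G.IsRegularOfDegree (q + 1)) (hq : 1 ≤ q)
    (hp : 0 < p) (hp2 : p ≤ 2) {m : ℕ} {φ : X → ℂ} {c : ℝ}
    (hφ : ∀ x, weight G q p o m x * ‖φ x‖ ≤ c) (n : ℕ) (x : X) :
    weight G q p o m x * ‖ballSum G q n φ x‖ ≤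
      c * (2 * (n + 1) ^ (m + 2) * ((q : ℝ) ^ (1 / p)) ^ n) := by
  have hc : 0 ≤ c := (mul_nonneg (weight_nonneg G q p o m x) (norm_nonneg _)).trans (hφ x)
  set ρ := (q : ℝ) ^ (1 / p) with hρdef
  have hρ : 1 ≤ ρ := one_le_rpow hq hp
  have hS := fun n => weight_sphereSum_le hG hreg hq hp hp2 hφ n x
  rw [← hρdef] at hS
  have hmono : ∀ n : ℕ, c * (2 * ((n : ℝ) + 1) ^ (m + 1) * ρ ^ n) ≤
      c * (2 * (n + 1) ^ (m + 2) * ρ ^ n) := by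
    intro n
    gcongr
    · linarith [(Nat.cast_nonneg n : (0 : ℝ) ≤ n)]
    · omega
  induction n using Nat.strong_induction_on with
  | _ n ih =>
    match n, ih with
    | 0, _ =>
      have := (hS 0).trans (hmono 0)
      rwa [sphereSum_zero, ← Module.End.one_eq_id, ← ballSum_zero (G := G) (q := q)] at this
    | 1, _ =>
      have := (hS 1).trans (hmono 1)
      rwa [sphereSum_one, ← ballSum_one (G := G) (q := q) (by omega)] at this
    | n + 2, ih =>
      have h1 := ih n (by omega)
      have h2 := hS (n + 2)
      have e : ballSum G q (n + 2) φ x =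
          sphereSum hG.connected (n + 2) φ x + ballSum G q n φ x := by
        rw [sphereSum_add_two hG hreg (by omega)]
        simp
      have h3 := mul_le_mul_of_nonneg_left
        (norm_add_le (sphereSum hG.connected (n + 2) φ x) (ballSum G q n φ x))
        (weight_nonneg G q p o m x)
      rw [e]
      have h4 : 2 * ((n : ℝ) + 1) ^ (m + 2) * ρ ^ n ≤
          2 * (((n + 2 : ℕ) : ℝ) + 1) ^ (m + 1) * (n + 2) * ρ ^ (n + 2) := by
        have a1 : ρ ^ n ≤ ρ ^ (n + 2) := pow_le_pow_right₀ hρ (by omega)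
        have a2 : ((n : ℝ) + 1) ^ (m + 1) ≤ (((n + 2 : ℕ) : ℝ) + 1) ^ (m + 1) := by
          gcongr
          linarith
        have a3 : (n : ℝ) + 1 ≤ n + 2 := by linarith
        rw [pow_succ _ (m + 1), ← mul_assoc]
        gcongr
      have h5 := mul_le_mul_of_nonneg_left h4 hc
      calc _ ≤ _ := h3
        _ ≤ c * (2 * (((n + 2 : ℕ) : ℝ) + 1) ^ (m + 1) * ρ ^ (n + 2)) +
            c * (2 * (((n + 2 : ℕ) : ℝ) + 1) ^ (m + 1) * (n + 2) * ρ ^ (n + 2)) := by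
          rw [mul_add]
          linarith
        _ = _ := by
          push_cast
          ring

theorem two_mul_cheb (n : ℕ) (hq : q ≠ 0) :
    (2 : ℂ) • cheb G q (n + 2 : ℕ) =
      (((√(q : ℝ) ^ (n + 2))⁻¹ : ℝ) : ℂ) • ballSum G q (n + 2) -
        (((√(q : ℝ) ^ n)⁻¹ : ℝ) : ℂ) • ballSum G q n := by
  have h := congrArg (aeval (normAdj G q)) (Chebyshev.two_mul_T_eq_U_sub_U ℂ n)
  have hs : √(q : ℝ) ≠ 0 := by positivity
  unfold cheb ballSum
  rw [smul_smul, smul_smul, ← Complex.ofReal_mul, ← Complex.ofReal_mul,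
    inv_mul_cancel₀ (by positivity), inv_mul_cancel₀ (by positivity)]
  simp only [map_sub, map_mul, map_ofNat] at h
  push_cast
  rw [one_smul, one_smul, ← h]
  rw [two_eq_smul_one]
  simp

theorem weight_cheb_le (hG : G.IsTree) (hreg : G.IsRegularOfDegree (q + 1)) (hq : 2 ≤ q)
    (hp : 0 < p) (hp2 : p < 2) {m : ℕ} {φ : X → ℂ} {c : ℝ}
    (hφ : ∀ x, weight G q p o m x * ‖φ x‖ ≤ c) (j : ℤ) (x : X) :
    weight G q p o m x * ‖cheb G q j φ x‖ ≤
      c * (2 * (1 + (j.natAbs : ℝ)) ^ (m + 2) * radius q p ^ j.natAbs) := by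
  have hc : 0 ≤ c := (mul_nonneg (weight_nonneg G q p o m x) (norm_nonneg _)).trans (hφ x)
  have hr := one_lt_radius hq hp hp2
  have hs : 0 < √(q : ℝ) := by
    have : (0 : ℝ) < q := by exact_mod_cast (by omega : 0 < q)
    positivity
  have hcheb : cheb G q j = cheb G q (j.natAbs : ℕ) := by
    unfold cheb
    rw [Chebyshev.T_natAbs]
  rw [hcheb]
  generalize j.natAbs = n
  -- the bound for `U_n`
  have hU : ∀ n : ℕ, weight G q p o m x *
      ‖((((√(q : ℝ) ^ n)⁻¹ : ℝ) : ℂ) • ballSum G q n) φ x‖ ≤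
        c * (2 * (1 + (n : ℝ)) ^ (m + 2) * radius q p ^ n) := by
    intro n
    have h := weight_ballSum_le hG hreg (by omega) hp hp2.le hφ n x
    have hsn : 0 < √(q : ℝ) ^ n := by positivity
    rw [LinearMap.smul_apply, Pi.smul_apply, norm_smul, Complex.norm_real, Real.norm_eq_abs,
      abs_of_pos (by positivity), radius, div_pow]
    calc _ = (√(q : ℝ) ^ n)⁻¹ * (weight G q p o m x * ‖ballSum G q n φ x‖) := by ring
      _ ≤ (√(q : ℝ) ^ n)⁻¹ * _ := mul_le_mul_of_nonneg_left h (by positivity)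
      _ = _ := by
        rw [add_comm (1 : ℝ)]
        field_simp
  match n with
  | 0 =>
    have := hφ x
    simp [cheb]
    linarith
  | 1 =>
    have h := hU 1
    have e : cheb G q (1 : ℕ) φ x =
        (1 / 2 : ℂ) * ((((√(q : ℝ) ^ 1)⁻¹ : ℝ) : ℂ) • ballSum G q 1) φ x := by
      have e1 : (((√(q : ℝ) ^ 1)⁻¹ : ℝ) : ℂ) • ballSum G q 1 = (2 : ℂ) • cheb G q (1 : ℕ) := by
        unfold ballSum cheb
        rw [smul_smul, ← Complex.ofReal_mul, inv_mul_cancel₀ (by positivity)]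
        simp only [Nat.cast_one, Chebyshev.U_one, Chebyshev.T_one, map_mul, map_ofNat, aeval_X]
        rw [two_eq_smul_one]
        simp
      rw [e1]
      simp
    have h0 := mul_nonneg (weight_nonneg G q p o m x)
      (norm_nonneg (((((√(q : ℝ) ^ 1)⁻¹ : ℝ) : ℂ) • ballSum G q 1) φ x))
    rw [e, norm_mul]
    norm_num at h h0 ⊢
    linarith
  | n + 2 =>
    have h1 := hU (n + 2)
    have h2 := hU n
    have e := congrFun (LinearMap.congr_fun (two_mul_cheb (G := G) (q := q) n (by omega)) φ) x
    rw [LinearMap.smul_apply, Pi.smul_apply, LinearMap.sub_apply, Pi.sub_apply] at e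
    have e2 := congrArg norm e
    rw [norm_smul, Complex.norm_ofNat] at e2
    have h3 := mul_le_mul_of_nonneg_left (norm_sub_le
      (((((√(q : ℝ) ^ (n + 2))⁻¹ : ℝ) : ℂ) • ballSum G q (n + 2)) φ x)
      (((((√(q : ℝ) ^ n)⁻¹ : ℝ) : ℂ) • ballSum G q n) φ x)) (weight_nonneg G q p o m x)
    rw [← e2] at h3
    have h4 : c * (2 * (1 + (n : ℝ)) ^ (m + 2) * radius q p ^ n) ≤
        c * (2 * (1 + ((n + 2 : ℕ) : ℝ)) ^ (m + 2) * radius q p ^ (n + 2)) := by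
      have a1 : radius q p ^ n ≤ radius q p ^ (n + 2) := pow_le_pow_right₀ hr.le (by omega)
      have a2 : (1 + (n : ℝ)) ^ (m + 2) ≤ (1 + ((n + 2 : ℕ) : ℝ)) ^ (m + 2) := by
        gcongr
        omega
      have : 0 < radius q p := by linarith
      gcongr
    linarith

end Operators

/-! ### Regrouping the kernel along the antidiagonals -/

section Kernel

theorem hasSum_finset_fiberwise {ι : Type*} {f : ι → ℂ} {a : ℂ} (hf : HasSum f a) (g : ι → ℕ)
    (s : ℕ → Finset ι) (hs : ∀ n b, b ∈ s n ↔ g b = n) :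
    HasSum (fun n => ∑ b ∈ s n, f b) a := by
  have h := hf.tsum_fiberwise g
  have e : (fun n => ∑ b ∈ s n, f b) = fun n => ∑' b : (g ⁻¹' Set.singleton n : Set ι), f b := by
    funext n
    have : g ⁻¹' Set.singleton n = ↑(s n) := Set.ext fun b => (hs n b).symm
    rw [this, Finset.tsum_subtype']
  rw [e]
  exact h

/-- The coefficients `(k(l+i) - k(l+i+2)) s^{l+i}`. Summed against `w^{l-i}` they give the Laurent
expansion of the symbol of the radial kernel `k`, up to collecting equal powers of `w`. -/
def coeff (k : ℕ → ℂ) (s : ℝ) (a : ℕ × ℕ) : ℂ :=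
  (k (a.1 + a.2) - k (a.1 + a.2 + 2)) * (s : ℂ) ^ (a.1 + a.2)

variable {k : ℕ → ℂ} {s ρ : ℝ}

theorem summable_inv_sq : Summable fun n : ℕ => ((1 + (n : ℝ)) ^ 2)⁻¹ := by
  have h := (summable_nat_add_iff 1).2 (Real.summable_nat_pow_inv.2 (by norm_num : 1 < 2))
  refine h.congr fun n => ?_
  push_cast
  rw [add_comm]

theorem summable_of_decay
    (hk : ∀ m : ℕ, ∃ D, ∀ n : ℕ, (1 + (n : ℝ)) ^ m * ρ ^ n * ‖k n‖ ≤ D)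
    {y : ℕ → ℂ} {D : ℝ} {N : ℕ} (hy : ∀ n, ‖y n‖ ≤ D * ((1 + (n : ℝ)) ^ N * ρ ^ n)) :
    Summable fun n => ‖k n * y n‖ := by
  obtain ⟨E, hE⟩ := hk (N + 2)
  have hD : 0 ≤ D := by
    have := (norm_nonneg _).trans (hy 0)
    simpa using this
  refine Summable.of_nonneg_of_le (fun n => norm_nonneg _) (fun n => ?_)
    (summable_inv_sq.mul_left (D * E))
  have h1 := hE n
  have h2 := hy n
  rw [norm_mul, ← div_eq_mul_inv, le_div_iff₀ (by positivity)]
  calc ‖k n‖ * ‖y n‖ * (1 + (n : ℝ)) ^ 2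
      ≤ ‖k n‖ * (D * ((1 + (n : ℝ)) ^ N * ρ ^ n)) * (1 + (n : ℝ)) ^ 2 := by gcongr
    _ = D * ((1 + (n : ℝ)) ^ (N + 2) * ρ ^ n * ‖k n‖) := by ring
    _ ≤ D * E := by gcongr

theorem summable_coeff (hs : 0 < s) (hsρ : s ≤ ρ) (hρ : 1 ≤ ρ)
    (hk : ∀ m : ℕ, ∃ D, ∀ n : ℕ, (1 + (n : ℝ)) ^ m * ρ ^ n * ‖k n‖ ≤ D) (N : ℕ) :
    Summable fun a : ℕ × ℕ => ‖coeff k s a‖ *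
      ((1 + (((a.1 : ℤ) - a.2).natAbs : ℝ)) ^ N * (ρ / s) ^ ((a.1 : ℤ) - a.2).natAbs) := by
  obtain ⟨D, hD⟩ := hk (N + 4)
  have h := summable_inv_sq.mul_of_nonneg summable_inv_sq (fun n => by positivity)
    (fun n => by positivity)
  refine Summable.of_nonneg_of_le (fun a => by positivity) (fun a => ?_) (h.mul_left (2 * D))
  obtain ⟨l, i⟩ := a
  simp only [coeff]
  have hn : ((l : ℤ) - i).natAbs ≤ l + i := by omega
  have hli : (1 + (l : ℝ)) ^ 2 * (1 + (i : ℝ)) ^ 2 ≤ (1 + ((l + i : ℕ) : ℝ)) ^ 4 := by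
    rw [← mul_pow, show (4 : ℕ) = 2 * 2 from rfl, pow_mul]
    refine pow_le_pow_left₀ (by positivity) ?_ 2
    push_cast
    nlinarith [(Nat.cast_nonneg l : (0 : ℝ) ≤ l), (Nat.cast_nonneg i : (0 : ℝ) ≤ i)]
  generalize ((l : ℤ) - i).natAbs = d at hn
  generalize hnd : l + i = n at hn hli
  have hr : 1 ≤ ρ / s := (one_le_div hs).2 hsρ
  have h1 := hD n
  have h2 : (1 + (n : ℝ)) ^ (N + 4) * ρ ^ n * ‖k (n + 2)‖ ≤ D := by
    refine le_trans ?_ (hD (n + 2))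
    gcongr <;> omega
  have h3 : ‖k n - k (n + 2)‖ * ((1 + (n : ℝ)) ^ (N + 4) * ρ ^ n) ≤ 2 * D := by
    refine (mul_le_mul_of_nonneg_right (norm_sub_le _ _) (by positivity)).trans ?_
    linarith
  rw [norm_mul, norm_pow, Complex.norm_real, Real.norm_eq_abs, abs_of_pos hs, ← mul_inv,
    ← div_eq_mul_inv, le_div_iff₀ (by positivity)]
  have hρ0 : 0 < ρ := by linarith
  calc ‖k n - k (n + 2)‖ * s ^ n * ((1 + (d : ℝ)) ^ N * (ρ / s) ^ d) *
        ((1 + (l : ℝ)) ^ 2 * (1 + (i : ℝ)) ^ 2)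
      ≤ ‖k n - k (n + 2)‖ * s ^ n * ((1 + (n : ℝ)) ^ N * (ρ / s) ^ n) * (1 + (n : ℝ)) ^ 4 := by
        gcongr
    _ = ‖k n - k (n + 2)‖ * ((1 + (n : ℝ)) ^ (N + 4) * ρ ^ n) := by
        rw [div_pow, pow_add]
        field_simp
    _ ≤ 2 * D := h3

/-- Summation by parts: a series `∑ k(n) S_n` with `S_{n+2} = Y_{n+2} - Y_n`, where `Y_n` is the
`n`-th antidiagonal sum of `s^n v_{l-i}`, equals `∑ coeff(l,i) v_{l-i}`. -/
theorem hasSum_coeff (hs : 0 < s) (hsρ : s ≤ ρ) (hρ : 1 ≤ ρ)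
    (hk : ∀ m : ℕ, ∃ D, ∀ n : ℕ, (1 + (n : ℝ)) ^ m * ρ ^ n * ‖k n‖ ≤ D)
    {v : ℤ → ℂ} {D : ℝ} {N : ℕ}
    (hv : ∀ j, ‖v j‖ ≤ D * ((1 + (j.natAbs : ℝ)) ^ N * (ρ / s) ^ j.natAbs))
    {S Y : ℕ → ℂ}
    (hY : ∀ n, Y n = (s : ℂ) ^ n *
      ∑ a ∈ Finset.HasAntidiagonal.antidiagonal n, v ((a.1 : ℤ) - a.2))
    (h0 : S 0 = Y 0) (h1 : S 1 = Y 1) (h2 : ∀ n, S (n + 2) = Y (n + 2) - Y n) :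
    (Summable fun n => ‖k n * S n‖) ∧
      HasSum (fun a : ℕ × ℕ => coeff k s a * v ((a.1 : ℤ) - a.2)) (∑' n, k n * S n) := by
  have hρ0 : 0 < ρ := by linarith
  have hr : 1 ≤ ρ / s := (one_le_div hs).2 hsρ
  have hD : 0 ≤ D := by
    have := (norm_nonneg _).trans (hv 0)
    simpa using this
  have hYb : ∀ n, ‖Y n‖ ≤ D * ((1 + (n : ℝ)) ^ (N + 1) * ρ ^ n) := by
    intro n
    have hv' : ∀ a ∈ Finset.HasAntidiagonal.antidiagonal n,
        ‖v ((a.1 : ℤ) - a.2)‖ ≤ D * ((1 + (n : ℝ)) ^ N * (ρ / s) ^ n) := by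
      intro a ha
      rw [Finset.HasAntidiagonal.mem_antidiagonal] at ha
      have hle : ((a.1 : ℤ) - a.2).natAbs ≤ n := by omega
      refine (hv _).trans ?_
      gcongr
    rw [hY, norm_mul, norm_pow, Complex.norm_real, Real.norm_eq_abs, abs_of_pos hs]
    refine (mul_le_mul_of_nonneg_left (norm_sum_le_of_le _ hv') (by positivity)).trans ?_
    rw [Finset.sum_const, Finset.Nat.card_antidiagonal, nsmul_eq_mul, div_pow]
    push_cast
    apply le_of_eq
    field_simp
    ring
  have sY := summable_of_decay hk hYb
  have hshift : ∀ m : ℕ, ∃ D, ∀ n : ℕ, (1 + (n : ℝ)) ^ m * ρ ^ n * ‖k (n + 2)‖ ≤ D := by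
    intro m
    obtain ⟨E, hE⟩ := hk m
    refine ⟨E, fun n => le_trans ?_ (hE (n + 2))⟩
    gcongr <;> omega
  have sY2 := summable_of_decay (k := fun n => k (n + 2)) hshift hYb
  -- the shifted series
  set Z : ℕ → ℂ := fun n => k n * Y n - k n * S n with hZ
  have hZ0 : Z 0 = 0 := by simp [hZ, h0]
  have hZ1 : Z 1 = 0 := by simp [hZ, h1]
  have hZ2 : ∀ n, Z (n + 2) = k (n + 2) * Y n := by
    intro n
    simp only [hZ, h2]
    ring
  have sZ : Summable fun n => ‖Z n‖ := by
    rw [← summable_nat_add_iff 2]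
    exact sY2.congr fun n => by rw [hZ2]
  have sS : Summable fun n => ‖k n * S n‖ := by
    refine Summable.of_nonneg_of_le (fun n => norm_nonneg _) (fun n => ?_) (sY.add sZ)
    have : k n * S n = k n * Y n - Z n := by simp [hZ]
    rw [this]
    exact norm_sub_le _ _
  refine ⟨sS, ?_⟩
  have hZsum : HasSum Z (∑' n, k (n + 2) * Y n) := by
    have : HasSum (fun n => Z (n + 2)) (∑' n, k (n + 2) * Y n) := by
      simp only [hZ2]
      exact sY2.of_norm.hasSum
    rw [hasSum_nat_add_iff 2] at this
    simpa [Finset.sum_range_succ, hZ0, hZ1] using this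
  have hSsum : ∑' n, k n * S n = ∑' n, k n * Y n - ∑' n, k (n + 2) * Y n := by
    have h3 := (sY.of_norm.hasSum.sub sS.of_norm.hasSum)
    have h4 := h3.unique hZsum
    rw [← h4]
    ring
  have sβ : Summable fun a : ℕ × ℕ => coeff k s a * v ((a.1 : ℤ) - a.2) := by
    refine Summable.of_norm_bounded ((summable_coeff hs hsρ hρ hk N).mul_left D) fun a => ?_
    rw [norm_mul]
    refine (mul_le_mul_of_nonneg_left (hv _) (norm_nonneg _)).trans (le_of_eq ?_)
    ring
  have h5 := hasSum_finset_fiberwise sβ.hasSum (fun a => a.1 + a.2)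
    Finset.HasAntidiagonal.antidiagonal (fun n b => Finset.HasAntidiagonal.mem_antidiagonal)
  have h6 : ∀ n, ∑ a ∈ Finset.HasAntidiagonal.antidiagonal n,
      coeff k s a * v ((a.1 : ℤ) - a.2) = k n * Y n - k (n + 2) * Y n := by
    intro n
    rw [hY, ← sub_mul, ← mul_assoc, Finset.mul_sum]
    refine Finset.sum_congr rfl fun a ha => ?_
    rw [Finset.HasAntidiagonal.mem_antidiagonal] at ha
    rw [coeff, ha]
  simp only [h6] at h5
  have h7 := h5.unique (sY.of_norm.hasSum.sub sY2.of_norm.hasSum)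
  rw [hSsum, ← h7]
  exact sβ.hasSum

end Kernel

/-! ### The Schwartz space and the multiplier -/

section Schwartz

variable {X : Type*} {G : SimpleGraph X} {q : ℕ} {p : ℝ} {o : X}

theorem weight_mul_le_nu (φ : Schwartz G q p o) (m : ℕ) (x : X) :
    weight G q p o m x * ‖φ.1 x‖ ≤ nu G q p o m φ.1 :=
  le_ciSup (φ.2 m) x

theorem nu_le {m : ℕ} {φ : X → ℂ} {c : ℝ} (h : ∀ x, weight G q p o m x * ‖φ x‖ ≤ c) :
    nu G q p o m φ ≤ c :=
  haveI : Nonempty X := ⟨o⟩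
  ciSup_le h

/-- A functional that is bounded with respect to one seminorm may be applied termwise to a series
that converges pointwise and absolutely in this seminorm. -/
theorem hasSum_functional {ι : Type*} {m : ℕ} {D : ℝ} {U : Schwartz G q p o →ₗ[ℂ] ℂ}
    (hU : ∀ φ, ‖U φ‖ ≤ D * nu G q p o m φ.1) (hD : 0 ≤ D) {f : ι → Schwartz G q p o} {c : ι → ℝ}
    (hc : Summable c) (hf : ∀ n x, weight G q p o m x * ‖(f n).1 x‖ ≤ c n)
    {F : Schwartz G q p o} (hF : ∀ x, HasSum (fun n => (f n).1 x) (F.1 x)) :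
    HasSum (fun n => U (f n)) (U F) := by
  classical
  have htail := (tendsto_tsum_compl_atTop_zero c).const_mul D
  rw [mul_zero] at htail
  refine tendsto_iff_norm_sub_tendsto_zero.2 (squeeze_zero (fun _ => norm_nonneg _) (fun t => ?_)
    htail)
  rw [← map_sum, norm_sub_rev, ← map_sub]
  refine (hU _).trans (mul_le_mul_of_nonneg_left (nu_le fun x => ?_) hD)
  have h1 : HasSum (fun n : {n // n ∉ t} => (f n).1 x) ((F - ∑ n ∈ t, f n).1 x) := by
    have h2 := (t.hasSum_compl_iff (f := fun n => (f n).1 x)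
      (a := (F - ∑ n ∈ t, f n).1 x)).2
    refine h2 ?_
    have h3 : (F - ∑ n ∈ t, f n).1 x + ∑ n ∈ t, (f n).1 x = F.1 x := by
      simp
    rw [h3]
    exact hF x
  rw [← h1.tsum_eq]
  have hw := weight_nonneg G q p o m x
  have hs : Summable fun n : {n // n ∉ t} => weight G q p o m x * ‖(f n).1 x‖ :=
    Summable.of_nonneg_of_le (fun n => mul_nonneg hw (norm_nonneg _)) (fun n => hf n x)
      (hc.subtype _)
  have h4 : ‖(weight G q p o m x : ℂ) * ∑' n : {n // n ∉ t}, (f n).1 x‖ ≤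
      ∑' n : {n // n ∉ t}, c n := by
    rw [← tsum_mul_left]
    refine tsum_of_norm_bounded (hc.subtype _).hasSum fun n => ?_
    rw [norm_mul, Complex.norm_real, Real.norm_eq_abs, abs_of_nonneg hw]
    exact hf n x
  rwa [norm_mul, Complex.norm_real, Real.norm_eq_abs, abs_of_nonneg hw] at h4

variable [G.LocallyFinite]

omit [G.LocallyFinite] in
theorem mem_schwartz {φ : X → ℂ} (h : ∀ m : ℕ, ∃ c, ∀ x, weight G q p o m x * ‖φ x‖ ≤ c) :
    φ ∈ Schwartz G q p o := by
  intro m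
  obtain ⟨c, hc⟩ := h m
  refine ⟨c, ?_⟩
  rintro _ ⟨x, rfl⟩
  exact hc x

theorem cheb_mem (hG : G.IsTree) (hreg : G.IsRegularOfDegree (q + 1)) (hq : 2 ≤ q)
    (hp : 0 < p) (hp2 : p < 2) (j : ℤ) (φ : Schwartz G q p o) :
    cheb G q j φ.1 ∈ Schwartz G q p o :=
  mem_schwartz fun m => ⟨_, weight_cheb_le hG hreg hq hp hp2 (weight_mul_le_nu φ m) j⟩

theorem sphereSum_mem (hG : G.IsTree) (hreg : G.IsRegularOfDegree (q + 1)) (hq : 2 ≤ q)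
    (hp : 0 < p) (hp2 : p < 2) (n : ℕ) (φ : Schwartz G q p o) :
    sphereSum hG.connected n φ.1 ∈ Schwartz G q p o :=
  mem_schwartz fun m =>
    ⟨_, weight_sphereSum_le hG hreg (by omega) hp hp2.le (weight_mul_le_nu φ m) n⟩

theorem ballSum_mem (hG : G.IsTree) (hreg : G.IsRegularOfDegree (q + 1)) (hq : 2 ≤ q)
    (hp : 0 < p) (hp2 : p < 2) (n : ℕ) (φ : Schwartz G q p o) :
    ballSum G q n φ.1 ∈ Schwartz G q p o :=
  mem_schwartz fun m => ⟨_, weight_ballSum_le hG hreg (by omega) hp hp2.le (weight_mul_le_nu φ m) n⟩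

/-- The function `T_j φ`, for the Chebyshev polynomial `T_j` of the normalised adjacency operator,
as an element of the Schwartz space. -/
def chebSchwartz (hG : G.IsTree) (hreg : G.IsRegularOfDegree (q + 1)) (hq : 2 ≤ q)
    (hp : 0 < p) (hp2 : p < 2) (j : ℤ) (φ : Schwartz G q p o) : Schwartz G q p o :=
  ⟨cheb G q j φ.1, cheb_mem hG hreg hq hp hp2 j φ⟩

theorem chebSchwartz_zero (hG : G.IsTree) (hreg : G.IsRegularOfDegree (q + 1)) (hq : 2 ≤ q)
    (hp : 0 < p) (hp2 : p < 2) (φ : Schwartz G q p o) :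
    chebSchwartz hG hreg hq hp hp2 0 φ = φ := by
  ext x
  simp [chebSchwartz, cheb]

theorem norm_chebSchwartz_le (hG : G.IsTree) (hreg : G.IsRegularOfDegree (q + 1)) (hq : 2 ≤ q)
    (hp : 0 < p) (hp2 : p < 2) {m : ℕ} {D : ℝ} {U : Schwartz G q p o →ₗ[ℂ] ℂ}
    (hU : ∀ φ, ‖U φ‖ ≤ D * nu G q p o m φ.1) (hD : 0 ≤ D) (φ : Schwartz G q p o) (j : ℤ) :
    ‖U (chebSchwartz hG hreg hq hp hp2 j φ)‖ ≤ (D * nu G q p o m φ.1 * 2) *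
      ((1 + (j.natAbs : ℝ)) ^ (m + 2) * radius q p ^ j.natAbs) := by
  refine (hU _).trans ((mul_le_mul_of_nonneg_left (nu_le fun x =>
    weight_cheb_le hG hreg hq hp hp2 (weight_mul_le_nu φ m) j x) hD).trans (le_of_eq ?_))
  ring

/-- The kernel of a multiplier is rapidly decreasing, being the image of the point mass at `o`. -/
theorem kernel_decay (hG : G.IsTree) (hreg : G.IsRegularOfDegree (q + 1)) (hq : 2 ≤ q)
    (Λ : Multiplier G q p o) (m : ℕ) :
    ∃ D, ∀ n : ℕ, (1 + (n : ℝ)) ^ m * ((q : ℝ) ^ (1 / p)) ^ n * ‖Λ.kernel n‖ ≤ D := by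
  classical
  have hδ : (Pi.single o 1 : X → ℂ) ∈ Schwartz G q p o := by
    intro m
    refine ⟨weight G q p o m o, ?_⟩
    rintro _ ⟨x, rfl⟩
    by_cases hx : x = o
    · subst hx
      simp
    · simp [hx, weight_nonneg]
  obtain ⟨D, hD⟩ := Λ.mem ⟨_, hδ⟩ m
  refine ⟨D, fun n => ?_⟩
  have hne : (sphere hG.connected o n).Nonempty := by
    cases n with
    | zero => simp [sphere_zero]
    | succ n =>
      rw [← Finset.card_pos, card_sphere_succ hG hreg]
      have : 0 < q := by omega
      positivity
  obtain ⟨x, hx⟩ := hne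
  rw [mem_sphere] at hx
  have h := hD ⟨x, rfl⟩
  simp only at h
  have hconv : convolution G (Pi.single o 1 : X → ℂ) Λ.kernel x = Λ.kernel n := by
    unfold convolution
    rw [tsum_eq_single o fun y hy => by simp [hy], SimpleGraph.dist_comm, hx]
    simp
  rwa [hconv, weight_eq, hx] at h

theorem convolution_hasSum (hG : G.IsTree) (Λ : Multiplier G q p o) (φ : Schwartz G q p o) (x : X) :
    HasSum (fun n => Λ.kernel n * sphereSum hG.connected n φ.1 x)
      ((Λ.toLinearMap φ).1 x) := by
  have h := hasSum_finset_fiberwise (Λ.summable φ x).hasSum (G.dist x)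
    (sphere hG.connected x) (fun n b => mem_sphere)
  have e : ∀ n, ∑ y ∈ sphere hG.connected x n, φ.1 y * Λ.kernel (G.dist x y) =
      Λ.kernel n * sphereSum hG.connected n φ.1 x := by
    intro n
    rw [sphereSum_apply, Finset.mul_sum]
    refine Finset.sum_congr rfl fun y hy => ?_
    rw [mem_sphere] at hy
    rw [hy, mul_comm]
  simp only [e] at h
  exact h

theorem one_le_sqrt (hq : 2 ≤ q) : 1 ≤ √(q : ℝ) :=
  Real.one_le_sqrt.2 (by exact_mod_cast (by omega : 1 ≤ q))

theorem sqrt_le_rpow (hq : 2 ≤ q) (hp : 0 < p) (hp2 : p < 2) : √(q : ℝ) ≤ (q : ℝ) ^ (1 / p) :=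
  (one_le_div (zero_lt_one.trans_le (one_le_sqrt hq))).1 (one_lt_radius hq hp hp2).le

/-- For a functional `U` that is bounded with respect to one seminorm, `U(Λ T_j φ)` is the Laurent
series of the symbol with the powers `w^i` replaced by `U(T_{i+j} φ)`. -/
theorem hasSum_functional_multiplier (hG : G.IsTree) (hreg : G.IsRegularOfDegree (q + 1))
    (hq : 2 ≤ q) (hp : 0 < p) (hp2 : p < 2) (Λ : Multiplier G q p o) {m : ℕ} {D : ℝ}
    {U : Schwartz G q p o →ₗ[ℂ] ℂ} (hU : ∀ φ, ‖U φ‖ ≤ D * nu G q p o m φ.1) (hD : 0 ≤ D)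
    (φ : Schwartz G q p o) (j : ℤ) :
    HasSum (fun a : ℕ × ℕ => coeff Λ.kernel √(q : ℝ) a *
        U (chebSchwartz hG hreg hq hp hp2 ((a.1 : ℤ) - a.2 + j) φ))
      (U (Λ.toLinearMap (chebSchwartz hG hreg hq hp hp2 j φ))) := by
  have hq0 : q ≠ 0 := by omega
  have hr := one_lt_radius hq hp hp2
  have hk := kernel_decay hG hreg hq Λ
  set ψ := chebSchwartz hG hreg hq hp hp2 j φ with hψ
  let sph : ℕ → Schwartz G q p o := fun n =>
    ⟨sphereSum hG.connected n ψ.1, sphereSum_mem hG hreg hq hp hp2 n ψ⟩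
  let bll : ℕ → Schwartz G q p o := fun n =>
    ⟨ballSum G q n ψ.1, ballSum_mem hG hreg hq hp hp2 n ψ⟩
  have hν := nu_nonneg G q p o m ψ.1
  have hρ := one_le_rpow (q := q) (by omega) hp
  -- the expansion of `Λ ψ` along spheres
  have h1 : HasSum (fun n => U (Λ.kernel n • sph n)) (U (Λ.toLinearMap ψ)) := by
    let y : ℕ → ℂ := fun n =>
      ((nu G q p o m ψ.1 * (2 * (n + 1) ^ (m + 1) * ((q : ℝ) ^ (1 / p)) ^ n) : ℝ) : ℂ)
    have hy : ∀ n, ‖y n‖ =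
        nu G q p o m ψ.1 * (2 * (n + 1) ^ (m + 1) * ((q : ℝ) ^ (1 / p)) ^ n) := by
      intro n
      rw [Complex.norm_real, Real.norm_eq_abs, abs_of_nonneg (by positivity)]
    have hc := summable_of_decay hk (y := y) (D := 2 * nu G q p o m ψ.1) (N := m + 1)
      fun n => by
        rw [hy]
        apply le_of_eq
        ring
    refine hasSum_functional hU hD hc (fun n x => ?_) fun x => ?_
    · have h2 := weight_sphereSum_le hG hreg (by omega) hp hp2.le (weight_mul_le_nu ψ m) n x
      rw [norm_mul, hy]
      change weight G q p o m x * ‖Λ.kernel n * sphereSum hG.connected n ψ.1 x‖ ≤ _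
      rw [norm_mul, mul_left_comm]
      exact mul_le_mul_of_nonneg_left h2 (norm_nonneg _)
    · exact convolution_hasSum hG Λ ψ x
  simp only [map_smul, smul_eq_mul] at h1
  rw [← h1.tsum_eq]
  have hE := norm_chebSchwartz_le hG hreg hq hp hp2 hU hD φ
  set E := D * nu G q p o m φ.1 * 2
  have hE0 : 0 ≤ E := by
    have := nu_nonneg G q p o m φ.1
    positivity
  refine (hasSum_coeff (S := fun n => U (sph n)) (Y := fun n => U (bll n))
    (v := fun i => U (chebSchwartz hG hreg hq hp hp2 (i + j) φ)) (N := m + 2)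
    (D := E * ((1 + (j.natAbs : ℝ)) ^ (m + 2) * radius q p ^ j.natAbs))
    (zero_lt_one.trans_le (one_le_sqrt hq)) (sqrt_le_rpow hq hp hp2) hρ hk (fun i => ?_)
    (fun n => ?_) ?_ ?_ fun n => ?_).2
  · refine (hE (i + j)).trans (le_of_le_of_eq (mul_le_mul_of_nonneg_left ?_ hE0)
      (mul_assoc E _ _).symm)
    have hij : (i + j).natAbs ≤ j.natAbs + i.natAbs := by omega
    have hr0 : 0 < radius q p := by linarith
    calc (1 + ((i + j).natAbs : ℝ)) ^ (m + 2) * radius q p ^ (i + j).natAbs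
        ≤ ((1 + (j.natAbs : ℝ)) * (1 + (i.natAbs : ℝ))) ^ (m + 2) *
            radius q p ^ (j.natAbs + i.natAbs) := by
          gcongr
          · have h3 : ((i + j).natAbs : ℝ) ≤ j.natAbs + i.natAbs := by exact_mod_cast hij
            nlinarith [mul_nonneg (Nat.cast_nonneg (α := ℝ) i.natAbs)
              (Nat.cast_nonneg (α := ℝ) j.natAbs)]
          · exact hr.le
      _ = (1 + (j.natAbs : ℝ)) ^ (m + 2) * radius q p ^ j.natAbs *
            ((1 + (i.natAbs : ℝ)) ^ (m + 2) * radius q p ^ i.natAbs) := by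
          rw [mul_pow, pow_add]
          ring
  · have e : bll n = ((√(q : ℝ) : ℝ) : ℂ) ^ n • ∑ a ∈ Finset.HasAntidiagonal.antidiagonal n,
        chebSchwartz hG hreg hq hp hp2 ((a.1 : ℤ) - a.2 + j) φ := by
      refine Subtype.ext ?_
      have h2 := LinearMap.congr_fun (ballSum_mul_cheb (G := G) (q := q) n j) φ.1
      simp only [Module.End.mul_apply, LinearMap.smul_apply, LinearMap.sum_apply] at h2
      simpa [bll, hψ, chebSchwartz] using h2
    simp only [e, map_smul, map_sum, smul_eq_mul]
  · have e : sph 0 = bll 0 := Subtype.ext (by simp [sph, bll, sphereSum_zero, ballSum_zero])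
    simp only [e]
  · have e : sph 1 = bll 1 := Subtype.ext (by simp [sph, bll, sphereSum_one, ballSum_one hq0])
    simp only [e]
  · have e : sph (n + 2) = bll (n + 2) - bll n :=
      Subtype.ext (by simp [sph, bll, sphereSum_add_two hG hreg hq0])
    simp only [e, map_sub]

/-! ### The Laurent expansion of the symbol -/

theorem one_sub_gamma (hq : q ≠ 0) (z : ℂ) :
    ((q : ℂ) + 1) * (1 - gamma q z) =
      2 * (√(q : ℝ) : ℂ) * Complex.cosh (Complex.I * z * Real.log q) := by
  have hq1 : (q : ℂ) + 1 ≠ 0 := by exact_mod_cast Nat.succ_ne_zero q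
  have hqc : (q : ℂ) ≠ 0 := by exact_mod_cast hq
  have hs : (q : ℂ) ^ (1 / 2 : ℂ) = (√(q : ℝ) : ℂ) := by
    rw [Real.sqrt_eq_rpow, Complex.ofReal_cpow (Nat.cast_nonneg q)]
    push_cast
    rfl
  have hl : (Real.log q : ℂ) = Complex.log q := by
    rw [Complex.ofReal_log (Nat.cast_nonneg q)]
    simp
  rw [gamma, Complex.cpow_add _ _ hqc, sub_eq_add_neg (1 / 2 : ℂ), Complex.cpow_add _ _ hqc, hs,
    Complex.cosh, hl, Complex.cpow_def_of_ne_zero hqc, Complex.cpow_def_of_ne_zero hqc]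
  rw [mul_comm (Complex.log q), mul_comm (Complex.log q), neg_mul]
  field_simp
  ring

theorem cheb_spherical (hG : G.IsTree) (hreg : G.IsRegularOfDegree (q + 1)) (hq : q ≠ 0) (z : ℂ)
    (j : ℤ) : cheb G q j (fun y => spherical q z (G.dist o y)) =
      Complex.cosh (j * (Complex.I * z * Real.log q)) • fun y => spherical q z (G.dist o y) := by
  have hq1 : (q : ℂ) + 1 ≠ 0 := by exact_mod_cast Nat.succ_ne_zero q
  have hs : (√(q : ℝ) : ℂ) ≠ 0 := by
    have : √(q : ℝ) ≠ 0 := by positivity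
    exact_mod_cast this
  have h : normAdj G q (fun y => spherical q z (G.dist o y)) =
      Complex.cosh (Complex.I * z * Real.log q) • fun y => spherical q z (G.dist o y) := by
    ext x
    have h1 := laplacian_spherical hq hG hreg o z x
    have h2 := one_sub_gamma hq z
    simp only [normAdj, LinearMap.smul_apply, Pi.smul_apply, smul_eq_mul, adjacency_apply]
    rw [laplacian, sub_eq_iff_eq_add, ← sub_eq_iff_eq_add', eq_div_iff hq1] at h1
    rw [← h1, Complex.ofReal_div, Complex.ofReal_one, Complex.ofReal_mul, Complex.ofReal_ofNat]
    field_simp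
    linear_combination spherical q z (G.dist o x) * h2
  rw [cheb, Module.End.aeval_apply_of_mem_apply_eq_smul h, Polynomial.Chebyshev.T_complex_cosh]

/-- The sum of an even function of the difference over an antidiagonal. -/
theorem sum_antidiagonal_cosh (n : ℕ) (ζ : ℂ) :
    ∑ a ∈ Finset.HasAntidiagonal.antidiagonal n, Complex.cosh ((((a.1 : ℤ) - a.2 : ℤ) : ℂ) * ζ) =
      ∑ a ∈ Finset.HasAntidiagonal.antidiagonal n,
        Complex.exp ((((a.1 : ℤ) - a.2 : ℤ) : ℂ) * ζ) := by
  have h := Finset.Nat.sum_antidiagonal_swap (n := n)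
    (f := fun a : ℕ × ℕ => Complex.exp ((((a.1 : ℤ) - a.2 : ℤ) : ℂ) * ζ))
  have h2 : ∀ a : ℕ × ℕ, Complex.exp ((((a.swap.1 : ℤ) - a.swap.2 : ℤ) : ℂ) * ζ) =
      Complex.exp (-((((a.1 : ℤ) - a.2 : ℤ) : ℂ) * ζ)) := by
    intro a
    congr 1
    push_cast
    simp only [Prod.fst_swap, Prod.snd_swap]
    ring
  simp only [h2] at h
  simp only [Complex.cosh]
  rw [← Finset.sum_div, Finset.sum_add_distrib, h]
  ring

theorem norm_exp_int_mul_le {σ : ℝ} {ζ : ℂ} (hζ : |ζ.re| ≤ σ) (j : ℤ) :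
    ‖Complex.exp (j * ζ)‖ ≤ Real.exp σ ^ j.natAbs := by
  rw [Complex.norm_exp, ← Real.exp_nat_mul]
  refine Real.exp_le_exp.2 ?_
  have : ((j : ℂ) * ζ).re = j * ζ.re := by simp
  rw [this]
  refine (le_abs_self _).trans ?_
  rw [abs_mul, Nat.cast_natAbs, Int.cast_abs]
  gcongr

theorem re_le_of_mem_strip (hq : 2 ≤ q) (hp : 0 < p) (hp2 : p < 2) (z : ℂ) :
    |(Complex.I * z * Real.log q).re| ≤ Real.log (radius q p) ↔ z ∈ strip p := by
  have hq1 : (1 : ℝ) < q := by exact_mod_cast (by omega : 1 < q)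
  have hl : 0 < Real.log q := Real.log_pos hq1
  have hδ : 0 < 1 / p - 1 / 2 := sub_pos.2 (one_div_lt_one_div_of_lt hp hp2)
  have e : (Complex.I * z * Real.log q).re = -z.im * Real.log q := by
    rw [Complex.re_mul_ofReal]
    simp
  rw [e, radius_eq (by omega), Real.log_rpow (by linarith), abs_mul, abs_of_pos hl, abs_neg, strip,
    Set.mem_ofPred_eq, abs_of_pos hδ]
  exact mul_le_mul_iff_left₀ hl

/-- The symbol as a Laurent series in `e^ζ`, where `ζ = i z log q`; `T_j` of the normalised adjacency
operator acts on `φ_z` as `cosh (j ζ)`. -/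
theorem hasSum_symbol (hG : G.IsTree) (hreg : G.IsRegularOfDegree (q + 1)) (hq : 2 ≤ q)
    (hp : 0 < p) (hp2 : p < 2) (Λ : Multiplier G q p o) {z : ℂ} (hz : z ∈ strip p) :
    HasSum (fun a : ℕ × ℕ => coeff Λ.kernel √(q : ℝ) a *
      Complex.exp ((((a.1 : ℤ) - a.2 : ℤ) : ℂ) * (Complex.I * z * Real.log q)))
      (Λ.symbol z) := by
  classical
  have hq0 : q ≠ 0 := by omega
  set ζ := Complex.I * z * Real.log q with hζdef
  have hζ := (re_le_of_mem_strip hq hp hp2 z).2 hz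
  set Φ : X → ℂ := fun y => spherical q z (G.dist o y) with hΦ
  have hΦo : Φ o = 1 := by simp [hΦ, spherical]
  have key := hasSum_coeff (k := Λ.kernel) (S := fun n => sphereSum hG.connected n Φ o)
    (Y := fun n => ballSum G q n Φ o) (v := fun j => Complex.exp (j * ζ)) (D := 1) (N := 0)
    (zero_lt_one.trans_le (one_le_sqrt hq)) (sqrt_le_rpow hq hp hp2)
    (one_le_rpow (by omega) hp) (kernel_decay hG hreg hq Λ)
    (fun j => by
      rw [pow_zero, one_mul, one_mul]
      have h := norm_exp_int_mul_le hζ j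
      rwa [Real.exp_log (zero_lt_one.trans (one_lt_radius hq hp hp2))] at h)
    (fun n => ?_) ?_ ?_ fun n => ?_
  · obtain ⟨hsum, hcoeff⟩ := key
    have hS : ∀ n, ∑ y ∈ sphere hG.connected o n,
        Λ.kernel (G.dist o y) * spherical q z (G.dist o y) =
          Λ.kernel n * sphereSum hG.connected n Φ o := by
      intro n
      rw [sphereSum_apply, Finset.mul_sum]
      refine Finset.sum_congr rfl fun y hy => ?_
      rw [mem_sphere] at hy
      simp only [hΦ, hy]
    have hSn : ∀ n, ∑ y ∈ sphere hG.connected o n,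
        ‖Λ.kernel (G.dist o y) * spherical q z (G.dist o y)‖ =
          ‖Λ.kernel n * sphereSum hG.connected n Φ o‖ := by
      intro n
      have h1 : ∀ y ∈ sphere hG.connected o n, Φ y = spherical q z n := by
        intro y hy
        rw [mem_sphere] at hy
        simp only [hΦ, hy]
      rw [sphereSum_apply, Finset.sum_congr rfl h1, Finset.sum_const, nsmul_eq_mul]
      have h2 : ∀ y ∈ sphere hG.connected o n,
          ‖Λ.kernel (G.dist o y) * spherical q z (G.dist o y)‖ =
            ‖Λ.kernel n * spherical q z n‖ := by
        intro y hy
        rw [mem_sphere] at hy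
        rw [hy]
      rw [Finset.sum_congr rfl h2, Finset.sum_const, nsmul_eq_mul]
      simp only [norm_mul, Complex.norm_natCast]
      ring
    have hsX : Summable fun x : X =>
        ‖Λ.kernel (G.dist o x) * spherical q z (G.dist o x)‖ := by
      refine summable_of_sum_le (fun x => norm_nonneg _)
        (c := ∑' n, ‖Λ.kernel n * sphereSum hG.connected n Φ o‖) fun u => ?_
      have hmaps : ∀ x ∈ u, G.dist o x ∈ Finset.range (u.sup (G.dist o) + 1) := by
        intro x hx
        rw [Finset.mem_range]
        exact Nat.lt_succ_of_le (Finset.le_sup (f := G.dist o) hx)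
      rw [← Finset.sum_fiberwise_of_maps_to hmaps]
      refine le_trans (Finset.sum_le_sum fun n _ => ?_)
        (hsum.sum_le_tsum (Finset.range (u.sup (G.dist o) + 1)) fun n _ => norm_nonneg _)
      rw [← hSn]
      refine Finset.sum_le_sum_of_subset_of_nonneg (fun x hx => ?_) fun x _ _ => norm_nonneg _
      rw [mem_sphere]
      exact (Finset.mem_filter.1 hx).2
    have h := hasSum_finset_fiberwise hsX.of_norm.hasSum (G.dist o) (sphere hG.connected o)
      (fun n b => mem_sphere)
    simp only [hS] at h
    rw [h.tsum_eq] at hcoeff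
    exact hcoeff
  · have h2 := congrFun (LinearMap.congr_fun (ballSum_mul_cheb (G := G) (q := q) n 0) Φ) o
    simp only [Module.End.mul_apply, LinearMap.smul_apply, LinearMap.sum_apply, add_zero,
      cheb_spherical hG hreg hq0, hΦ, Pi.smul_apply, Finset.sum_apply] at h2
    simp only [Int.cast_zero, zero_mul, Complex.cosh_zero, one_smul, ← hζdef] at h2
    rw [← sum_antidiagonal_cosh]
    simpa [spherical] using h2
  · simp [sphereSum_zero, ballSum_zero]
  · simp [sphereSum_one, ballSum_one hq0]
  · simp [sphereSum_add_two hG hreg hq0]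

end Schwartz

/-! ### Fourier coefficients of periodic holomorphic functions on a strip -/

section Fourier

/-- The open vertical strip of half-width `σ`. -/
def openStrip (σ : ℝ) : Set ℂ := {ζ | |ζ.re| < σ}

/-- The closed vertical strip of half-width `σ`. -/
def closedStrip (σ : ℝ) : Set ℂ := {ζ | |ζ.re| ≤ σ}

theorem isOpen_openStrip (σ : ℝ) : IsOpen (openStrip σ) :=
  isOpen_lt (by fun_prop) continuous_const

theorem openStrip_subset (σ : ℝ) : openStrip σ ⊆ closedStrip σ := by
  intro ζ h
  simp only [openStrip, closedStrip, Set.mem_ofPred_eq] at h ⊢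
  exact h.le

theorem convex_openStrip (σ : ℝ) : Convex ℝ (openStrip σ) := by
  have : openStrip σ = Complex.reLm ⁻¹' Set.Ioo (-σ) σ := by
    ext ζ
    simp [openStrip, abs_lt]
  rw [this]
  exact (convex_Ioo (-σ) σ).is_linear_preimage Complex.reLm.isLinear

theorem mem_openStrip {σ s : ℝ} (hs : |s| < σ) (y : ℝ) : (s : ℂ) + y * Complex.I ∈ openStrip σ := by
  simpa [openStrip] using hs

theorem mem_openStrip_imag {σ : ℝ} (hσ : 0 < σ) (y : ℝ) : (y : ℂ) * Complex.I ∈ openStrip σ := by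
  simpa [openStrip] using hσ

/-- The `j`-th Fourier coefficient of the restriction of `g` to the imaginary axis. -/
def fourierCoef (g : ℂ → ℂ) (j : ℤ) : ℂ :=
  (2 * Real.pi : ℂ)⁻¹ *
    ∫ y in (0 : ℝ)..2 * Real.pi, g (y * Complex.I) * Complex.exp (-(j * (y * Complex.I)))

variable {σ : ℝ} {g : ℂ → ℂ}

theorem periodic_exp_int_mul (j : ℤ) :
    Function.Periodic (fun ζ : ℂ => Complex.exp (j * ζ)) (2 * Real.pi * Complex.I) := by
  intro ζ
  simp only
  rw [mul_add, Complex.exp_add, mul_comm (j : ℂ) (2 * Real.pi * Complex.I), mul_comm _ (j : ℂ),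
    Complex.exp_int_mul_two_pi_mul_I, mul_one]

/-- Integrals over a period do not depend on the vertical line. -/
theorem integral_vertical_eq (hg : DifferentiableOn ℂ g (openStrip σ))
    (hper : Function.Periodic g (2 * Real.pi * Complex.I)) {s : ℝ} (hs : |s| < σ) :
    ∫ y in (0 : ℝ)..2 * Real.pi, g (s + y * Complex.I) =
      ∫ y in (0 : ℝ)..2 * Real.pi, g (y * Complex.I) := by
  have hsub : Set.uIcc (0 : ℂ).re (s + (2 * Real.pi : ℝ) * Complex.I : ℂ).re ×ℂ
      Set.uIcc (0 : ℂ).im (s + (2 * Real.pi : ℝ) * Complex.I : ℂ).im ⊆ openStrip σ := by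
    intro ζ hζ
    have h1 := (Complex.mem_reProdIm.1 hζ).1
    simp only [Complex.zero_re, Complex.add_re, Complex.ofReal_re, Complex.mul_re, Complex.I_re,
      mul_zero, Complex.ofReal_im, Complex.I_im, mul_one, sub_self, add_zero] at h1
    have h2 := Set.abs_sub_left_of_mem_uIcc h1
    simp only [sub_zero] at h2
    rw [openStrip, Set.mem_ofPred_eq]
    exact h2.trans_lt hs
  have h := Complex.integral_boundary_rect_eq_zero_of_differentiableOn g 0
    (s + (2 * Real.pi : ℝ) * Complex.I) (hg.mono hsub)
  have e : ∀ x : ℝ, g (x + ((2 * Real.pi : ℝ) : ℂ) * Complex.I) = g x := by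
    intro x
    have := hper x
    push_cast
    exact this
  simp only [Complex.zero_re, Complex.add_re, Complex.ofReal_re, Complex.mul_re, Complex.I_re,
    mul_zero, Complex.ofReal_im, Complex.I_im, mul_one, sub_self, add_zero, Complex.zero_im,
    Complex.add_im, Complex.mul_im, zero_add, zero_mul, Complex.ofReal_zero, e,
    sub_self, smul_eq_mul] at h
  exact mul_left_cancel₀ Complex.I_ne_zero (sub_eq_zero.1 h)

theorem norm_fourierCoef_le_exp (hg : DifferentiableOn ℂ g (openStrip σ))
    (hper : Function.Periodic g (2 * Real.pi * Complex.I)) {B : ℝ}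
    (hB : ∀ ζ ∈ openStrip σ, ‖g ζ‖ ≤ B) (j : ℤ) {s : ℝ} (hs : |s| < σ) :
    ‖fourierCoef g j‖ ≤ B * Real.exp (-(j * s)) := by
  have hπ : (0 : ℝ) < 2 * Real.pi := by positivity
  have hexp : ∀ ζ : ℂ, Complex.exp (-(j * ζ)) = Complex.exp ((-j : ℤ) * ζ) := by
    intro ζ
    push_cast
    rw [neg_mul]
  have h1 := integral_vertical_eq (g := fun ζ => g ζ * Complex.exp (-(j * ζ)))
    (hg.mul (by fun_prop)) (by
      simp only [hexp]
      exact hper.mul (periodic_exp_int_mul (-j))) hs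
  rw [fourierCoef, ← h1, norm_mul]
  have h2 := intervalIntegral.norm_integral_le_of_norm_le_const (a := 0) (b := 2 * Real.pi)
    (f := fun y : ℝ => g (s + y * Complex.I) * Complex.exp (-(j * (s + y * Complex.I))))
    (C := B * Real.exp (-(j * s))) (fun y _ => by
      rw [norm_mul, Complex.norm_exp]
      have e : (-((j : ℂ) * (s + y * Complex.I))).re = -(j * s) := by simp
      rw [e]
      exact mul_le_mul_of_nonneg_right (hB _ (mem_openStrip hs y)) (Real.exp_pos _).le)
  rw [sub_zero, abs_of_pos hπ] at h2
  have e : ‖(2 * Real.pi : ℂ)⁻¹‖ = (2 * Real.pi)⁻¹ := by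
    rw [norm_inv, norm_mul, Complex.norm_real, Complex.norm_ofNat, Real.norm_eq_abs,
      abs_of_pos Real.pi_pos]
  rw [e, inv_mul_le_iff₀ hπ]
  linarith

theorem norm_fourierCoef_le (hσ : 0 < σ) (hg : DifferentiableOn ℂ g (openStrip σ))
    (hper : Function.Periodic g (2 * Real.pi * Complex.I)) {B : ℝ}
    (hB : ∀ ζ ∈ openStrip σ, ‖g ζ‖ ≤ B) (j : ℤ) :
    ‖fourierCoef g j‖ * Real.exp σ ^ j.natAbs ≤ B := by
  have key : ‖fourierCoef g j‖ ≤ B * Real.exp (-(j.natAbs * σ)) := by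
    -- move the line of integration to the boundary on the side where `e^{-jζ}` decreases
    have hlim : Tendsto (fun s : ℝ => B * Real.exp (-(j.natAbs * s))) (𝓝[<] σ)
        (𝓝 (B * Real.exp (-(j.natAbs * σ)))) := by
      refine Tendsto.mono_left ?_ nhdsWithin_le_nhds
      exact Continuous.tendsto (by fun_prop) σ
    refine ge_of_tendsto hlim ?_
    filter_upwards [Ioo_mem_nhdsLT hσ] with s hs
    rcases Int.natAbs_eq j with hj | hj
    · have h := norm_fourierCoef_le_exp hg hper hB j (s := s) (by rw [abs_of_pos hs.1]; exact hs.2)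
      have e : ((j : ℤ) : ℝ) = j.natAbs := by
        rw [hj]
        simp
      rwa [e] at h
    · have h := norm_fourierCoef_le_exp hg hper hB j (s := -s)
        (by rw [abs_neg, abs_of_pos hs.1]; exact hs.2)
      have e : ((j : ℤ) : ℝ) = -(j.natAbs : ℝ) := by
        rw [hj]
        simp
      rwa [e, neg_mul_neg] at h
  have hE : Real.exp σ ^ j.natAbs = Real.exp (j.natAbs * σ) := (Real.exp_nat_mul σ j.natAbs).symm
  calc ‖fourierCoef g j‖ * Real.exp σ ^ j.natAbs
      ≤ B * Real.exp (-(j.natAbs * σ)) * Real.exp σ ^ j.natAbs := by gcongr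
    _ = B := by rw [hE, mul_assoc, ← Real.exp_add]; simp

theorem fourierCoef_deriv (hσ : 0 < σ) (hg : DifferentiableOn ℂ g (openStrip σ))
    (hper : Function.Periodic g (2 * Real.pi * Complex.I)) (j : ℤ) :
    fourierCoef (deriv g) j = j * fourierCoef g j := by
  have hd : ∀ y : ℝ, HasDerivAt g (deriv g (y * Complex.I)) (y * Complex.I) := fun y =>
    (hg.differentiableAt ((isOpen_openStrip σ).mem_nhds (mem_openStrip_imag hσ y))).hasDerivAt
  have hline : ∀ y : ℝ, HasDerivAt (fun y : ℝ => (y : ℂ) * Complex.I) Complex.I y := fun y => by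
    simpa using (Complex.ofRealCLM.hasDerivAt (x := y)).mul_const Complex.I
  have hcont : ContinuousOn (deriv g) (openStrip σ) :=
    (hg.deriv (isOpen_openStrip σ)).continuousOn
  have hc1 : Continuous fun y : ℝ => deriv g (y * Complex.I) :=
    hcont.comp_continuous (by fun_prop) fun y => mem_openStrip_imag hσ y
  have hc0 : Continuous fun y : ℝ => g (y * Complex.I) :=
    hg.continuousOn.comp_continuous (by fun_prop) fun y => mem_openStrip_imag hσ y
  have hF : ∀ y : ℝ, HasDerivAt
      (fun y : ℝ => g (y * Complex.I) * Complex.exp (-(j * (y * Complex.I))))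
      (Complex.I * (deriv g (y * Complex.I) * Complex.exp (-(j * (y * Complex.I)))) -
        Complex.I * j * (g (y * Complex.I) * Complex.exp (-(j * (y * Complex.I))))) y := by
    intro y
    have h1 := (hd y).comp y (hline y)
    have h2 := (((hline y).const_mul (j : ℂ)).neg).cexp
    refine (h1.mul h2).congr_deriv ?_
    simp only [Function.comp_apply, Pi.neg_apply]
    ring
  have hi1 : IntervalIntegrable (fun y : ℝ => Complex.I * (deriv g (y * Complex.I) *
      Complex.exp (-(j * (y * Complex.I))))) MeasureTheory.volume 0 (2 * Real.pi) :=
    Continuous.intervalIntegrable (by fun_prop) _ _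
  have hc2 : Continuous fun y : ℝ => g (y * Complex.I) * Complex.exp (-(j * (y * Complex.I))) :=
    hc0.mul (by fun_prop)
  have hi2 : IntervalIntegrable (fun y : ℝ => Complex.I * j * (g (y * Complex.I) *
      Complex.exp (-(j * (y * Complex.I))))) MeasureTheory.volume 0 (2 * Real.pi) :=
    (continuous_const.mul hc2).intervalIntegrable _ _
  have h := intervalIntegral.integral_eq_sub_of_hasDerivAt (fun y _ => hF y) (hi1.sub hi2)
  have hend : g ((2 * Real.pi : ℝ) * Complex.I) *
      Complex.exp (-(j * (((2 * Real.pi : ℝ) : ℂ) * Complex.I))) =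
      g ((0 : ℝ) * Complex.I) * Complex.exp (-(j * (((0 : ℝ) : ℂ) * Complex.I))) := by
    have e1 := hper 0
    have e2 := periodic_exp_int_mul (-j) 0
    push_cast at e1 e2 ⊢
    simp only [zero_add, neg_mul] at e1 e2
    rw [e1, e2]
    simp
  rw [hend, sub_self, intervalIntegral.integral_sub hi1 hi2, intervalIntegral.integral_const_mul,
    intervalIntegral.integral_const_mul, mul_assoc, ← mul_sub] at h
  have h3 := sub_eq_zero.1 ((mul_eq_zero.1 h).resolve_left Complex.I_ne_zero)
  rw [fourierCoef, fourierCoef, h3]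
  ring

theorem periodic_iteratedDeriv {c : ℂ} (hper : Function.Periodic g c) (m : ℕ) :
    Function.Periodic (iteratedDeriv m g) c := by
  induction m with
  | zero => simpa using hper
  | succ m ih =>
    rw [iteratedDeriv_succ]
    intro ζ
    rw [← deriv_comp_add_const]
    congr 1
    funext w
    exact ih w

theorem differentiableOn_iteratedDeriv (hg : DifferentiableOn ℂ g (openStrip σ)) (m : ℕ) :
    DifferentiableOn ℂ (iteratedDeriv m g) (openStrip σ) := by
  induction m with
  | zero => simpa using hg
  | succ m ih =>
    rw [iteratedDeriv_succ]
    exact ih.deriv (isOpen_openStrip σ)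

/-- Fourier coefficients of a function whose derivatives are bounded on the strip. -/
theorem norm_pow_mul_fourierCoef_le (hσ : 0 < σ) (hg : DifferentiableOn ℂ g (openStrip σ))
    (hper : Function.Periodic g (2 * Real.pi * Complex.I)) {B : ℝ} (m : ℕ)
    (hB : ∀ ζ ∈ openStrip σ, ‖iteratedDeriv m g ζ‖ ≤ B) (j : ℤ) :
    (j.natAbs : ℝ) ^ m * (‖fourierCoef g j‖ * Real.exp σ ^ j.natAbs) ≤ B := by
  have h : ∀ m, fourierCoef (iteratedDeriv m g) j = (j : ℂ) ^ m * fourierCoef g j := by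
    intro m
    induction m with
    | zero => simp
    | succ m ih =>
      rw [iteratedDeriv_succ, fourierCoef_deriv hσ (differentiableOn_iteratedDeriv hg m)
        (periodic_iteratedDeriv hper m), ih]
      ring
  have h2 := norm_fourierCoef_le hσ (differentiableOn_iteratedDeriv hg m)
    (periodic_iteratedDeriv hper m) hB j
  rw [h, norm_mul, norm_pow, Complex.norm_intCast, ← Int.cast_abs, ← Nat.cast_natAbs,
    mul_assoc] at h2
  exact h2

end Fourier

/-! ### Laurent series on the closed strip and their resolvents -/

section Laurent

variable {ι : Type*}

/-- The exponential sum `∑ β_a e^{d_a ζ}`; in the variable `w = e^ζ` it is a Laurent series in which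
the same power of `w` may be listed several times. -/
def laurent (β : ι → ℂ) (d : ι → ℤ) (ζ : ℂ) : ℂ := ∑' a, β a * Complex.exp (d a * ζ)

/-- The coefficients decay so fast that all derivatives of the Laurent series converge absolutely
on the closed strip of half-width `σ`. -/
def RapidDecay (σ : ℝ) (β : ι → ℂ) (d : ι → ℤ) : Prop :=
  ∀ N : ℕ, Summable fun a => ‖β a‖ * ((1 + ((d a).natAbs : ℝ)) ^ N * Real.exp σ ^ (d a).natAbs)

variable {σ : ℝ} {β : ι → ℂ} {d : ι → ℤ}

theorem RapidDecay.mul_pow (h : RapidDecay σ β d) (m : ℕ) :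
    RapidDecay σ (fun a => β a * (d a : ℂ) ^ m) d := by
  intro N
  refine Summable.of_nonneg_of_le (fun a => by positivity) (fun a => ?_) (h (m + N))
  rw [norm_mul, norm_pow, Complex.norm_intCast, ← Int.cast_abs, ← Nat.cast_natAbs, pow_add,
    mul_assoc, mul_assoc ((1 + ((d a).natAbs : ℝ)) ^ m)]
  gcongr
  linarith

theorem RapidDecay.summable (h : RapidDecay σ β d) :
    Summable fun a => ‖β a‖ * Real.exp σ ^ (d a).natAbs := by
  simpa using h 0

theorem norm_laurent_term_le {ζ : ℂ} (hζ : ζ ∈ closedStrip σ) (a : ι) :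
    ‖β a * Complex.exp (d a * ζ)‖ ≤ ‖β a‖ * Real.exp σ ^ (d a).natAbs := by
  rw [norm_mul]
  exact mul_le_mul_of_nonneg_left (norm_exp_int_mul_le hζ (d a)) (norm_nonneg _)

theorem hasSum_laurent (h : RapidDecay σ β d) {ζ : ℂ} (hζ : ζ ∈ closedStrip σ) :
    HasSum (fun a => β a * Complex.exp (d a * ζ)) (laurent β d ζ) :=
  (Summable.of_norm_bounded h.summable fun a => norm_laurent_term_le hζ a).hasSum

theorem norm_laurent_le (h : RapidDecay σ β d) {ζ : ℂ} (hζ : ζ ∈ closedStrip σ) :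
    ‖laurent β d ζ‖ ≤ ∑' a, ‖β a‖ * Real.exp σ ^ (d a).natAbs :=
  tsum_of_norm_bounded h.summable.hasSum fun a => norm_laurent_term_le hζ a

theorem continuousOn_laurent (h : RapidDecay σ β d) :
    ContinuousOn (laurent β d) (closedStrip σ) :=
  continuousOn_tsum (fun a => by fun_prop) h.summable fun a _ hζ => norm_laurent_term_le hζ a

theorem hasDerivAt_laurent (hσ : 0 < σ) (h : RapidDecay σ β d) {ζ : ℂ} (hζ : ζ ∈ openStrip σ) :
    HasDerivAt (laurent β d) (laurent (fun a => β a * d a) d ζ) ζ := by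
  have h1 : RapidDecay σ (fun a => β a * d a) d := by simpa using h.mul_pow 1
  have h0 : (0 : ℂ) ∈ openStrip σ := by simpa [openStrip] using hσ
  have hterm : ∀ (a : ι) (w : ℂ), w ∈ openStrip σ →
      HasDerivAt (fun w => β a * Complex.exp (d a * w)) (β a * d a * Complex.exp (d a * w)) w := by
    intro a w _
    have h2 := (((hasDerivAt_id w).const_mul (d a : ℂ)).cexp).const_mul (β a)
    refine h2.congr_deriv ?_
    simp only [id]
    ring
  exact hasDerivAt_tsum_of_isPreconnected (g := fun a w => β a * Complex.exp (d a * w))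
    (g' := fun a w => β a * d a * Complex.exp (d a * w)) h1.summable (isOpen_openStrip σ)
    (convex_openStrip σ).isPreconnected hterm
    (fun a w hw => norm_laurent_term_le (β := fun a => β a * d a) (d := d)
      (openStrip_subset σ hw) a) h0
    (hasSum_laurent h (openStrip_subset σ h0)).summable hζ

theorem differentiableOn_laurent (hσ : 0 < σ) (h : RapidDecay σ β d) :
    DifferentiableOn ℂ (laurent β d) (openStrip σ) := fun _ hζ =>
  (hasDerivAt_laurent hσ h hζ).differentiableAt.differentiableWithinAt

theorem iteratedDeriv_laurent (hσ : 0 < σ) (h : RapidDecay σ β d) (m : ℕ) :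
    Set.EqOn (iteratedDeriv m (laurent β d)) (laurent (fun a => β a * (d a : ℂ) ^ m) d)
      (openStrip σ) := by
  induction m with
  | zero =>
    intro ζ _
    simp
  | succ m ih =>
    intro ζ hζ
    rw [iteratedDeriv_succ, (ih.eventuallyEq_of_mem ((isOpen_openStrip σ).mem_nhds hζ)).deriv_eq,
      (hasDerivAt_laurent hσ (h.mul_pow m) hζ).deriv]
    simp only [pow_succ, mul_assoc]

theorem periodic_laurent : Function.Periodic (laurent β d) (2 * Real.pi * Complex.I) := by
  intro ζ
  unfold laurent
  exact tsum_congr fun a => congrArg (β a * ·) (periodic_exp_int_mul (d a) ζ)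

/-- A value that is omitted on the closed strip keeps a positive distance from the range. -/
theorem exists_pos_le_norm_laurent_sub (hσ : 0 < σ) (h : RapidDecay σ β d) {μ : ℂ}
    (hμ : ∀ ζ ∈ closedStrip σ, laurent β d ζ ≠ μ) :
    ∃ ε > 0, ∀ ζ ∈ closedStrip σ, ε ≤ ‖laurent β d ζ - μ‖ := by
  set Q : Set ℂ := Set.Icc (-σ) σ ×ℂ Set.Icc 0 (2 * Real.pi) with hQ
  have hQsub : Q ⊆ closedStrip σ := by
    intro ζ hζ
    simpa [closedStrip, abs_le] using (Complex.mem_reProdIm.1 hζ).1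
  have hcomp : IsCompact Q := isCompact_Icc.reProdIm isCompact_Icc
  have hne : Q.Nonempty := ⟨0, by
    rw [hQ, Complex.mem_reProdIm]
    simp [hσ.le, Real.pi_pos.le]⟩
  have hcont : ContinuousOn (fun ζ => ‖laurent β d ζ - μ‖) Q :=
    (((continuousOn_laurent h).mono hQsub).sub continuousOn_const).norm
  obtain ⟨ζ₀, hζ₀, hmin⟩ := hcomp.exists_isMinOn hne hcont
  refine ⟨‖laurent β d ζ₀ - μ‖, norm_pos_iff.2 (sub_ne_zero.2 (hμ ζ₀ (hQsub hζ₀))),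
    fun ζ hζ => ?_⟩
  -- translate `ζ` into the fundamental rectangle
  set n : ℤ := ⌊ζ.im / (2 * Real.pi)⌋ with hn
  have hπ : (0 : ℝ) < 2 * Real.pi := by positivity
  have hper := (periodic_laurent (β := β) (d := d)).sub_zsmul_eq (x := ζ) n
  have hmem : ζ - n • (2 * Real.pi * Complex.I) ∈ Q := by
    rw [hQ, Complex.mem_reProdIm]
    have e1 : (ζ - n • (2 * Real.pi * Complex.I : ℂ)).re = ζ.re := by simp
    have e2 : (ζ - n • (2 * Real.pi * Complex.I : ℂ)).im = ζ.im - n * (2 * Real.pi) := by simp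
    rw [e1, e2]
    have h1 := Int.floor_le (ζ.im / (2 * Real.pi))
    have h2 := (Int.lt_floor_add_one (ζ.im / (2 * Real.pi))).le
    rw [← hn, le_div_iff₀ hπ] at h1
    rw [← hn, div_le_iff₀ hπ] at h2
    refine ⟨abs_le.1 (by simpa [closedStrip] using hζ), ?_, ?_⟩ <;> linarith
  have h3 := hmin hmem
  rw [Set.mem_ofPred_eq] at h3
  simpa only [hper] using h3

variable (β d) in
/-- The function `1/(K - μ)` for the Laurent series `K`. -/
def resolventFun (μ ζ : ℂ) : ℂ := (laurent β d ζ - μ)⁻¹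

theorem periodic_resolventFun (μ : ℂ) :
    Function.Periodic (resolventFun β d μ) (2 * Real.pi * Complex.I) := by
  intro ζ
  rw [resolventFun, resolventFun, periodic_laurent ζ]

theorem differentiableOn_resolventFun (hσ : 0 < σ) (h : RapidDecay σ β d) {μ : ℂ}
    (hμ : ∀ ζ ∈ closedStrip σ, laurent β d ζ ≠ μ) :
    DifferentiableOn ℂ (resolventFun β d μ) (openStrip σ) :=
  ((differentiableOn_laurent hσ h).sub_const μ).inv fun ζ hζ =>
    sub_ne_zero.2 (hμ ζ (openStrip_subset σ hζ))

/-- The derivatives of `1/(K - μ)` grow at most like a power of the inverse distance from `μ` to the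
range of `K`: differentiate `(K - μ) · 1/(K - μ) = 1` by the Leibniz rule. -/
theorem norm_iteratedDeriv_resolventFun_le (hσ : 0 < σ) (h : RapidDecay σ β d) (m : ℕ) :
    ∃ C : ℝ, 0 ≤ C ∧ ∀ (μ : ℂ) (ε : ℝ), 0 < ε →
      (∀ ζ ∈ closedStrip σ, ε ≤ ‖laurent β d ζ - μ‖) → ∀ i ≤ m, ∀ ζ ∈ openStrip σ,
        ‖iteratedDeriv i (resolventFun β d μ) ζ‖ ≤ C * (1 + 1 / ε) ^ (i + 1) := by
  induction m with
  | zero =>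
    refine ⟨1, zero_le_one, fun μ ε hε hμ i hi ζ hζ => ?_⟩
    obtain rfl : i = 0 := by omega
    have h1 := hμ ζ (openStrip_subset σ hζ)
    rw [iteratedDeriv_zero, resolventFun, norm_inv, zero_add, pow_one, one_mul, ← one_div]
    have h2 := one_div_le_one_div_of_le hε h1
    linarith
  | succ m ih =>
    obtain ⟨C, hC, ih⟩ := ih
    set B : ℕ → ℝ := fun n => ∑' a, ‖β a * (d a : ℂ) ^ n‖ * Real.exp σ ^ (d a).natAbs
    have hB0 : ∀ n, 0 ≤ B n := fun n => tsum_nonneg fun a => by positivity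
    set E : ℝ := ∑ i ∈ Finset.range (m + 1), ((m + 1).choose i : ℝ) * C * B (m + 1 - i) with hE
    have hE0 : 0 ≤ E := Finset.sum_nonneg fun i _ =>
      mul_nonneg (mul_nonneg (Nat.cast_nonneg _) hC) (hB0 _)
    refine ⟨C + E, by positivity, fun μ ε hε hμ i hi ζ hζ => ?_⟩
    have hε1 : 0 < 1 / ε := by positivity
    rcases Nat.lt_or_ge i (m + 1) with hlt | hge
    · refine (ih μ ε hε hμ i (by omega) ζ hζ).trans ?_
      gcongr
      linarith
    obtain rfl : i = m + 1 := by omega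
    have hne : ∀ w ∈ closedStrip σ, laurent β d w ≠ μ := fun w hw e => by
      have := hμ w hw
      rw [e, sub_self, norm_zero] at this
      linarith
    have hO := (isOpen_openStrip σ).mem_nhds hζ
    set f : ℂ → ℂ := fun w => laurent β d w - μ
    have hfd : DifferentiableOn ℂ f (openStrip σ) := (differentiableOn_laurent hσ h).sub_const μ
    have hgd := differentiableOn_resolventFun hσ h hne
    have hprod : (resolventFun β d μ * f) =ᶠ[𝓝 ζ] fun _ => 1 := by
      filter_upwards [hO] with w hw
      exact inv_mul_cancel₀ (sub_ne_zero.2 (hne w (openStrip_subset σ hw)))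
    have h1 := iteratedDeriv_mul (n := m + 1) ((hgd.analyticAt hO).contDiffAt)
      ((hfd.analyticAt hO).contDiffAt)
    rw [hprod.iteratedDeriv_eq, iteratedDeriv_const, if_neg (by omega), Finset.sum_range_succ,
      Nat.choose_self, Nat.sub_self, iteratedDeriv_zero, Nat.cast_one, one_mul] at h1
    have hfi : ∀ n : ℕ, ‖iteratedDeriv (n + 1) f ζ‖ ≤ B (n + 1) := by
      intro n
      have e : iteratedDeriv (n + 1) f = iteratedDeriv (n + 1) (laurent β d) := by
        rw [iteratedDeriv_succ', iteratedDeriv_succ']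
        congr 1
        funext w
        exact deriv_sub_const μ
      rw [e, iteratedDeriv_laurent hσ h (n + 1) hζ]
      exact norm_laurent_le (h.mul_pow (n + 1)) (openStrip_subset σ hζ)
    have hsum : ‖∑ i ∈ Finset.range (m + 1), ((m + 1).choose i : ℂ) *
        iteratedDeriv i (resolventFun β d μ) ζ * iteratedDeriv (m + 1 - i) f ζ‖ ≤
          E * (1 + 1 / ε) ^ (m + 1) := by
      rw [hE, Finset.sum_mul]
      refine norm_sum_le_of_le _ fun i hi => ?_
      rw [Finset.mem_range] at hi
      obtain ⟨n, hn⟩ : ∃ n, m + 1 - i = n + 1 := ⟨m - i, by omega⟩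
      have h2 := ih μ ε hε hμ i (by omega) ζ hζ
      have h3 : (1 + 1 / ε) ^ (i + 1) ≤ (1 + 1 / ε) ^ (m + 1) :=
        pow_le_pow_right₀ (by linarith) (by omega)
      rw [hn, norm_mul, norm_mul, Complex.norm_natCast]
      calc ((m + 1).choose i : ℝ) * ‖iteratedDeriv i (resolventFun β d μ) ζ‖ *
            ‖iteratedDeriv (n + 1) f ζ‖
          ≤ ((m + 1).choose i : ℝ) * (C * (1 + 1 / ε) ^ (m + 1)) * B (n + 1) := by
            gcongr
            · exact h2.trans (mul_le_mul_of_nonneg_left h3 hC)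
            · exact hfi n
        _ = _ := by ring
    have h4 : ‖iteratedDeriv (m + 1) (resolventFun β d μ) ζ‖ * ‖f ζ‖ ≤
        E * (1 + 1 / ε) ^ (m + 1) := by
      rw [← norm_mul, ← neg_eq_of_add_eq_zero_right h1.symm, norm_neg]
      exact hsum
    have h5 := hμ ζ (openStrip_subset σ hζ)
    have h6 : ‖iteratedDeriv (m + 1) (resolventFun β d μ) ζ‖ * ε ≤ E * (1 + 1 / ε) ^ (m + 1) :=
      (mul_le_mul_of_nonneg_left h5 (norm_nonneg _)).trans h4
    rw [← le_div_iff₀ hε] at h6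
    refine h6.trans ?_
    have h7 : 0 ≤ (1 + 1 / ε) ^ (m + 1) := by positivity
    rw [div_eq_mul_one_div, pow_succ _ (m + 1), ← mul_assoc]
    refine mul_le_mul ?_ (by linarith) hε1.le (by positivity)
    exact mul_le_mul_of_nonneg_right (by linarith) h7

/-- The Laurent coefficients of `1/(K - μ)` decay rapidly. -/
theorem norm_fourierCoef_resolventFun_le (hσ : 0 < σ) (h : RapidDecay σ β d) (N : ℕ) :
    ∃ C : ℝ, 0 ≤ C ∧ ∀ (μ : ℂ) (ε : ℝ), 0 < ε →
      (∀ ζ ∈ closedStrip σ, ε ≤ ‖laurent β d ζ - μ‖) → ∀ j : ℤ,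
        (1 + (j.natAbs : ℝ)) ^ N * (‖fourierCoef (resolventFun β d μ) j‖ *
          Real.exp σ ^ j.natAbs) ≤ C * (1 + 1 / ε) ^ (N + 1) := by
  obtain ⟨C, hC, hb⟩ := norm_iteratedDeriv_resolventFun_le hσ h N
  refine ⟨2 ^ N * (C + C), by positivity, fun μ ε hε hμ j => ?_⟩
  have hne : ∀ w ∈ closedStrip σ, laurent β d w ≠ μ := fun w hw e => by
    have := hμ w hw
    rw [e, sub_self, norm_zero] at this
    linarith
  have hd := differentiableOn_resolventFun hσ h hne
  have h0 := norm_pow_mul_fourierCoef_le hσ hd (periodic_resolventFun μ) 0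
    (hb μ ε hε hμ 0 (by omega)) j
  have h1 := norm_pow_mul_fourierCoef_le hσ hd (periodic_resolventFun μ) N
    (hb μ ε hε hμ N le_rfl) j
  have hε1 : 0 < 1 / ε := by positivity
  have h2 : C * (1 + 1 / ε) ^ (0 + 1) ≤ C * (1 + 1 / ε) ^ (N + 1) :=
    mul_le_mul_of_nonneg_left (pow_le_pow_right₀ (by linarith) (by omega)) hC
  have h3 : (1 + (j.natAbs : ℝ)) ^ N ≤ 2 ^ N * (1 + (j.natAbs : ℝ) ^ N) := by
    rcases Nat.eq_zero_or_pos j.natAbs with hj | hj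
    · rw [hj]
      have e : (1 : ℝ) ≤ 2 ^ N := one_le_pow₀ (by norm_num)
      have e2 : (0 : ℝ) ≤ ((0 : ℕ) : ℝ) ^ N := by positivity
      have e3 : (1 + ((0 : ℕ) : ℝ)) ^ N = 1 := by simp
      rw [e3]
      nlinarith
    · have hj1 : (1 : ℝ) ≤ j.natAbs := by exact_mod_cast hj
      calc (1 + (j.natAbs : ℝ)) ^ N ≤ (2 * j.natAbs) ^ N := by
            gcongr
            linarith
        _ = 2 ^ N * (j.natAbs : ℝ) ^ N := mul_pow _ _ _
        _ ≤ _ := by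
            gcongr
            linarith
  set A := ‖fourierCoef (resolventFun β d μ) j‖ * Real.exp σ ^ j.natAbs
  have hA0 : 0 ≤ A := by positivity
  calc (1 + (j.natAbs : ℝ)) ^ N * A ≤ 2 ^ N * (1 + (j.natAbs : ℝ) ^ N) * A := by gcongr
    _ = 2 ^ N * ((j.natAbs : ℝ) ^ 0 * A + (j.natAbs : ℝ) ^ N * A) := by ring
    _ ≤ 2 ^ N * (C * (1 + 1 / ε) ^ (N + 1) + C * (1 + 1 / ε) ^ (N + 1)) := by
      exact mul_le_mul_of_nonneg_left (add_le_add (h0.trans h2) h1) (by positivity)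
    _ = _ := by ring

/-- The coefficients of `1/(K - μ)` invert those of `K - μ` under convolution. -/
theorem hasSum_convolution_resolventFun [Countable ι] (hσ : 0 < σ) (h : RapidDecay σ β d) {μ : ℂ}
    (hμ : ∀ ζ ∈ closedStrip σ, laurent β d ζ ≠ μ) (n : ℤ) :
    HasSum (fun a => β a * fourierCoef (resolventFun β d μ) (n - d a))
      (μ * fourierCoef (resolventFun β d μ) n + if n = 0 then 1 else 0) := by
  set g := resolventFun β d μ
  have hc : Continuous fun y : ℝ => g (y * Complex.I) :=
    (differentiableOn_resolventFun hσ h hμ).continuousOn.comp_continuous (by fun_prop)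
      fun y => mem_openStrip_imag hσ y
  obtain ⟨B, hB⟩ : ∃ B, ∀ y ∈ Set.uIcc (0 : ℝ) (2 * Real.pi), ‖g (y * Complex.I)‖ ≤ B :=
    isCompact_uIcc.exists_bound_of_continuousOn hc.continuousOn
  have hmem : ∀ y : ℝ, (y : ℂ) * Complex.I ∈ closedStrip σ := fun y =>
    openStrip_subset σ (mem_openStrip_imag hσ y)
  have hsβ : Summable fun a => ‖β a‖ := by
    refine Summable.of_nonneg_of_le (fun a => norm_nonneg _) (fun a => ?_) h.summable
    exact le_mul_of_one_le_right (norm_nonneg _) (one_le_pow₀ (Real.one_le_exp hσ.le))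
  have hexp1 : ∀ (k : ℤ) (y : ℝ), ‖Complex.exp (-(k * (y * Complex.I)))‖ = 1 := by
    intro k y
    rw [Complex.norm_exp]
    simp
  have hterm : ∀ (y : ℝ) (a : ι),
      β a * (g (y * Complex.I) * Complex.exp (-(((n - d a : ℤ) : ℂ) * (y * Complex.I)))) =
        β a * Complex.exp (d a * (y * Complex.I)) *
          (g (y * Complex.I) * Complex.exp (-(n * (y * Complex.I)))) := by
    intro y a
    have e : -(((n - d a : ℤ) : ℂ) * (y * Complex.I)) =
        d a * (y * Complex.I) + -(n * (y * Complex.I)) := by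
      push_cast
      ring
    rw [e, Complex.exp_add]
    ring
  have key := intervalIntegral.hasSum_integral_of_dominated_convergence
    (a := 0) (b := 2 * Real.pi) (μ := MeasureTheory.volume)
    (F := fun a (y : ℝ) => β a * (g (y * Complex.I) *
      Complex.exp (-(((n - d a : ℤ) : ℂ) * (y * Complex.I)))))
    (f := fun y : ℝ => laurent β d (y * Complex.I) *
      (g (y * Complex.I) * Complex.exp (-(n * (y * Complex.I)))))
    (fun a _ => ‖β a‖ * B)
    (fun a => (continuous_const.mul (hc.mul (by fun_prop))).aestronglyMeasurable)
    (fun a => Eventually.of_forall fun y hy => by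
      rw [norm_mul, norm_mul, hexp1, mul_one]
      exact mul_le_mul_of_nonneg_left (hB y (Set.uIoc_subset_uIcc hy)) (norm_nonneg _))
    (Eventually.of_forall fun y _ => hsβ.mul_right B)
    intervalIntegrable_const
    (Eventually.of_forall fun y _ => by
      simp only [hterm]
      exact (hasSum_laurent h (hmem y)).mul_right _)
  have hval : ∀ y : ℝ, laurent β d (y * Complex.I) *
      (g (y * Complex.I) * Complex.exp (-(n * (y * Complex.I)))) =
        Complex.exp (-(n * (y * Complex.I))) +
          μ * (g (y * Complex.I) * Complex.exp (-(n * (y * Complex.I)))) := by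
    intro y
    have h1 : (laurent β d (y * Complex.I) - μ) * g (y * Complex.I) = 1 :=
      mul_inv_cancel₀ (sub_ne_zero.2 (hμ _ (hmem y)))
    linear_combination Complex.exp (-(n * (y * Complex.I))) * h1
  have hi1 : IntervalIntegrable (fun y : ℝ => Complex.exp (-(n * (y * Complex.I))))
      MeasureTheory.volume 0 (2 * Real.pi) := Continuous.intervalIntegrable (by fun_prop) _ _
  have hi2 : IntervalIntegrable (fun y : ℝ => μ * (g (y * Complex.I) *
      Complex.exp (-(n * (y * Complex.I))))) MeasureTheory.volume 0 (2 * Real.pi) :=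
    (continuous_const.mul (hc.mul (by fun_prop))).intervalIntegrable _ _
  have hπ : (2 * Real.pi : ℂ) ≠ 0 := by
    simp
  have horth : ∫ y in (0 : ℝ)..2 * Real.pi, Complex.exp (-(n * (y * Complex.I))) =
      if n = 0 then (2 * Real.pi : ℂ) else 0 := by
    split_ifs with hn
    · simp [hn]
    · have hc0 : -(n * Complex.I) ≠ 0 := by simpa using hn
      have e : ∀ y : ℝ, Complex.exp (-(n * (y * Complex.I))) =
          Complex.exp (-(n * Complex.I) * y) := fun y => by
        congr 1
        ring
      simp only [e]
      rw [integral_exp_mul_complex hc0]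
      have e2 : -(n * Complex.I) * ((2 * Real.pi : ℝ) : ℂ) =
          ((-n : ℤ) : ℂ) * (2 * Real.pi * Complex.I) := by
        push_cast
        ring
      rw [e2, Complex.exp_int_mul_two_pi_mul_I]
      simp
  simp only [hval] at key
  rw [intervalIntegral.integral_add hi1 hi2, horth, intervalIntegral.integral_const_mul] at key
  have key2 := key.mul_left (2 * Real.pi : ℂ)⁻¹
  have e1 : (fun a => β a * fourierCoef g (n - d a)) = fun a => (2 * Real.pi : ℂ)⁻¹ *
      ∫ y in (0 : ℝ)..2 * Real.pi, β a * (g (y * Complex.I) *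
        Complex.exp (-(((n - d a : ℤ) : ℂ) * (y * Complex.I)))) := by
    funext a
    rw [intervalIntegral.integral_const_mul, fourierCoef]
    ring
  have e2 : (μ * fourierCoef g n + if n = 0 then 1 else 0) = (2 * Real.pi : ℂ)⁻¹ *
      ((if n = 0 then (2 * Real.pi : ℂ) else 0) + μ * ∫ y in (0 : ℝ)..2 * Real.pi,
        g (y * Complex.I) * Complex.exp (-(n * (y * Complex.I)))) := by
    rw [fourierCoef, mul_add, mul_ite, inv_mul_cancel₀ hπ, mul_zero]
    ring
  rw [e1, e2]
  exact key2

theorem differentiableAt_fourierCoef_resolventFun (hσ : 0 < σ) (h : RapidDecay σ β d) {μ : ℂ}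
    {ε : ℝ} (hε : 0 < ε) (hμ : ∀ ζ ∈ closedStrip σ, ε ≤ ‖laurent β d ζ - μ‖) (j : ℤ) :
    DifferentiableAt ℂ (fun w => fourierCoef (resolventFun β d w) j) μ := by
  have hmem : ∀ y : ℝ, (y : ℂ) * Complex.I ∈ closedStrip σ := fun y =>
    openStrip_subset σ (mem_openStrip_imag hσ y)
  have hK : Continuous fun y : ℝ => laurent β d (y * Complex.I) :=
    (continuousOn_laurent h).comp_continuous (by fun_prop) hmem
  have hlow : ∀ w ∈ Metric.ball μ (ε / 2), ∀ y : ℝ,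
      ε / 2 ≤ ‖laurent β d (y * Complex.I) - w‖ := by
    intro w hw y
    rw [Metric.mem_ball, dist_eq_norm] at hw
    have h1 := hμ _ (hmem y)
    have h2 := norm_sub_le_norm_sub_add_norm_sub (laurent β d (y * Complex.I)) w μ
    linarith
  have hne : ∀ w ∈ Metric.ball μ (ε / 2), ∀ y : ℝ, laurent β d (y * Complex.I) - w ≠ 0 := by
    intro w hw y h0
    have := hlow w hw y
    rw [h0, norm_zero] at this
    linarith
  have hcont : ∀ w ∈ Metric.ball μ (ε / 2), Continuous fun y : ℝ =>
      (laurent β d (y * Complex.I) - w)⁻¹ := fun w hw =>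
    (hK.sub continuous_const).inv₀ (hne w hw)
  have hμb : μ ∈ Metric.ball μ (ε / 2) := Metric.mem_ball_self (by positivity)
  have hball : Metric.ball μ (ε / 2) ∈ 𝓝 μ := Metric.ball_mem_nhds μ (by positivity)
  have hexp1 : ∀ y : ℝ, ‖Complex.exp (-(j * (y * Complex.I)))‖ = 1 := by
    intro y
    rw [Complex.norm_exp]
    simp
  have key := intervalIntegral.hasDerivAt_integral_of_dominated_loc_of_deriv_le
    (μ := MeasureTheory.volume) (a := 0) (b := 2 * Real.pi) (x₀ := μ) (s := Metric.ball μ (ε / 2))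
    (F := fun w (y : ℝ) => (laurent β d (y * Complex.I) - w)⁻¹ *
      Complex.exp (-(j * (y * Complex.I))))
    (F' := fun w (y : ℝ) => (laurent β d (y * Complex.I) - w)⁻¹ ^ 2 *
      Complex.exp (-(j * (y * Complex.I))))
    (bound := fun _ => (ε / 2)⁻¹ ^ 2) hball
    (Filter.mem_of_superset hball fun w hw =>
      ((hcont w hw).mul (by fun_prop)).aestronglyMeasurable)
    (((hcont μ hμb).mul (by fun_prop)).intervalIntegrable _ _)
    ((((hcont μ hμb).pow 2).mul (by fun_prop)).aestronglyMeasurable)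
    (Eventually.of_forall fun y _ w hw => by
      rw [norm_mul, hexp1, mul_one, norm_pow, norm_inv]
      exact pow_le_pow_left₀ (by positivity)
        (inv_anti₀ (by positivity) (hlow w hw y)) 2)
    intervalIntegrable_const
    (Eventually.of_forall fun y _ w hw => by
      have h1 := ((hasDerivAt_id w).const_sub (laurent β d (y * Complex.I))).inv (hne w hw y)
      refine (h1.mul_const _).congr_deriv ?_
      simp [div_eq_mul_inv])
  exact (key.2.const_mul (2 * Real.pi : ℂ)⁻¹).differentiableAt

end Laurent

/-! ### Pairing the coefficients of the resolvent with a sequence -/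

section Pairing

variable {ι : Type*} {σ : ℝ} {β : ι → ℂ} {d : ι → ℤ}

theorem hasSum_of_eq {κ : Type*} {f g : κ → ℂ} {a : ℂ} (h : ∀ b, f b = g b) (hf : HasSum f a) :
    HasSum g a := funext h ▸ hf

variable (β d) in
/-- The sum `∑ c_j t_j`, where `c_j` are the Laurent coefficients of `1/(K - μ)`. -/
def pairing (t : ℤ → ℂ) (μ : ℂ) : ℂ := ∑' j, fourierCoef (resolventFun β d μ) j * t j

theorem summable_int_inv_sq : Summable fun j : ℤ => ((1 + (j.natAbs : ℝ)) ^ 2)⁻¹ := by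
  refine Summable.of_nat_of_neg ?_ ?_ <;> simpa using summable_inv_sq

theorem norm_fourierCoef_mul_le (hσ : 0 < σ) (h : RapidDecay σ β d) (N : ℕ) :
    ∃ C : ℝ, 0 ≤ C ∧ ∀ (t : ℤ → ℂ) (D : ℝ),
      (∀ j, ‖t j‖ ≤ D * ((1 + (j.natAbs : ℝ)) ^ N * Real.exp σ ^ j.natAbs)) →
      ∀ (μ : ℂ) (ε : ℝ), 0 < ε → (∀ ζ ∈ closedStrip σ, ε ≤ ‖laurent β d ζ - μ‖) → ∀ j : ℤ,
        ‖fourierCoef (resolventFun β d μ) j * t j‖ ≤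
          D * C * (1 + 1 / ε) ^ (N + 3) * ((1 + (j.natAbs : ℝ)) ^ 2)⁻¹ := by
  obtain ⟨C, hC, hb⟩ := norm_fourierCoef_resolventFun_le hσ h (N + 2)
  refine ⟨C, hC, fun t D ht μ ε hε hμ j => ?_⟩
  have hD : 0 ≤ D := by
    have := (norm_nonneg _).trans (ht 0)
    simpa using this
  have h1 := hb μ ε hε hμ j
  rw [norm_mul, ← div_eq_mul_inv, le_div_iff₀ (by positivity)]
  calc ‖fourierCoef (resolventFun β d μ) j‖ * ‖t j‖ * (1 + (j.natAbs : ℝ)) ^ 2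
      ≤ ‖fourierCoef (resolventFun β d μ) j‖ *
          (D * ((1 + (j.natAbs : ℝ)) ^ N * Real.exp σ ^ j.natAbs)) * (1 + (j.natAbs : ℝ)) ^ 2 := by
        gcongr
        exact ht j
    _ = D * ((1 + (j.natAbs : ℝ)) ^ (N + 2) * (‖fourierCoef (resolventFun β d μ) j‖ *
          Real.exp σ ^ j.natAbs)) := by ring
    _ ≤ D * (C * (1 + 1 / ε) ^ (N + 2 + 1)) := by gcongr
    _ = _ := by ring

/-- The pairing grows at most like a power of the inverse distance from `μ` to the range of `K`. -/
theorem norm_pairing_le (hσ : 0 < σ) (h : RapidDecay σ β d) {N : ℕ} {t : ℤ → ℂ} {D : ℝ}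
    (ht : ∀ j, ‖t j‖ ≤ D * ((1 + (j.natAbs : ℝ)) ^ N * Real.exp σ ^ j.natAbs)) :
    ∃ C : ℝ, 0 ≤ C ∧ ∀ (μ : ℂ) (ε : ℝ), 0 < ε →
      (∀ ζ ∈ closedStrip σ, ε ≤ ‖laurent β d ζ - μ‖) →
        ‖pairing β d t μ‖ ≤ C * (1 + 1 / ε) ^ (N + 3) := by
  have hD : 0 ≤ D := by
    have := (norm_nonneg _).trans (ht 0)
    simpa using this
  obtain ⟨C, hC, hb⟩ := norm_fourierCoef_mul_le hσ h N
  have hZ : 0 ≤ ∑' j : ℤ, ((1 + (j.natAbs : ℝ)) ^ 2)⁻¹ := tsum_nonneg fun j => by positivity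
  refine ⟨D * C * ∑' j : ℤ, ((1 + (j.natAbs : ℝ)) ^ 2)⁻¹, by positivity, fun μ ε hε hμ => ?_⟩
  refine (tsum_of_norm_bounded (summable_int_inv_sq.mul_left _).hasSum
    (hb t D ht μ ε hε hμ)).trans (le_of_eq ?_)
  rw [tsum_mul_left]
  ring

theorem differentiableAt_pairing (hσ : 0 < σ) (h : RapidDecay σ β d) {N : ℕ} {t : ℤ → ℂ} {D : ℝ}
    (ht : ∀ j, ‖t j‖ ≤ D * ((1 + (j.natAbs : ℝ)) ^ N * Real.exp σ ^ j.natAbs)) {μ : ℂ}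
    (hμ : ∀ ζ ∈ closedStrip σ, laurent β d ζ ≠ μ) :
    DifferentiableAt ℂ (pairing β d t) μ := by
  obtain ⟨C, hC, hb⟩ := norm_fourierCoef_mul_le hσ h N
  obtain ⟨ε, hε, hμε⟩ := exists_pos_le_norm_laurent_sub hσ h hμ
  have hlow : ∀ w ∈ Metric.ball μ (ε / 2), ∀ ζ ∈ closedStrip σ, ε / 2 ≤ ‖laurent β d ζ - w‖ := by
    intro w hw ζ hζ
    rw [Metric.mem_ball, dist_eq_norm] at hw
    have h1 := hμε ζ hζ
    have h2 := norm_sub_le_norm_sub_add_norm_sub (laurent β d ζ) w μ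
    linarith
  have hε2 : 0 < ε / 2 := by positivity
  have key := Complex.differentiableOn_tsum_of_summable_norm
    (F := fun (j : ℤ) (w : ℂ) => fourierCoef (resolventFun β d w) j * t j)
    (summable_int_inv_sq.mul_left (D * C * (1 + 1 / (ε / 2)) ^ (N + 3)))
    (fun j w hw => ((differentiableAt_fourierCoef_resolventFun hσ h hε2 (hlow w hw)
      j).mul_const _).differentiableWithinAt)
    Metric.isOpen_ball fun j w hw => hb t D ht w (ε / 2) hε2 (hlow w hw) j
  exact key.differentiableAt (Metric.ball_mem_nhds μ hε2)

/-- If `t = (K - μ) u`, in the sense that `t_j = ∑ β_a u_{d_a + j} - μ u_j`, then pairing `t` with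
the coefficients of `1/(K - μ)` recovers `u_0`. -/
theorem pairing_eq [Countable ι] (hσ : 0 < σ) (h : RapidDecay σ β d) {N : ℕ} {u t : ℤ → ℂ} {D : ℝ}
    (hu : ∀ j, ‖u j‖ ≤ D * ((1 + (j.natAbs : ℝ)) ^ N * Real.exp σ ^ j.natAbs)) {μ : ℂ}
    (hμ : ∀ ζ ∈ closedStrip σ, laurent β d ζ ≠ μ)
    (ht : ∀ j, HasSum (fun a => β a * u (d a + j)) (t j + μ * u j)) :
    pairing β d t μ = u 0 := by
  have hD : 0 ≤ D := by
    have := (norm_nonneg _).trans (hu 0)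
    simpa using this
  obtain ⟨ε, hε, hμε⟩ := exists_pos_le_norm_laurent_sub hσ h hμ
  set c : ℤ → ℂ := fourierCoef (resolventFun β d μ) with hc
  -- absolute convergence of the double series
  obtain ⟨C, hC, hb⟩ := norm_fourierCoef_mul_le hσ h N
  have hsum1 : Summable fun j => c j * u j :=
    Summable.of_norm_bounded (summable_int_inv_sq.mul_left _) (hb u D hu μ ε hε hμε)
  set v : ℤ → ℂ := fun j => (((1 + (j.natAbs : ℝ)) ^ N * Real.exp σ ^ j.natAbs : ℝ) : ℂ) with hv
  have hvn : ∀ j, ‖v j‖ = (1 + (j.natAbs : ℝ)) ^ N * Real.exp σ ^ j.natAbs := by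
    intro j
    rw [hv, Complex.norm_real, Real.norm_eq_abs, abs_of_nonneg (by positivity)]
  have hcv := hb v 1 (fun j => by rw [hvn, one_mul]) μ ε hε hμε
  have hbound : Summable fun x : ℤ × ι => D * (‖c x.1 * v x.1‖ *
      (‖β x.2‖ * ((1 + ((d x.2).natAbs : ℝ)) ^ N * Real.exp σ ^ (d x.2).natAbs))) := by
    refine Summable.mul_left D (Summable.mul_of_nonneg
      (f := fun j => ‖c j * v j‖) ?_ (h N) (fun j => norm_nonneg _) fun a => by positivity)
    exact Summable.of_nonneg_of_le (fun j => norm_nonneg _) hcv (summable_int_inv_sq.mul_left _)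
  set F : ℤ × ι → ℂ := fun x => c x.1 * (β x.2 * u (d x.2 + x.1)) with hF
  have hFs : Summable F := by
    refine Summable.of_norm_bounded hbound fun x => ?_
    obtain ⟨j, a⟩ := x
    simp only [hF, norm_mul, hvn]
    have h1 := hu (d a + j)
    have hle : (d a + j).natAbs ≤ j.natAbs + (d a).natAbs := by omega
    have h2 : (1 + ((d a + j).natAbs : ℝ)) ^ N * Real.exp σ ^ (d a + j).natAbs ≤
        ((1 + (j.natAbs : ℝ)) * (1 + ((d a).natAbs : ℝ))) ^ N *
          Real.exp σ ^ (j.natAbs + (d a).natAbs) := by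
      gcongr
      · have h3 : ((d a + j).natAbs : ℝ) ≤ j.natAbs + (d a).natAbs := by exact_mod_cast hle
        nlinarith [mul_nonneg (Nat.cast_nonneg (α := ℝ) j.natAbs)
          (Nat.cast_nonneg (α := ℝ) (d a).natAbs)]
      · exact Real.one_le_exp hσ.le
    calc ‖c j‖ * (‖β a‖ * ‖u (d a + j)‖)
        ≤ ‖c j‖ * (‖β a‖ * (D * (((1 + (j.natAbs : ℝ)) * (1 + ((d a).natAbs : ℝ))) ^ N *
          Real.exp σ ^ (j.natAbs + (d a).natAbs)))) := by
          gcongr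
          exact h1.trans (mul_le_mul_of_nonneg_left h2 hD)
      _ = _ := by
          rw [mul_pow, pow_add]
          ring
  have hS1 : HasSum (fun j => c j * (t j + μ * u j)) (∑' x, F x) :=
    hFs.hasSum.prod_fiberwise fun j => (ht j).mul_left (c j)
  -- the same double series, arranged by the index of `u`
  let e : ℤ × ι ≃ ℤ × ι :=
    { toFun := fun x => (x.1 - d x.2, x.2)
      invFun := fun x => (x.1 + d x.2, x.2)
      left_inv := fun x => by simp
      right_inv := fun x => by simp }
  have hS2 : HasSum (fun n : ℤ => u n * (μ * c n + if n = 0 then 1 else 0)) (∑' x, F x) := by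
    have h1 : HasSum (F ∘ e) (∑' x, F x) := e.hasSum_iff.2 hFs.hasSum
    refine h1.prod_fiberwise fun n => ?_
    refine hasSum_of_eq (fun a => ?_)
      ((hasSum_convolution_resolventFun hσ h hμ n).mul_left (u n))
    simp only [hF, e, hc, Function.comp_apply, Equiv.coe_fn_mk, add_sub_cancel]
    ring
  have hδ : HasSum (fun n : ℤ => u n * if n = 0 then 1 else 0) (u 0) := by
    have h1 := hasSum_single (f := fun n : ℤ => u n * if n = 0 then 1 else 0) 0
      fun n hn => by simp [hn]
    rwa [if_pos rfl, mul_one] at h1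
  have hS3 : HasSum (fun n : ℤ => u n * (μ * c n + if n = 0 then 1 else 0))
      (μ * ∑' n, c n * u n + u 0) := by
    refine hasSum_of_eq (fun n => ?_) ((hsum1.hasSum.mul_left μ).add hδ)
    ring
  have hfin : HasSum (fun j => c j * t j) (u 0) := by
    have h1 := hS1.sub (hsum1.hasSum.mul_left μ)
    rw [hS2.unique hS3, add_sub_cancel_left] at h1
    refine hasSum_of_eq (fun j => ?_) h1
    ring
  exact hfin.tsum_eq

end Pairing

/-! ### Singularities of functions that are controlled off a circle -/

section Poles

/-- A holomorphic function on a punctured disc about a point of the circle `|μ| = R`, bounded by a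
power of `1/||μ|² - R²|`, is bounded by the same power of `1/|μ - a|`. On the circle
`|μ - μ₀| = ρ` the non-holomorphic factor `|μ|² - R²` has the same modulus as a polynomial, so that
the maximum principle applies. -/
theorem norm_mul_pow_le_of_norm_mul_abs_pow_le {R ρ₀ C : ℝ} (hR : 0 < R) {N : ℕ} {a : ℂ}
    (ha : ‖a‖ = R) {g : ℂ → ℂ} (hg : DifferentiableOn ℂ g (Metric.ball a ρ₀ \ {a}))
    (hC : ∀ μ ∈ Metric.ball a ρ₀ \ {a}, ‖g μ‖ * |‖μ‖ ^ 2 - R ^ 2| ^ N ≤ C) {μ₀ : ℂ}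
    (hne : μ₀ ≠ a) (hμ₀ : 2 * ‖μ₀ - a‖ < ρ₀) (hμR : 2 * ‖μ₀ - a‖ < R) :
    ‖g μ₀‖ * ‖μ₀ - a‖ ^ N ≤ C * (4 / R) ^ N := by
  have hs : 0 < ‖μ₀ - a‖ := norm_pos_iff.2 (sub_ne_zero.2 hne)
  set ρ := ‖μ₀ - a‖ / 2 with hρdef
  have hρ : 0 < ρ := by positivity
  have hsub : Metric.closedBall μ₀ ρ ⊆ Metric.ball a ρ₀ \ {a} := by
    intro μ hμ
    rw [Metric.mem_closedBall, dist_eq_norm] at hμ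
    refine ⟨?_, ?_⟩
    · rw [Metric.mem_ball, dist_eq_norm]
      have := norm_sub_le_norm_sub_add_norm_sub μ μ₀ a
      linarith
    · rintro rfl
      rw [norm_sub_rev] at hμ
      linarith
  let P : ℂ → ℂ := fun μ => μ * ((starRingEnd ℂ) μ₀ * (μ - μ₀) + (ρ : ℂ) ^ 2) -
    (R : ℂ) ^ 2 * (μ - μ₀)
  have hP : ∀ μ ∈ Metric.sphere μ₀ ρ, ‖P μ‖ = ρ * |‖μ‖ ^ 2 - R ^ 2| := by
    intro μ hμ
    rw [Metric.mem_sphere, dist_eq_norm] at hμ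
    have h1 : (μ - μ₀) * (starRingEnd ℂ) (μ - μ₀) = (ρ : ℂ) ^ 2 := by
      rw [Complex.mul_conj, Complex.normSq_eq_norm_sq, hμ]
      push_cast
      rfl
    have h2 : μ * (starRingEnd ℂ) μ = (‖μ‖ : ℂ) ^ 2 := by
      rw [Complex.mul_conj, Complex.normSq_eq_norm_sq]
      push_cast
      rfl
    have h3 : P μ = (μ - μ₀) * ((‖μ‖ ^ 2 - R ^ 2 : ℝ) : ℂ) := by
      simp only [P]
      push_cast
      rw [← h1, ← h2, map_sub]
      ring
    rw [h3, norm_mul, hμ, Complex.norm_real, Real.norm_eq_abs]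
  have hdiff : DifferentiableOn ℂ (fun μ => g μ * P μ ^ N) (Metric.closedBall μ₀ ρ) := by
    refine (hg.mono hsub).mul ?_
    simp only [P]
    fun_prop
  have hmax := Complex.norm_le_of_forall_mem_frontier_norm_le (U := Metric.ball μ₀ ρ)
    (f := fun μ => g μ * P μ ^ N) (C := C * ρ ^ N) Metric.isBounded_ball
    (hdiff.mono Metric.closure_ball_subset_closedBall).diffContOnCl (fun μ hμ => by
      rw [frontier_ball μ₀ hρ.ne'] at hμ
      have h1 := hC μ (hsub (Metric.sphere_subset_closedBall hμ))
      rw [norm_mul, norm_pow, hP μ hμ, mul_pow]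
      calc ‖g μ‖ * (ρ ^ N * |‖μ‖ ^ 2 - R ^ 2| ^ N)
          = (‖g μ‖ * |‖μ‖ ^ 2 - R ^ 2| ^ N) * ρ ^ N := by ring
        _ ≤ C * ρ ^ N := by gcongr)
    (subset_closure (Metric.mem_ball_self hρ))
  have hPμ : ‖P μ₀‖ = ‖μ₀‖ * ρ ^ 2 := by
    simp only [P, sub_self, mul_zero, zero_add, sub_zero]
    rw [norm_mul, norm_pow, Complex.norm_real, Real.norm_eq_abs, abs_of_pos hρ]
  simp only [norm_mul, norm_pow, hPμ] at hmax
  have hμ0 : R / 2 ≤ ‖μ₀‖ := by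
    have h1 := norm_sub_norm_le a μ₀
    rw [norm_sub_rev, ha] at h1
    linarith
  -- divide by `ρ^N` and use `R ‖μ₀ - a‖ / 4 ≤ ‖μ₀‖ ρ`
  have h4 : ‖g μ₀‖ * (‖μ₀‖ * ρ) ^ N ≤ C := by
    have : ‖g μ₀‖ * (‖μ₀‖ * ρ) ^ N * ρ ^ N ≤ C * ρ ^ N := by
      refine le_trans (le_of_eq ?_) hmax
      rw [mul_assoc, ← mul_pow]
      ring
    exact le_of_mul_le_mul_right this (by positivity)
  have h5 : ‖μ₀ - a‖ ≤ (4 / R) * (‖μ₀‖ * ρ) := by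
    rw [div_mul_eq_mul_div, le_div_iff₀ hR]
    have : R / 2 * ρ ≤ ‖μ₀‖ * ρ := by gcongr
    rw [hρdef] at this ⊢
    nlinarith
  calc ‖g μ₀‖ * ‖μ₀ - a‖ ^ N ≤ ‖g μ₀‖ * ((4 / R) * (‖μ₀‖ * ρ)) ^ N := by gcongr
    _ = (‖g μ₀‖ * (‖μ₀‖ * ρ) ^ N) * (4 / R) ^ N := by
      rw [mul_pow]
      ring
    _ ≤ _ := by gcongr

/-- If a pole lies on the circle `|μ| = R` and the function is `O(1/(|μ| - R))` outside the circle,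
then the pole is at most simple. -/
theorem exists_norm_sub_mul_le {R ρ₀ C : ℝ} (hR : 0 < R) (hρ₀ : 0 < ρ₀) {a : ℂ} (ha : ‖a‖ = R)
    {g : ℂ → ℂ} (hg : DifferentiableOn ℂ g (Metric.ball a ρ₀ \ {a}))
    (hout : ∀ μ ∈ Metric.ball a ρ₀ \ {a}, R < ‖μ‖ → ‖g μ‖ * (‖μ‖ - R) ≤ C) (n : ℕ)
    (hn : ∃ δ > 0, ∃ B, ∀ μ ∈ Metric.ball a δ \ {a}, ‖(μ - a) ^ (n + 1) * g μ‖ ≤ B) :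
    ∃ δ > 0, ∃ B, ∀ μ ∈ Metric.ball a δ \ {a}, ‖(μ - a) * g μ‖ ≤ B := by
  induction n with
  | zero => simpa using! hn
  | succ n ih =>
    apply ih
    obtain ⟨δ, hδ, B, hB⟩ := hn
    set δ₁ := min δ ρ₀
    have hδ₁pos : 0 < δ₁ := lt_min hδ hρ₀
    have hsubδ : Metric.ball a δ₁ \ {a} ⊆ Metric.ball a δ \ {a} :=
      Set.sdiff_subset_sdiff_left (Metric.ball_subset_ball (min_le_left _ _))
    have hsubρ : Metric.ball a δ₁ \ {a} ⊆ Metric.ball a ρ₀ \ {a} :=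
      Set.sdiff_subset_sdiff_left (Metric.ball_subset_ball (min_le_right _ _))
    set h : ℂ → ℂ := fun μ => (μ - a) ^ (n + 1 + 1) * g μ with hh
    have hd : DifferentiableOn ℂ h (Metric.ball a δ₁ \ {a}) :=
      DifferentiableOn.mul (by fun_prop) (hg.mono hsubρ)
    have hball : Metric.ball a δ₁ ∈ 𝓝 a := Metric.ball_mem_nhds a hδ₁pos
    have hbdd : BddAbove (norm ∘ h '' (Metric.ball a δ₁ \ {a})) := by
      refine ⟨B, ?_⟩
      rintro _ ⟨μ, hμ, rfl⟩
      exact hB μ (hsubδ hμ)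
    set L := limUnder (𝓝[≠] a) h
    have hext := Complex.differentiableOn_update_limUnder_of_bddAbove hball hd hbdd
    have hda : DifferentiableAt ℂ (Function.update h a L) a := hext.differentiableAt hball
    -- approach `a` radially from outside: the limit is zero
    have hne0 : a ≠ 0 := by
      rintro rfl
      simp at ha
      linarith
    have hL0 : L = 0 := by
      have hcurve : Tendsto (fun t : ℝ => a + t * a) (𝓝[>] 0) (𝓝[≠] a) := by
        refine tendsto_nhdsWithin_iff.2 ⟨?_, ?_⟩
        · have : Continuous fun t : ℝ => a + t * a := by fun_prop
          have h1 := this.tendsto 0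
          simp only [Complex.ofReal_zero, zero_mul, add_zero] at h1
          exact h1.mono_left nhdsWithin_le_nhds
        · filter_upwards [self_mem_nhdsWithin] with t ht
          have ht0 : (t : ℂ) ≠ 0 := by
            rw [Set.mem_Ioi] at ht
            exact_mod_cast ht.ne'
          simp [ht0, hne0]
      have hcont : Tendsto (Function.update h a L) (𝓝[≠] a) (𝓝 L) := by
        have h1 := hda.continuousAt.tendsto
        rw [Function.update_self] at h1
        exact h1.mono_left nhdsWithin_le_nhds
      have hlim := hcont.comp hcurve
      have hlim0 : Tendsto (fun t : ℝ => Function.update h a L (a + t * a)) (𝓝[>] 0) (𝓝 0) := by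
        have hz : Tendsto (fun t : ℝ => ‖(t : ℂ) * a‖ ^ (n + 1) * C) (𝓝[>] 0) (𝓝 0) := by
          have h1 : Continuous fun t : ℝ => ‖(t : ℂ) * a‖ ^ (n + 1) * C := by fun_prop
          have h2 := (h1.tendsto 0).mono_left (nhdsWithin_le_nhds (s := Set.Ioi 0))
          simpa using h2
        refine squeeze_zero_norm' ?_ hz
        have hin : ∀ᶠ t : ℝ in 𝓝[>] 0, a + t * a ∈ Metric.ball a δ₁ \ {a} :=
          hcurve (sdiff_mem_nhdsWithin_compl hball {a})
        filter_upwards [hin, self_mem_nhdsWithin] with t ht ht0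
        rw [Set.mem_Ioi] at ht0
        rw [Function.update_of_ne ht.2]
        have hnorm : ‖a + t * a‖ = R + t * R := by
          have e : a + t * a = ((1 + t : ℝ) : ℂ) * a := by
            push_cast
            ring
          rw [e, norm_mul, Complex.norm_real, Real.norm_eq_abs, abs_of_pos (by linarith), ha]
          ring
        have h1 := hout _ (hsubρ ht) (by rw [hnorm]; nlinarith)
        rw [hnorm, add_sub_cancel_left] at h1
        have hta : ‖(t : ℂ) * a‖ = t * R := by
          rw [norm_mul, Complex.norm_real, Real.norm_eq_abs, abs_of_pos ht0, ha]
        simp only [hh, add_sub_cancel_left]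
        rw [norm_mul, norm_pow, pow_succ, mul_assoc]
        refine mul_le_mul_of_nonneg_left ?_ (by positivity)
        rw [hta, mul_comm]
        exact h1
      exact tendsto_nhds_unique hlim hlim0
    -- a differentiable function that vanishes at `a` is `O(μ - a)`
    have hO := hda.isBigO_sub
    rw [Function.update_self, hL0] at hO
    obtain ⟨c, hc⟩ := hO.bound
    obtain ⟨δ₂, hδ₂, hball₂⟩ := Metric.eventually_nhds_iff_ball.1 hc
    refine ⟨δ₂, hδ₂, c, fun μ hμ => ?_⟩
    have h1 := hball₂ μ hμ.1
    have hμne : μ ≠ a := hμ.2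
    rw [Function.update_of_ne hμne, sub_zero] at h1
    simp only [hh] at h1
    have hpos : 0 < ‖μ - a‖ := norm_pos_iff.2 (sub_ne_zero.2 hμne)
    rw [pow_succ, mul_assoc, mul_left_comm, norm_mul, mul_comm] at h1
    exact le_of_mul_le_mul_right h1 hpos

/-- Finitely many isolated singularities near which the function is bounded are removable. -/
theorem exists_differentiable_extension (s : Finset ℂ) {f : ℂ → ℂ}
    (hf : DifferentiableOn ℂ f (↑s : Set ℂ)ᶜ)
    (hb : ∀ a ∈ s, ∃ δ > 0, ∃ B, ∀ μ ∈ Metric.ball a δ \ {a}, ‖f μ‖ ≤ B) :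
    ∃ F : ℂ → ℂ, Differentiable ℂ F ∧ ∀ μ ∉ s, F μ = f μ := by
  induction s using Finset.induction_on generalizing f with
  | empty =>
    refine ⟨f, fun μ => ?_, fun μ _ => rfl⟩
    exact (hf μ (by simp)).differentiableAt (by simp)
  | insert a s has ih =>
    obtain ⟨δ, hδ, B, hB⟩ := hb a (Finset.mem_insert_self a s)
    have hs : ((↑s : Set ℂ)ᶜ) ∈ 𝓝 a := s.finite_toSet.isClosed.isOpen_compl.mem_nhds (by simpa)
    set V : Set ℂ := Metric.ball a δ ∩ (↑s : Set ℂ)ᶜ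
    have hVn : V ∈ 𝓝 a := inter_mem (Metric.ball_mem_nhds a hδ) hs
    have hVd : DifferentiableOn ℂ f (V \ {a}) := hf.mono fun μ hμ => by
      have h1 := hμ.1.2
      have h2 : μ ≠ a := hμ.2
      simp_all
    have hVb : BddAbove (norm ∘ f '' (V \ {a})) := by
      refine ⟨B, ?_⟩
      rintro _ ⟨μ, hμ, rfl⟩
      exact hB μ ⟨hμ.1.1, hμ.2⟩
    have hext := Complex.differentiableOn_update_limUnder_of_bddAbove hVn hVd hVb
    set f₁ := Function.update f a (limUnder (𝓝[≠] a) f) with hf₁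
    obtain ⟨F, hF, hFe⟩ := ih (f := f₁) (fun μ hμ => by
      by_cases hμa : μ = a
      · rw [hμa]
        exact (hext.differentiableAt hVn).differentiableWithinAt
      · have hμs : μ ∈ (↑(insert a s) : Set ℂ)ᶜ := by
          simp_all
        have h1 := hf.differentiableAt
          ((insert a s).finite_toSet.isClosed.isOpen_compl.mem_nhds hμs)
        refine (h1.congr_of_eventuallyEq ?_).differentiableWithinAt
        filter_upwards [isOpen_ne.mem_nhds hμa] with w hw
        exact Function.update_of_ne hw _ _) (fun b hb' => by
      obtain ⟨δ', hδ', B', hB'⟩ := hb b (Finset.mem_insert_of_mem hb')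
      have hba : b ≠ a := fun e => has (e ▸ hb')
      refine ⟨min δ' (dist a b), lt_min hδ' (dist_pos.2 hba.symm), B', fun μ hμ => ?_⟩
      have hμa : μ ≠ a := by
        rintro rfl
        have := (Metric.mem_ball.1 hμ.1).trans_le (min_le_right _ _)
        exact lt_irrefl _ this
      rw [hf₁, Function.update_of_ne hμa]
      exact hB' μ ⟨Metric.ball_subset_ball (min_le_left _ _) hμ.1, hμ.2⟩)
    refine ⟨F, hF, fun μ hμ => ?_⟩
    rw [Finset.mem_insert, not_or] at hμ
    rw [hFe μ hμ.2, hf₁, Function.update_of_ne hμ.1]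

end Poles

/-! ### Decomposition along distinct eigenvalues -/

section LinearAlgebra

open Polynomial

variable {V : Type*} [AddCommGroup V] [Module ℂ V]

/-- A vector annihilated by `∏ (f - a_i)` with distinct `a_i` is a sum of eigenvectors in exactly
one way; the components are given by the Lagrange basis polynomials. -/
theorem existsUnique_sum_eigenvectors (f : Module.End ℂ V) (x : V) {j : ℕ} (hj : j ≠ 0)
    (a : Fin j → ℂ) (ha : Function.Injective a)
    (hx : aeval f (∏ i, (X - C (a i))) x = 0) :
    ∃! S : Fin j → V, x = ∑ i, S i ∧ ∀ i, f (S i) = a i • S i := by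
  have : Nonempty (Fin j) := ⟨⟨0, Nat.pos_of_ne_zero hj⟩⟩
  have hbasis : ∀ i, ∃ c : ℂ, (X - C (a i)) * Lagrange.basis Finset.univ a i =
      C c * ∏ i, (X - C (a i)) := by
    intro i
    refine ⟨∏ l ∈ Finset.univ.erase i, (a i - a l)⁻¹, ?_⟩
    rw [Lagrange.basis, ← Finset.mul_prod_erase _ _ (Finset.mem_univ i)]
    simp only [Lagrange.basisDivisor, Finset.prod_mul_distrib, map_prod]
    ring
  refine ⟨fun i => aeval f (Lagrange.basis Finset.univ a i) x, ⟨?_, fun i => ?_⟩, ?_⟩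
  · have h := congrArg (fun P => aeval f P x)
      (Lagrange.sum_basis (s := Finset.univ) (v := a) ha.injOn Finset.univ_nonempty)
    simpa using h.symm
  · obtain ⟨c, hc⟩ := hbasis i
    have h := congrArg (fun P => aeval f P x) hc
    simp only [map_mul, map_sub, aeval_X, aeval_C, Module.End.mul_apply] at h
    rw [hx, map_zero] at h
    simpa [sub_eq_zero] using h
  · rintro S ⟨hS, hSi⟩
    funext i
    rw [hS, map_sum, Finset.sum_eq_single i]
    · rw [Module.End.aeval_apply_of_mem_apply_eq_smul (hSi i),
        Lagrange.eval_basis_self ha.injOn (Finset.mem_univ i), one_smul]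
    · intro l _ hl
      rw [Module.End.aeval_apply_of_mem_apply_eq_smul (hSi l),
        Lagrange.eval_basis_of_ne hl.symm (Finset.mem_univ l), zero_smul]
    · intro h
      exact absurd (Finset.mem_univ i) h

end LinearAlgebra

/-! ### The resolvent of an orbit of functionals outside a disc -/

section ExteriorResolvent

open Polynomial

variable {V : Type*} [AddCommGroup V] [Module ℂ V]

/-- The series `-∑ A^k μ^{-(k+1)} τ_k`, which for `|μ| > |A|` represents the functional
`φ ↦ τ_0 ((L - μ)⁻¹ φ)` when `τ_k ∘ L = A τ_{k+1}` for all `k`. -/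
def exteriorResolvent (τ : ℕ → V →ₗ[ℂ] ℂ) (A μ : ℂ) (φ : V) : ℂ :=
  -∑' k, A ^ k * (μ ^ (k + 1))⁻¹ * τ k φ

variable {τ : ℕ → V →ₗ[ℂ] ℂ} {A μ : ℂ} {B : V → ℝ} {L : V →ₗ[ℂ] V}

theorem norm_exteriorResolvent_term_le (hB : ∀ k φ, ‖τ k φ‖ ≤ B φ) {r : ℝ} (hr : 0 < r)
    (hμ : r ≤ ‖μ‖) (φ : V) (k : ℕ) :
    ‖A ^ k * (μ ^ (k + 1))⁻¹ * τ k φ‖ ≤ r⁻¹ * B φ * (‖A‖ / r) ^ k := by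
  have hB0 : 0 ≤ B φ := (norm_nonneg _).trans (hB 0 φ)
  rw [norm_mul, norm_mul, norm_inv, norm_pow, norm_pow]
  calc ‖A‖ ^ k * (‖μ‖ ^ (k + 1))⁻¹ * ‖τ k φ‖ ≤ ‖A‖ ^ k * (r ^ (k + 1))⁻¹ * B φ := by
        gcongr
        exact hB k φ
    _ = r⁻¹ * B φ * (‖A‖ / r) ^ k := by
        rw [pow_succ, mul_inv, div_pow]
        ring

theorem summable_exteriorResolvent (hB : ∀ k φ, ‖τ k φ‖ ≤ B φ) (hμ : ‖A‖ < ‖μ‖) (φ : V) :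
    Summable fun k => A ^ k * (μ ^ (k + 1))⁻¹ * τ k φ := by
  have hpos : 0 < ‖μ‖ := (norm_nonneg A).trans_lt hμ
  refine Summable.of_norm_bounded ?_ (norm_exteriorResolvent_term_le hB hpos le_rfl φ)
  exact (summable_geometric_of_lt_one (by positivity) ((div_lt_one hpos).2 hμ)).mul_left _

theorem exteriorResolvent_add (hB : ∀ k φ, ‖τ k φ‖ ≤ B φ) (hμ : ‖A‖ < ‖μ‖) (φ ψ : V) :
    exteriorResolvent τ A μ (φ + ψ) =
      exteriorResolvent τ A μ φ + exteriorResolvent τ A μ ψ := by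
  have h := (summable_exteriorResolvent hB hμ φ).tsum_add (summable_exteriorResolvent hB hμ ψ)
  simp only [exteriorResolvent, map_add, mul_add, h, neg_add]

theorem exteriorResolvent_smul (c : ℂ) (φ : V) :
    exteriorResolvent τ A μ (c • φ) = c * exteriorResolvent τ A μ φ := by
  simp only [exteriorResolvent, map_smul, smul_eq_mul, mul_left_comm _ c, tsum_mul_left, mul_neg]

theorem norm_exteriorResolvent_le (hB : ∀ k φ, ‖τ k φ‖ ≤ B φ) (hμ : ‖A‖ < ‖μ‖) (φ : V) :
    ‖exteriorResolvent τ A μ φ‖ ≤ (‖μ‖ - ‖A‖)⁻¹ * B φ := by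
  have hpos : 0 < ‖μ‖ := (norm_nonneg A).trans_lt hμ
  have hlt : ‖A‖ / ‖μ‖ < 1 := (div_lt_one hpos).2 hμ
  have h := (hasSum_geometric_of_lt_one (by positivity) hlt).mul_left (‖μ‖⁻¹ * B φ)
  rw [exteriorResolvent, norm_neg]
  refine (tsum_of_norm_bounded h (norm_exteriorResolvent_term_le hB hpos le_rfl φ)).trans
    (le_of_eq ?_)
  have h1 : ‖μ‖ - ‖A‖ ≠ 0 := (sub_pos.2 hμ).ne'
  field_simp

theorem exteriorResolvent_apply (hL : ∀ k φ, τ k (L φ) = A * τ (k + 1) φ)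
    (hB : ∀ k φ, ‖τ k φ‖ ≤ B φ) (hμ : ‖A‖ < ‖μ‖) (φ : V) :
    exteriorResolvent τ A μ (L φ) = τ 0 φ + μ * exteriorResolvent τ A μ φ := by
  have hμ0 : μ ≠ 0 := norm_pos_iff.1 ((norm_nonneg A).trans_lt hμ)
  simp only [exteriorResolvent]
  rw [(summable_exteriorResolvent hB hμ φ).tsum_eq_zero_add, mul_neg, mul_add, ← tsum_mul_left]
  have h : ∀ k, A ^ k * (μ ^ (k + 1))⁻¹ * τ k (L φ) =
      μ * (A ^ (k + 1) * (μ ^ (k + 1 + 1))⁻¹ * τ (k + 1) φ) := by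
    intro k
    rw [hL]
    field_simp
    ring
  simp only [h]
  field_simp
  ring

theorem differentiableOn_exteriorResolvent (hA : A ≠ 0) (hB : ∀ k φ, ‖τ k φ‖ ≤ B φ) (φ : V) :
    DifferentiableOn ℂ (fun μ => exteriorResolvent τ A μ φ) {μ | ‖A‖ < ‖μ‖} := by
  intro μ hμ
  obtain ⟨r, hr1, hr2⟩ := exists_between (show ‖A‖ < ‖μ‖ from hμ)
  have hr : 0 < r := (norm_pos_iff.2 hA).trans hr1
  have hopen : IsOpen {w : ℂ | r < ‖w‖} := isOpen_lt continuous_const continuous_norm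
  have key := Complex.differentiableOn_tsum_of_summable_norm
    (F := fun (k : ℕ) (w : ℂ) => A ^ k * (w ^ (k + 1))⁻¹ * τ k φ)
    ((summable_geometric_of_lt_one (by positivity) ((div_lt_one hr).2 hr1)).mul_left
      (r⁻¹ * B φ))
    (fun k w hw => by
      have hw0 : w ≠ 0 := norm_pos_iff.1 (hr.trans hw)
      have hwk : w ^ (k + 1) ≠ 0 := pow_ne_zero _ hw0
      fun_prop (disch := assumption))
    hopen (fun k w hw => norm_exteriorResolvent_term_le hB hr (le_of_lt hw) φ k)
  exact (key.neg.differentiableAt (hopen.mem_nhds hr2)).differentiableWithinAt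

theorem tendsto_exteriorResolvent (hB : ∀ k φ, ‖τ k φ‖ ≤ B φ) (φ : V) :
    Tendsto (fun μ => exteriorResolvent τ A μ φ) (cocompact ℂ) (𝓝 0) := by
  have hnorm := tendsto_norm_cocompact_atTop (E := ℂ)
  have h1 : Tendsto (fun μ : ℂ => (‖μ‖ - ‖A‖)⁻¹ * B φ) (cocompact ℂ) (𝓝 0) := by
    have h2 := (tendsto_inv_atTop_zero.comp
      (tendsto_atTop_add_const_right _ (-‖A‖) hnorm)).mul_const (B φ)
    simpa [← sub_eq_add_neg, Function.comp_def] using h2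
  refine squeeze_zero_norm' ?_ h1
  filter_upwards [hnorm.eventually_gt_atTop ‖A‖] with μ hμ
  exact norm_exteriorResolvent_le hB hμ φ

/-- Modulo polynomials in `μ`, the resolvent turns `P(L)` into multiplication by `P(μ)`. -/
theorem exists_exteriorResolvent_aeval (hL : ∀ k φ, τ k (L φ) = A * τ (k + 1) φ)
    (hB : ∀ k φ, ‖τ k φ‖ ≤ B φ) (P : ℂ[X]) (φ : V) :
    ∃ Q : ℂ[X], ∀ μ, ‖A‖ < ‖μ‖ → exteriorResolvent τ A μ (aeval L P φ) =
      P.eval μ * exteriorResolvent τ A μ φ + Q.eval μ := by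
  induction P using Polynomial.induction_on with
  | C a =>
    refine ⟨0, fun μ _ => ?_⟩
    simp [Module.algebraMap_end_apply, exteriorResolvent_smul]
  | add P₁ P₂ h₁ h₂ =>
    obtain ⟨Q₁, h₁⟩ := h₁
    obtain ⟨Q₂, h₂⟩ := h₂
    refine ⟨Q₁ + Q₂, fun μ hμ => ?_⟩
    rw [map_add, LinearMap.add_apply, exteriorResolvent_add hB hμ, h₁ μ hμ, h₂ μ hμ, eval_add,
      eval_add]
    ring
  | monomial n a h =>
    obtain ⟨Q, h⟩ := h
    refine ⟨X * Q + C (τ 0 (aeval L (C a * X ^ n) φ)), fun μ hμ => ?_⟩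
    have e : C a * X ^ (n + 1) = X * (C a * X ^ n) := by ring
    rw [e, map_mul, aeval_X, Module.End.mul_apply, exteriorResolvent_apply hL hB hμ, h μ hμ]
    simp only [eval_add, eval_mul, eval_X, eval_C]
    ring

/-- If the resolvent of `φ` continues holomorphically to the complement of a finite subset `s` of
the circle `|μ| = |A|`, with at most polynomial growth at the circle, then `τ_0` annihilates
`∏_{a ∈ s} (L - a) φ`. Indeed, all poles are simple, so that the resolvent of this vector is
an entire function; it vanishes at infinity, hence identically. -/
theorem apply_aeval_prod_eq_zero (hA : A ≠ 0) (hL : ∀ k φ, τ k (L φ) = A * τ (k + 1) φ)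
    (hB : ∀ k φ, ‖τ k φ‖ ≤ B φ) (s : Finset ℂ) (hs : ∀ a ∈ s, ‖a‖ = ‖A‖) (φ : V) {g : ℂ → ℂ}
    (hg : DifferentiableOn ℂ g (↑s : Set ℂ)ᶜ)
    (hgr : ∀ μ, ‖A‖ < ‖μ‖ → g μ = exteriorResolvent τ A μ φ) {N : ℕ} {D : ℝ}
    (hgD : ∀ μ, ‖μ‖ ≤ ‖A‖ → ‖g μ‖ * |‖μ‖ ^ 2 - ‖A‖ ^ 2| ^ (N + 1) ≤ D) :
    τ 0 (aeval L (∏ a ∈ s, (X - C a)) φ) = 0 := by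
  have hR : 0 < ‖A‖ := norm_pos_iff.2 hA
  have hB0 : 0 ≤ B φ := (norm_nonneg _).trans (hB 0 φ)
  have hout : ∀ μ, ‖A‖ < ‖μ‖ → ‖g μ‖ * (‖μ‖ - ‖A‖) ≤ B φ := by
    intro μ hμ
    have h1 := norm_exteriorResolvent_le hB hμ φ
    rw [inv_mul_eq_div, le_div_iff₀ (sub_pos.2 hμ)] at h1
    rwa [hgr μ hμ]
  have hpole : ∀ a ∈ s, ∃ δ > 0, ∃ b, ∀ μ ∈ Metric.ball a δ \ {a}, ‖(μ - a) * g μ‖ ≤ b := by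
    intro a ha
    have hnhds : (↑(s.erase a) : Set ℂ)ᶜ ∈ 𝓝 a :=
      (s.erase a).finite_toSet.isClosed.isOpen_compl.mem_nhds (by simp)
    obtain ⟨ρ, hρ, hρs⟩ := Metric.mem_nhds_iff.1 hnhds
    set ρ₀ := min ρ 1
    have hρ₀ : 0 < ρ₀ := lt_min hρ one_pos
    have hga : DifferentiableOn ℂ g (Metric.ball a ρ₀ \ {a}) := hg.mono fun μ hμ hmem =>
      hρs (Metric.ball_subset_ball (min_le_left _ _) hμ.1)
        (Finset.mem_coe.2 (Finset.mem_erase.2 ⟨hμ.2, hmem⟩))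
    have hC : ∀ μ ∈ Metric.ball a ρ₀ \ {a}, ‖g μ‖ * |‖μ‖ ^ 2 - ‖A‖ ^ 2| ^ (N + 1) ≤
        max D (B φ * (2 * ‖A‖ + 1) ^ (N + 1)) := by
      intro μ hμ
      rcases le_or_gt ‖μ‖ ‖A‖ with h | h
      · exact (hgD μ h).trans (le_max_left _ _)
      · have hlt : ‖μ‖ - ‖A‖ ≤ 1 := by
          have h1 := (Metric.mem_ball.1 hμ.1).trans_le (min_le_right ρ 1)
          rw [dist_eq_norm] at h1
          have h2 := norm_sub_norm_le μ a
          rw [hs a ha] at h2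
          linarith
        have h0 : 0 < ‖μ‖ - ‖A‖ := sub_pos.2 h
        have hadd : ‖μ‖ + ‖A‖ ≤ 2 * ‖A‖ + 1 := by linarith
        have e : ‖μ‖ ^ 2 - ‖A‖ ^ 2 = (‖μ‖ - ‖A‖) * (‖μ‖ + ‖A‖) := by ring
        rw [e, abs_of_pos (by positivity)]
        refine le_trans ?_ (le_max_right _ _)
        calc ‖g μ‖ * ((‖μ‖ - ‖A‖) * (‖μ‖ + ‖A‖)) ^ (N + 1)
            = (‖g μ‖ * (‖μ‖ - ‖A‖)) * (‖μ‖ - ‖A‖) ^ N * (‖μ‖ + ‖A‖) ^ (N + 1) := by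
              rw [mul_pow, pow_succ (‖μ‖ - ‖A‖)]
              ring
          _ ≤ B φ * 1 * (2 * ‖A‖ + 1) ^ (N + 1) := by
              gcongr
              · exact hout μ h
              · exact pow_le_one₀ h0.le hlt
          _ = _ := by ring
    refine exists_norm_sub_mul_le hR hρ₀ (hs a ha) hga (fun μ _ h => hout μ h) N
      ⟨min ρ₀ ‖A‖ / 2, by positivity,
        max D (B φ * (2 * ‖A‖ + 1) ^ (N + 1)) * (4 / ‖A‖) ^ (N + 1), fun μ hμ => ?_⟩
    have h1 := Metric.mem_ball.1 hμ.1
    rw [dist_eq_norm, lt_div_iff₀ two_pos, mul_comm] at h1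
    rw [norm_mul, norm_pow, mul_comm]
    exact norm_mul_pow_le_of_norm_mul_abs_pow_le hR (hs a ha) hga hC hμ.2
      (h1.trans_le (min_le_left _ _)) (h1.trans_le (min_le_right _ _))
  set P : ℂ[X] := ∏ a ∈ s, (X - C a) with hP
  set ψ := aeval L P φ
  obtain ⟨Q, hQ⟩ := exists_exteriorResolvent_aeval hL hB P φ
  obtain ⟨F, hF, hFe⟩ := exists_differentiable_extension s
    (f := fun μ => P.eval μ * g μ + Q.eval μ)
    ((P.differentiable.differentiableOn.mul hg).add Q.differentiable.differentiableOn) (by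
      intro a ha
      obtain ⟨δ, hδ, b, hb⟩ := hpole a ha
      -- cancel the factor `μ - a` of `P` against the simple pole
      have hfac : ∀ μ, P.eval μ = (∏ c ∈ s.erase a, (X - C c)).eval μ * (μ - a) := by
        intro μ
        rw [hP, ← Finset.mul_prod_erase s _ ha]
        simp [mul_comm]
      set P₁ : ℂ[X] := ∏ c ∈ s.erase a, (X - C c)
      obtain ⟨b₁, hb₁⟩ := (isCompact_closedBall a δ).exists_bound_of_continuousOn
        P₁.continuous.continuousOn
      obtain ⟨b₂, hb₂⟩ := (isCompact_closedBall a δ).exists_bound_of_continuousOn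
        Q.continuous.continuousOn
      refine ⟨δ, hδ, b₁ * b + b₂, fun μ hμ => ?_⟩
      have hμ' := Metric.ball_subset_closedBall hμ.1
      have h1 := hb₁ μ hμ'
      have h2 := hb μ hμ
      have h3 := hb₂ μ hμ'
      have h4 : 0 ≤ b₁ := (norm_nonneg _).trans h1
      calc ‖P.eval μ * g μ + Q.eval μ‖ ≤ ‖P.eval μ * g μ‖ + ‖Q.eval μ‖ := norm_add_le _ _
        _ = ‖P₁.eval μ‖ * ‖(μ - a) * g μ‖ + ‖Q.eval μ‖ := by rw [hfac, mul_assoc, norm_mul]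
        _ ≤ b₁ * b + b₂ := by gcongr)
  have hFψ : ∀ μ, ‖A‖ < ‖μ‖ → F μ = exteriorResolvent τ A μ ψ := by
    intro μ hμ
    have hμs : μ ∉ s := fun h => (hs μ h).not_gt hμ
    rw [hFe μ hμs, hQ μ hμ, hgr μ hμ]
  have hev : ∀ᶠ μ in cocompact ℂ, ‖A‖ < ‖μ‖ :=
    (tendsto_norm_cocompact_atTop (E := ℂ)).eventually_gt_atTop ‖A‖
  have hFlim : Tendsto F (cocompact ℂ) (𝓝 0) :=
    (tendsto_exteriorResolvent hB ψ).congr' (hev.mono fun μ hμ => (hFψ μ hμ).symm)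
  have hconst : ∀ μ, ‖A‖ < ‖μ‖ → exteriorResolvent τ A μ (L ψ) = τ 0 ψ := by
    intro μ hμ
    rw [exteriorResolvent_apply hL hB hμ, ← hFψ μ hμ,
      hF.apply_eq_of_tendsto_cocompact μ hFlim, mul_zero, add_zero]
  have hlim := (tendsto_exteriorResolvent (A := A) hB (L ψ)).congr'
    (hev.mono fun μ hμ => hconst μ hμ)
  exact tendsto_nhds_unique tendsto_const_nhds hlim

end ExteriorResolvent

/-! ### Continuation of the resolvent to the disc -/

section Continuation

open Polynomial

variable {V : Type*} {G : SimpleGraph V} [G.LocallyFinite] {q : ℕ} {p : ℝ} {o : V}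

theorem log_radius_pos (hq : 2 ≤ q) (hp : 0 < p) (hp2 : p < 2) : 0 < Real.log (radius q p) :=
  Real.log_pos (one_lt_radius hq hp hp2)

theorem rapidDecay_coeff (hG : G.IsTree) (hreg : G.IsRegularOfDegree (q + 1)) (hq : 2 ≤ q)
    (hp : 0 < p) (hp2 : p < 2) (Λ : Multiplier G q p o) :
    RapidDecay (Real.log (radius q p)) (coeff Λ.kernel √(q : ℝ)) fun a => (a.1 : ℤ) - a.2 := by
  intro N
  rw [Real.exp_log (zero_lt_one.trans (one_lt_radius hq hp hp2))]
  exact summable_coeff (zero_lt_one.trans_le (one_le_sqrt hq)) (sqrt_le_rpow hq hp hp2)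
    (one_le_rpow (by omega) hp) (kernel_decay hG hreg hq Λ) N

/-- In the variable `ζ = i z log q` the symbol is a Laurent series in `e^ζ`, and the strip `S_p`
becomes the closed strip `|Re ζ| ≤ log (radius q p)`. -/
theorem exists_symbol_eq_laurent (hG : G.IsTree) (hreg : G.IsRegularOfDegree (q + 1)) (hq : 2 ≤ q)
    (hp : 0 < p) (hp2 : p < 2) (Λ : Multiplier G q p o) {ζ : ℂ}
    (hζ : ζ ∈ closedStrip (Real.log (radius q p))) :
    ∃ z ∈ strip p, Λ.symbol z =
      laurent (coeff Λ.kernel √(q : ℝ)) (fun a => (a.1 : ℤ) - a.2) ζ := by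
  have hl : (Real.log q : ℂ) ≠ 0 := by
    have : (1 : ℝ) < q := by exact_mod_cast (by omega : 1 < q)
    exact_mod_cast (Real.log_pos this).ne'
  have e : Complex.I * (ζ / (Complex.I * Real.log q)) * Real.log q = ζ := by
    field_simp
  have hz : ζ / (Complex.I * Real.log q) ∈ strip p := by
    rw [← re_le_of_mem_strip hq hp hp2, e]
    exact hζ
  refine ⟨_, hz, ?_⟩
  have h := hasSum_symbol hG hreg hq hp hp2 Λ hz
  rw [e] at h
  exact h.tsum_eq.symm

omit [G.LocallyFinite] in
theorem aeval_dual_apply (Λ : Multiplier G q p o) (P : ℂ[X]) (S : TemperedDist G q p o)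
    (φ : Schwartz G q p o) :
    (aeval Λ.dual P S).1 φ = S.1 (aeval Λ.toLinearMap P φ) := by
  induction P using Polynomial.induction_on generalizing φ with
  | C a => simp [Module.algebraMap_end_apply]
  | add P₁ P₂ h₁ h₂ => simp [h₁, h₂]
  | monomial n a h =>
    have e : C a * X ^ (n + 1) = X * (C a * X ^ n) := by ring
    rw [e, map_mul (aeval Λ.dual), aeval_X, Module.End.mul_apply]
    refine (h (Λ.toLinearMap φ)).trans ?_
    rw [mul_comm X, map_mul _ (C a * X ^ n) X, aeval_X, Module.End.mul_apply]

/-- If the modulus of the symbol is at least `|A|`, and equal to `|A|` only where the symbol takes a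
value in the finite set `s`, then `∏_{a ∈ s} (Λ - a)` annihilates `T_0`. -/
theorem aeval_prod_dual_eq_zero (hG : G.IsTree) (hreg : G.IsRegularOfDegree (q + 1)) (hq : 2 ≤ q)
    (hp : 0 < p) (hp2 : p < 2) (Λ : Multiplier G q p o) {A : ℂ} (hA : A ≠ 0)
    {T : ℕ → TemperedDist G q p o} (hT : ∀ k, Λ.dual (T k) = A • T (k + 1)) {m : ℕ} {M : ℝ}
    (hM : 0 ≤ M) (hb : ∀ k (φ : Schwartz G q p o), ‖(T k).1 φ‖ ≤ M * nu G q p o m φ.1)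
    (hle : ∀ z ∈ strip p, ‖A‖ ≤ ‖Λ.symbol z‖) (s : Finset ℂ) (hs : ∀ a ∈ s, ‖a‖ = ‖A‖)
    (hmem : ∀ z ∈ strip p, ‖Λ.symbol z‖ = ‖A‖ → Λ.symbol z ∈ s) :
    aeval Λ.dual (∏ a ∈ s, (X - C a)) (T 0) = 0 := by
  refine Subtype.ext (LinearMap.ext fun φ => ?_)
  rw [aeval_dual_apply]
  set σ := Real.log (radius q p)
  have hσ : 0 < σ := log_radius_pos hq hp hp2
  have hexp : Real.exp σ = radius q p :=
    Real.exp_log (zero_lt_one.trans (one_lt_radius hq hp hp2))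
  set β := coeff Λ.kernel √(q : ℝ)
  set d : ℕ × ℕ → ℤ := fun a => (a.1 : ℤ) - a.2
  have hdecay : RapidDecay σ β d := rapidDecay_coeff hG hreg hq hp hp2 Λ
  set τ : ℕ → Schwartz G q p o →ₗ[ℂ] ℂ := fun k => (T k).1
  have hL : ∀ k φ, τ k (Λ.toLinearMap φ) = A * τ (k + 1) φ := fun k φ =>
    congrArg (fun S : TemperedDist G q p o => S.1 φ) (hT k)
  set t : ℤ → ℂ := fun j => τ 0 (chebSchwartz hG hreg hq hp hp2 j φ)
  have htb := norm_chebSchwartz_le hG hreg hq hp hp2 (hb 0) hM φ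
  rw [← hexp] at htb
  -- outside the disc the two definitions of the resolvent agree
  have hagree : ∀ μ, ‖A‖ < ‖μ‖ → (∀ ζ ∈ closedStrip σ, laurent β d ζ ≠ μ) →
      pairing β d t μ = exteriorResolvent τ A μ φ := by
    intro μ hμ hμK
    let U : Schwartz G q p o →ₗ[ℂ] ℂ :=
      { toFun := exteriorResolvent τ A μ
        map_add' := exteriorResolvent_add hb hμ
        map_smul' := exteriorResolvent_smul }
    have hU : ∀ φ, ‖U φ‖ ≤ (‖μ‖ - ‖A‖)⁻¹ * M * nu G q p o m φ.1 := fun φ => by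
      rw [mul_assoc]
      exact norm_exteriorResolvent_le hb hμ φ
    have hD : 0 ≤ (‖μ‖ - ‖A‖)⁻¹ * M := mul_nonneg (inv_nonneg.2 (sub_pos.2 hμ).le) hM
    have hu := norm_chebSchwartz_le hG hreg hq hp hp2 hU hD φ
    rw [← hexp] at hu
    have h := pairing_eq (t := t) hσ hdecay hu hμK fun j => by
      have h1 := hasSum_functional_multiplier hG hreg hq hp hp2 Λ hU hD φ j
      rwa [show U (Λ.toLinearMap (chebSchwartz hG hreg hq hp hp2 j φ)) = t j + μ *
        U (chebSchwartz hG hreg hq hp hp2 j φ) from exteriorResolvent_apply hL hb hμ _] at h1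
    rw [h, chebSchwartz_zero]
    rfl
  have hK : ∀ ζ ∈ closedStrip σ, ‖A‖ ≤ ‖laurent β d ζ‖ := by
    intro ζ hζ
    obtain ⟨z, hz, e⟩ := exists_symbol_eq_laurent hG hreg hq hp hp2 Λ hζ
    exact e ▸ hle z hz
  obtain ⟨c, hc, hpair⟩ := norm_pairing_le hσ hdecay htb
  let g : ℂ → ℂ := fun μ =>
    if ‖A‖ < ‖μ‖ then exteriorResolvent τ A μ φ else pairing β d t μ
  refine apply_aeval_prod_eq_zero (g := g) (N := m + 2 + 2)
    (D := c * ((‖A‖ + 1) * (2 * ‖A‖)) ^ (m + 2 + 3)) hA hL hb s hs φ ?_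
    (fun μ hμ => if_pos hμ) ?_
  · intro μ hμs
    rcases lt_or_ge ‖A‖ ‖μ‖ with hμ | hμ
    · have hopen : IsOpen {w : ℂ | ‖A‖ < ‖w‖} := isOpen_lt continuous_const continuous_norm
      have h1 := (differentiableOn_exteriorResolvent hA hb φ).differentiableAt (hopen.mem_nhds hμ)
      refine (h1.congr_of_eventuallyEq ?_).differentiableWithinAt
      filter_upwards [hopen.mem_nhds hμ] with w hw
      exact if_pos hw
    · have hμK : ∀ ζ ∈ closedStrip σ, laurent β d ζ ≠ μ := by
        rintro ζ hζ rfl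
        obtain ⟨z, hz, e⟩ := exists_symbol_eq_laurent hG hreg hq hp hp2 Λ hζ
        have h1 := hmem z hz (le_antisymm (by rwa [e]) (hle z hz))
        rw [e] at h1
        exact hμs h1
      refine ((differentiableAt_pairing hσ hdecay htb hμK).congr_of_eventuallyEq
        ?_).differentiableWithinAt
      obtain ⟨ε, hε, hμε⟩ := exists_pos_le_norm_laurent_sub hσ hdecay hμK
      filter_upwards [Metric.ball_mem_nhds μ hε] with w hw
      by_cases hwA : ‖A‖ < ‖w‖
      · refine (if_pos hwA).trans (hagree w hwA ?_).symm
        rintro ζ hζ rfl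
        rw [Metric.mem_ball, dist_eq_norm] at hw
        exact (hμε ζ hζ).not_gt hw
      · exact if_neg hwA
  · intro μ hμ
    have hg : g μ = pairing β d t μ := if_neg hμ.not_gt
    rcases hμ.eq_or_lt with h | h
    · rw [h, sub_self, abs_zero, zero_pow (by omega), mul_zero]
      positivity
    · have hε : 0 < ‖A‖ - ‖μ‖ := sub_pos.2 h
      have h1 := hpair μ _ hε fun ζ hζ =>
        (sub_le_sub_right (hK ζ hζ) _).trans (norm_sub_norm_le _ _)
      have hsum : ‖A‖ + ‖μ‖ ≤ 2 * ‖A‖ := by linarith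
      have hsub : ‖A‖ - ‖μ‖ + 1 ≤ ‖A‖ + 1 := by linarith [norm_nonneg μ]
      have e : |‖μ‖ ^ 2 - ‖A‖ ^ 2| = (‖A‖ - ‖μ‖) * (‖A‖ + ‖μ‖) := by
        rw [abs_sub_comm, abs_of_nonneg (by nlinarith [norm_nonneg μ])]
        ring
      rw [hg, e]
      calc ‖pairing β d t μ‖ * ((‖A‖ - ‖μ‖) * (‖A‖ + ‖μ‖)) ^ (m + 2 + 3)
          ≤ (c * (1 + 1 / (‖A‖ - ‖μ‖)) ^ (m + 2 + 3)) *
            ((‖A‖ - ‖μ‖) * (‖A‖ + ‖μ‖)) ^ (m + 2 + 3) := by gcongr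
        _ = c * ((‖A‖ - ‖μ‖ + 1) * (‖A‖ + ‖μ‖)) ^ (m + 2 + 3) := by
            rw [mul_assoc, ← mul_pow]
            congr 2
            field_simp
        _ ≤ _ := by gcongr

end Continuation

end HomogeneousTree

end

theorem theorem4p4 {X : Type*} (G : SimpleGraph X) [G.LocallyFinite] (hG : G.IsTree)
    (q : ℕ) (hq : 2 ≤ q) (hreg : G.IsRegularOfDegree (q + 1)) (o : X)
    (p : ℝ) (hp1 : 1 ≤ p) (hp2 : p < 2)
    (Λ : Multiplier G q p o) (hΛ : ∀ z ∈ strip p, Λ.symbol z ≠ 0)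
    (A : ℂ) (hA : A ≠ 0) (T : ℕ → TemperedDist G q p o)
    (hT : ∀ k : ℕ, Λ.dual (T k) = A • T (k + 1))
    (m : ℕ) (M : ℝ) (hM : 0 < M)
    (hbound : ∀ (k : ℕ) (φ : Schwartz G q p o), ‖(T k).1 φ‖ ≤ M * nu G q p o m φ.1) :
    (IsLeast ((fun z => ‖Λ.symbol z‖) '' strip p) ‖A‖ →
      ∀ (j : ℕ) (a : Fin j → ℂ), Function.Injective a →
        Set.range a = Λ.symbol '' strip p ∩ {w : ℂ | ‖w‖ = ‖A‖} →
        ∃! S : Fin j → TemperedDist G q p o,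
          T 0 = ∑ i, S i ∧ ∀ i, Λ.dual (S i) = a i • S i) ∧
    ((∀ z ∈ strip p, ‖A‖ < ‖Λ.symbol z‖) → T 0 = 0) := by
  have hp : 0 < p := zero_lt_one.trans_le hp1
  refine ⟨fun hmin j a ha hrange => ?_, fun hlt => ?_⟩
  · have hmem : ∀ w, (∃ z ∈ strip p, Λ.symbol z = w) ∧ ‖w‖ = ‖A‖ ↔ ∃ i, a i = w :=
      fun w => (Set.ext_iff.1 hrange w).symm
    obtain ⟨z₀, hz₀, he₀⟩ := hmin.1
    obtain ⟨i₀, -⟩ := (hmem (Λ.symbol z₀)).1 ⟨⟨z₀, hz₀, rfl⟩, he₀⟩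
    have hj : j ≠ 0 := fun h => (h ▸ i₀).elim0
    refine existsUnique_sum_eigenvectors Λ.dual (T 0) hj a ha ?_
    have h := aeval_prod_dual_eq_zero hG hreg hq hp hp2 Λ hA hT hM.le hbound
      (fun z hz => hmin.2 ⟨z, hz, rfl⟩) (Finset.univ.image a)
      (fun w hw => by
        obtain ⟨i, -, rfl⟩ := Finset.mem_image.1 hw
        exact ((hmem _).2 ⟨i, rfl⟩).2)
      (fun z hz hzA => by
        obtain ⟨i, hi⟩ := (hmem (Λ.symbol z)).1 ⟨⟨z, hz, rfl⟩, hzA⟩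
        exact Finset.mem_image.2 ⟨i, Finset.mem_univ i, hi⟩)
    rwa [Finset.prod_image ha.injOn] at h
  · have h := aeval_prod_dual_eq_zero hG hreg hq hp hp2 Λ hA hT hM.le hbound
      (fun z hz => (hlt z hz).le) ∅ (by simp) (fun z hz hzA => absurd hzA (hlt z hz).ne')
    simpa using h
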